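/- Let $d\ge 1$, $T>0$, $r\ge 1$, $c\in\mathbb C$ and $\varrho\in\mathbb C^d$. For $\alpha\in\mathbb N^d$ put $\mu_\alpha=2\sum_j\alpha_j\varrho_j+\sum_j\varrho_j+c$ and $\lambda_\alpha=\mu_\alpha^r$ (powers are principal branches, $\arg\in(-\pi,\pi]$), and let $h_\alpha$ be the $L^2$-normalized Hermite functions. The operators $H_{x,\varrho,c}=\sum_j\varrho_j(x_j^2-\partial_{x_j}^2)+c$, $H_{x,\varrho,c}^r$ and $e^{-itH_{x,\varrho,c}^r}$ act on formal Hermite series $\sum_\alpha a(\alpha)h_\alpha$ by multiplying the coefficients by $\mu_\alpha$, $\lambda_\alpha$ and $e^{-it\lambda_\alpha}$. Suppose that $\operatorname{Im}(\varrho_j^r)>0$ for some $j$, where, if $r$ is not an integer and $\varrho_j$ lies on the branch cut $(-\infty,0)$, it is also assumed that $\operatorname{Im}\mu_\alpha\ge 0$ for some $\alpha$. Consider the problem $$ i\partial_tu-H_{x,\varrho,c}^ru=F,\qquad u(0)=u_0,\qquad t\in[0,T], \tag{P}$$ where a solution in a space $X$ is a map $u:[0,T]\to X$ each of whose Hermite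 coefficients is absolutely continuous and solves the corresponding ordinary differential equation $i\hat u_\alpha'-\lambda_\alpha\hat u_\alpha=\hat F_\alpha$, $\hat u_\alpha(0)=\hat u_{0,\alpha}$. For a given $F$, (P) is well-posed in $X$ if every $u_0\in X$ has a unique solution $u:[0,T]\to X$ and $u$ depends continuously in $X$, uniformly on $[0,T]$, on $u_0\in X$; otherwise it is ill-posed. For $s\ge\frac12$ let $\mathcal S_s(\mathbb R^d)$, and for $s>\frac12$ let $\Sigma_s(\mathbb R^d)$, be the Gelfand–Shilov spaces of Roumieu and Beurling type, i.e. the inductive, respectively projective, limit with respect to $h>0$ of the spaces of smooth $f$ with $\sup_{\alpha,\beta,x}|x^\beta\partial^\alpha f(x)|/(h^{|\alpha|+|\beta|}(\alpha!\beta!)^s)<\infty$; $\mathscr S$ is the Schwartz space, and $'$ denotes strong duals of these spaces. Pilipović spaces: let the index $s$ be a real number $s\ge0$ or a symbol $\flat_\sigma$, $\sigma>0$, ordered by $t_1<\flat_\sigma<t_2$ when $t_1<\frac12\le t_2$ are real, and $\flat_{\sigma_1}<\flat_{\sigma_2}$ when $\sigma_1<\sigma_2$. For $\rho>0$ let $\mathcal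 H_{s;\rho}$ and $\mathcal H'_{s;\rho}$ be the spaces of formal Hermite series with $\sup_\alpha|a(\alpha)|e^{\rho|\alpha|^{1/(2s)}}<\infty$, respectively $\sup_\alpha|a(\alpha)|e^{-\rho|\alpha|^{1/(2s)}}<\infty$, if $s>0$ is real, and with $\sup_\alpha|a(\alpha)|\rho^{-|\alpha|}\alpha!^{1/(2\sigma)}<\infty$, respectively $\sup_\alpha|a(\alpha)|\rho^{-|\alpha|}\alpha!^{-1/(2\sigma)}<\infty$, if $s=\flat_\sigma$. With respect to $\rho$, $\mathcal H_s$ and $\mathcal H_{0,s}$ are the inductive and the projective limit of $\mathcal H_{s;\rho}$, and $\mathcal H_s'$ and $\mathcal H_{0,s}'$ are the projective and the inductive limit of $\mathcal H_{s;\rho}'$. Moreover $\mathcal H_0$ is the space of finite Hermite sums (inductive limit of the spaces of sums over $|\alpha|\le N$) and $\mathcal H_0'$ the space of all formal Hermite series (topology of coefficientwise convergence). The spaces $L^1([0,T];X)$ for these $X$ are the corresponding limits of $L^1([0,T];\mathcal H_{s;\rho})$ and $L^1([0,T];\mathcal H_{s;\rho}')$ (for $s=0$, with the analogous norms). Then the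 following is true. (1) For every $F$, (P) is ill-posed in $\mathscr S(\mathbb R^d)$, in $\mathcal S_s(\mathbb R^d)$ for every $s\ge\frac12$, in $\Sigma_s(\mathbb R^d)$ for every $s>\frac12$, and in the duals of all these spaces. Moreover, if $X$ is any of these spaces and (P) has at least one solution in $X$ (for example if $F=0$), then for every $t\in(0,T]$ the value $u(t)\in X$ of the solutions in $X$ fails to depend continuously on $u_0\in X$. (2) Let $s_1,s_2$ be indices with $0<s_1\le\frac1{2r}$ and $s_2<\frac1{2r}$, and let $X$ be any of $\mathcal H_{0,s_1}(\mathbb R^d)$, $\mathcal H_{s_2}(\mathbb R^d)$, $\mathcal H_{s_2}'(\mathbb R^d)$, $\mathcal H_{0,s_1}'(\mathbb R^d)$. Then (P) is well-posed in $X$ for every $F\in L^1([0,T];X)$; for every $t\in[0,T]$ the propagator $e^{-itH_{x,\varrho,c}^r}$ is a homeomorphism on $X$; and the operators $$S_1F(t)=\int_0^te^{-i(t-s)H_{x,\varrho,c}^r}F(s)\,ds,\qquad S_2F(t)=\int_0^Te^{-i(t-s)H_{x,\varrho,c}^r}F(s)\,ds$$ are continuous from $L^1([0,T];X)$ to itself.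 -/

import Mathlib

open MeasureTheory Set Filter Topology
open scoped ENNReal NNReal SchwartzMap Nat

noncomputable section

namespace Pilipovic

/-! ### Projective and inductive limits of scales of normed spaces -/

/-- A family of extended norms on a complex vector space `E`, indexed by `ρ > 0`.  The member of
index `ρ` stands for the normed space `{x : E | N ρ x < ∞}` with norm `N ρ`. -/
structure NormScale (E : Type*) [AddCommGroup E] [Module ℂ E] where
  N : {ρ : ℝ // 0 < ρ} → E → ℝ≥0∞
  add_le : ∀ ρ x y, N ρ (x + y) ≤ N ρ x + N ρ y
  smul_eq : ∀ ρ (a : ℂ) x, N ρ (a • x) = ‖a‖ₑ * N ρ x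

namespace NormScale

variable {E : Type*} [AddCommGroup E] [Module ℂ E] (S : NormScale E)

theorem zero_eq (ρ : {ρ : ℝ // 0 < ρ}) : S.N ρ 0 = 0 := by
  simpa using S.smul_eq ρ 0 0

/-- The space `{x : E | N ρ x < ∞}`. -/
def step (ρ : {ρ : ℝ // 0 < ρ}) : Submodule ℂ E where
  carrier := {x | S.N ρ x < ∞}
  zero_mem' := by simp [S.zero_eq]
  add_mem' := fun {x y} hx hy => (S.add_le ρ x y).trans_lt (ENNReal.add_lt_top.2 ⟨hx, hy⟩)
  smul_mem' := fun a x hx => by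
    rw [mem_ofPred_eq] at hx ⊢
    rw [S.smul_eq]
    exact ENNReal.mul_lt_top (by simp) hx

/-- The projective limit of the spaces `step ρ`: the elements that lie in all of them. -/
def ProjLim : Type _ := ↥(⨅ ρ, S.step ρ)

/-- The inductive limit of the spaces `step ρ`: the span of all of them (their union, when they are
nested). -/
def IndLim : Type _ := ↥(⨆ ρ, S.step ρ)

instance : AddCommGroup S.ProjLim := inferInstanceAs (AddCommGroup ↥(⨅ ρ, S.step ρ))
instance : Module ℂ S.ProjLim := inferInstanceAs (Module ℂ ↥(⨅ ρ, S.step ρ))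
instance : AddCommGroup S.IndLim := inferInstanceAs (AddCommGroup ↥(⨆ ρ, S.step ρ))
instance : Module ℂ S.IndLim := inferInstanceAs (Module ℂ ↥(⨆ ρ, S.step ρ))

/-- The underlying element of `E`. -/
def ProjLim.val : S.ProjLim →ₗ[ℂ] E := (⨅ ρ, S.step ρ).subtype

/-- The underlying element of `E`. -/
def IndLim.val : S.IndLim →ₗ[ℂ] E := (⨆ ρ, S.step ρ).subtype

theorem ProjLim.lt_top (x : S.ProjLim) (ρ : {ρ : ℝ // 0 < ρ}) : S.N ρ (ProjLim.val S x) < ∞ :=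
  (Submodule.mem_iInf _).1 x.2 ρ

/-- The norm `N ρ` on the projective limit. -/
def projSeminorm : SeminormFamily ℂ S.ProjLim {ρ : ℝ // 0 < ρ} := fun ρ =>
  Seminorm.of (fun x => (S.N ρ (ProjLim.val S x)).toReal)
    (fun x y => by
      rw [← ENNReal.toReal_add (ProjLim.lt_top S x ρ).ne (ProjLim.lt_top S y ρ).ne, map_add]
      exact ENNReal.toReal_mono
        (ENNReal.add_lt_top.2 ⟨ProjLim.lt_top S x ρ, ProjLim.lt_top S y ρ⟩).ne (S.add_le ρ _ _))
    (fun a x => by rw [map_smul, S.smul_eq, ENNReal.toReal_mul, toReal_enorm])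

/-- The seminorms on the inductive limit whose restriction to each `step ρ` is continuous for the
norm `N ρ`. -/
def IsStepContinuous (p : Seminorm ℂ S.IndLim) : Prop :=
  ∀ ρ, ∃ C : ℝ≥0, ∀ x : S.IndLim, S.N ρ (IndLim.val S x) < ∞ →
    ENNReal.ofReal (p x) ≤ C * S.N ρ (IndLim.val S x)

/-- All seminorms whose restrictions to the steps are continuous. -/
def indSeminorm : SeminormFamily ℂ S.IndLim {p : Seminorm ℂ S.IndLim // S.IsStepContinuous p} :=
  fun p => p.1

instance : Nonempty {ρ : ℝ // 0 < ρ} := ⟨⟨1, one_pos⟩⟩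

instance : Nonempty {p : Seminorm ℂ S.IndLim // S.IsStepContinuous p} :=
  ⟨⟨0, fun _ => ⟨0, fun _ _ => by simp⟩⟩⟩

/-- The projective limit topology, given by the norms `N ρ`. -/
instance : TopologicalSpace S.ProjLim := S.projSeminorm.moduleFilterBasis.topology

/-- The locally convex inductive limit topology: the finest locally convex topology for which the
inclusions of all `step ρ`, with the norm `N ρ`, are continuous. -/
instance : TopologicalSpace S.IndLim := S.indSeminorm.moduleFilterBasis.topology

/-- The scale of weighted sup norms `N ρ x = sup_i w ρ i |L i x|`, for linear functionals `L i`. -/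
def ofSup {ι : Type*} (w : {ρ : ℝ // 0 < ρ} → ι → ℝ≥0∞) (L : ι → E →ₗ[ℂ] ℂ) : NormScale E where
  N ρ x := ⨆ i, w ρ i * ‖L i x‖ₑ
  add_le ρ x y := iSup_le fun i => by
    rw [map_add]
    calc w ρ i * ‖L i x + L i y‖ₑ ≤ w ρ i * (‖L i x‖ₑ + ‖L i y‖ₑ) := by
          gcongr; exact enorm_add_le _ _
      _ = w ρ i * ‖L i x‖ₑ + w ρ i * ‖L i y‖ₑ := mul_add _ _ _
      _ ≤ _ := add_le_add (le_iSup (fun i => w ρ i * ‖L i x‖ₑ) i)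
          (le_iSup (fun i => w ρ i * ‖L i y‖ₑ) i)
  smul_eq ρ a x := by
    rw [ENNReal.mul_iSup]
    refine iSup_congr fun i => ?_
    rw [map_smul, smul_eq_mul, enorm_mul]
    ring

end NormScale

/-! ### Sequence spaces and Pilipović spaces -/

/-- Multi-indices. -/
abbrev MIdx (d : ℕ) : Type := Fin d → ℕ

/-- All complex sequences indexed by multi-indices.  The sequence `a` is identified with the formal
Hermite series `∑ a(α) h_α`. -/
abbrev Seq (d : ℕ) : Type := MIdx d → ℂ

/-- The length `|α|` of a multi-index. -/
def len {d : ℕ} (α : MIdx d) : ℕ := ∑ j, α j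

/-- The factorial `α!` of a multi-index. -/
def fact {d : ℕ} (α : MIdx d) : ℕ := ∏ j, (α j)!

/-- The index set of Pilipović spaces: the real numbers `s ≥ 0` and the symbols `♭_σ`, `σ > 0`. -/
inductive PilOrder : Type
  | real (s : ℝ≥0)
  | flat (σ : {σ : ℝ // 0 < σ})

namespace PilOrder

/-- `s < ♭_σ < t` for all reals `s < 1/2 ≤ t`, and `♭_σ < ♭_τ` for `σ < τ`. -/
protected def lt : PilOrder → PilOrder → Prop
  | real s, real t => s < t
  | real s, flat _ => s < 1 / 2
  | flat _, real t => 1 / 2 ≤ t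
  | flat σ, flat τ => σ < τ

instance : LT PilOrder := ⟨PilOrder.lt⟩

instance : LE PilOrder := ⟨fun a b => a < b ∨ a = b⟩

instance : Zero PilOrder := ⟨real 0⟩

end PilOrder

/-- The weights of the spaces of rapidly decaying sequences: `exp(ρ |α|^{1/(2s)})` for real `s > 0`,
and `ρ^{-|α|} α!^{1/(2σ)}` for `s = ♭_σ`.  For `s = 0` the weight is `∞` on `|α| > ρ`,
which forces the sequence to vanish there. -/
def decayWeight {d : ℕ} : PilOrder → {ρ : ℝ // 0 < ρ} → MIdx d → ℝ≥0∞
  | .real s, ρ, α =>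
      if s = 0 then (if (len α : ℝ) ≤ ρ then 1 else ∞)
      else ENNReal.ofReal (Real.exp (ρ * (len α : ℝ) ^ (1 / (2 * (s : ℝ)))))
  | .flat σ, ρ, α => ENNReal.ofReal ((ρ : ℝ)⁻¹ ^ len α * (fact α : ℝ) ^ (1 / (2 * (σ : ℝ))))

/-- The weights of the dual sequence spaces: `exp(-ρ |α|^{1/(2s)})` for real `s > 0`, and
`ρ^{-|α|} α!^{-1/(2σ)}` for `s = ♭_σ`.  For `s = 0` the weight vanishes on `|α| > ρ`. -/
def growthWeight {d : ℕ} : PilOrder → {ρ : ℝ // 0 < ρ} → MIdx d → ℝ≥0∞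
  | .real s, ρ, α =>
      if s = 0 then (if (len α : ℝ) ≤ ρ then 1 else 0)
      else ENNReal.ofReal (Real.exp (-(ρ : ℝ) * (len α : ℝ) ^ (1 / (2 * (s : ℝ)))))
  | .flat σ, ρ, α => ENNReal.ofReal ((ρ : ℝ)⁻¹ ^ len α * (fact α : ℝ) ^ (-(1 / (2 * (σ : ℝ)))))

/-- The scale of weighted `ℓ^∞` norms with weights `w ρ`. -/
def seqScale {d : ℕ} (w : {ρ : ℝ // 0 < ρ} → MIdx d → ℝ≥0∞) : NormScale (Seq d) :=
  NormScale.ofSup w fun α => LinearMap.proj α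

/-- The Pilipović space `𝓗_{0,s}(ℝ^d)` of Beurling type (of interest for `s > 0`). -/
abbrev HBeurling (d : ℕ) (s : PilOrder) : Type := (seqScale (d := d) (decayWeight s)).ProjLim

/-- The Pilipović space `𝓗_s(ℝ^d)` of Roumieu type; for `s = 0` the finite Hermite sums. -/
abbrev HRoumieu (d : ℕ) (s : PilOrder) : Type := (seqScale (d := d) (decayWeight s)).IndLim

/-- The Pilipović distribution space `𝓗_s'(ℝ^d)`; for `s = 0` all formal Hermite series. -/
abbrev HRoumieuDual (d : ℕ) (s : PilOrder) : Type := (seqScale (d := d) (growthWeight s)).ProjLim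

/-- The Pilipović distribution space `𝓗_{0,s}'(ℝ^d)` (of interest for `s > 0`). -/
abbrev HBeurlingDual (d : ℕ) (s : PilOrder) : Type := (seqScale (d := d) (growthWeight s)).IndLim

/-! ### The spaces `L^1([0,T]; X)` for the limits `X` of scales of weighted sequence spaces -/

/-- (Classes of) measurable functions on `[0,T]` with values in the formal Hermite series. -/
abbrev SeqFun (d : ℕ) (T : ℝ) : Type := ℝ →ₘ[volume.restrict (Icc 0 T)] Seq d

theorem measurable_seqNorm {d : ℕ} (w : {ρ : ℝ // 0 < ρ} → MIdx d → ℝ≥0∞)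
    (ρ : {ρ : ℝ // 0 < ρ}) : Measurable ((seqScale w).N ρ) :=
  Measurable.iSup fun α => ((measurable_pi_apply α).enorm).const_mul (w ρ α)

/-- The norms `∫_0^T N ρ (F(t)) dt` of `L^1([0,T]; X_ρ)`, where `X_ρ` is the weighted `ℓ^∞` space
with weight `w ρ`.  (Measurability is meant coefficientwise, which agrees with strong measurability
in the projective and inductive limits of the spaces above.) -/
def l1Scale {d : ℕ} (T : ℝ) (w : {ρ : ℝ // 0 < ρ} → MIdx d → ℝ≥0∞) : NormScale (SeqFun d T) where
  N ρ F := ∫⁻ t in Icc 0 T, (seqScale w).N ρ (F t)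
  add_le ρ F G := by
    have hF : AEMeasurable (fun t => (seqScale w).N ρ (F t)) (volume.restrict (Icc 0 T)) :=
      (measurable_seqNorm w ρ).comp_aemeasurable F.aestronglyMeasurable.aemeasurable
    rw [← lintegral_add_left' hF]
    refine lintegral_mono_ae ?_
    filter_upwards [AEEqFun.coeFn_add F G] with t ht
    rw [ht]
    exact (seqScale w).add_le ρ _ _
  smul_eq ρ a F := by
    rw [← lintegral_const_mul' _ _ (by simp)]
    refine lintegral_congr_ae ?_
    filter_upwards [AEEqFun.coeFn_smul a F] with t ht
    rw [ht]
    exact (seqScale w).smul_eq ρ a _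

/-- `L^1([0,T]; 𝓗_{0,s}(ℝ^d))`, the projective limit of the spaces `L^1([0,T]; 𝓗_{s;ρ})`. -/
abbrev L1HBeurling (d : ℕ) (T : ℝ) (s : PilOrder) : Type :=
  (l1Scale (d := d) T (decayWeight s)).ProjLim

/-- `L^1([0,T]; 𝓗_s(ℝ^d))`, the inductive limit of the spaces `L^1([0,T]; 𝓗_{s;ρ})`. -/
abbrev L1HRoumieu (d : ℕ) (T : ℝ) (s : PilOrder) : Type :=
  (l1Scale (d := d) T (decayWeight s)).IndLim

/-- `L^1([0,T]; 𝓗_s'(ℝ^d))`, the projective limit of the spaces `L^1([0,T]; 𝓗_{s;ρ}')`. -/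
abbrev L1HRoumieuDual (d : ℕ) (T : ℝ) (s : PilOrder) : Type :=
  (l1Scale (d := d) T (growthWeight s)).ProjLim

/-- `L^1([0,T]; 𝓗_{0,s}'(ℝ^d))`, the inductive limit of the spaces `L^1([0,T]; 𝓗_{s;ρ}')`. -/
abbrev L1HBeurlingDual (d : ℕ) (T : ℝ) (s : PilOrder) : Type :=
  (l1Scale (d := d) T (growthWeight s)).IndLim

/-! ### Hermite functions, Schwartz space, Gelfand–Shilov spaces and their duals -/

/-- The space `ℝ^d`. -/
abbrev Eucl (d : ℕ) : Type := EuclideanSpace ℝ (Fin d)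

/-- The Hermite function `h_n` on `ℝ`. -/
def hermite1 (n : ℕ) (x : ℝ) : ℝ :=
  Real.pi ^ (-(1 / 4 : ℝ)) * (-1) ^ n * ((2 : ℝ) ^ n * n !) ^ (-(1 / 2 : ℝ)) *
    Real.exp (x ^ 2 / 2) * iteratedDeriv n (fun y => Real.exp (-y ^ 2)) x

/-- The Hermite function `h_α(x) = π^{-d/4} (-1)^{|α|} (2^{|α|} α!)^{-1/2} e^{|x|²/2} ∂^α e^{-|x|²}`
on `ℝ^d`, written as a tensor product. -/
def hermiteFn {d : ℕ} (α : MIdx d) (x : Eucl d) : ℂ := ((∏ j, hermite1 (α j) (x j) : ℝ) : ℂ)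

/-- The derivative `∂^α` on the Schwartz space. -/
def multiDeriv {d : ℕ} (α : MIdx d) : 𝓢(Eucl d, ℂ) →ₗ[ℂ] 𝓢(Eucl d, ℂ) :=
  ((List.finRange d).map fun j =>
    ((LineDeriv.lineDerivOpCLM ℂ 𝓢(Eucl d, ℂ)
      (EuclideanSpace.single j (1 : ℝ))).toLinearMap : Module.End ℂ 𝓢(Eucl d, ℂ)) ^ α j).prod

/-- The functional `f ↦ x^β ∂^α f(x)`. -/
def gsFunctional {d : ℕ} (i : MIdx d × MIdx d × Eucl d) : 𝓢(Eucl d, ℂ) →ₗ[ℂ] ℂ where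
  toFun f := ((∏ j, (i.2.2 j) ^ i.2.1 j : ℝ) : ℂ) * multiDeriv i.1 f i.2.2
  map_add' f g := by simp [mul_add]
  map_smul' a f := by simp; ring

/-- The norms `sup |x^β ∂^α f(x)| / (h^{|α|+|β|} (α! β!)^s)`, with the supremum over all `α`, `β`,
`x`, that define the Gelfand–Shilov spaces of order `s` (all functions with a finite norm are
Schwartz functions). -/
def gsScale (d : ℕ) (s : ℝ) : NormScale 𝓢(Eucl d, ℂ) :=
  NormScale.ofSup
    (fun h i => ENNReal.ofReal
      (((h : ℝ) ^ (len i.1 + len i.2.1) * ((fact i.1 * fact i.2.1 : ℕ) : ℝ) ^ s)⁻¹))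
    gsFunctional

/-- The Gelfand–Shilov space `𝓢_s(ℝ^d)` of Roumieu type. -/
abbrev GSRoumieu (d : ℕ) (s : ℝ) : Type := (gsScale d s).IndLim

/-- The Gelfand–Shilov space `Σ_s(ℝ^d)` of Beurling type. -/
abbrev GSBeurling (d : ℕ) (s : ℝ) : Type := (gsScale d s).ProjLim

/-- The Hermite coefficients of a Schwartz function. -/
def schwartzCoef {d : ℕ} (f : 𝓢(Eucl d, ℂ)) : Seq d := fun α => ∫ x, f x * hermiteFn α x

open Classical in
/-- The Hermite coefficients `u(h_α)` of a functional `u` on a space `Φ` of functions on `ℝ^d`,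
where `ev f` is the function given by the element `f` of `Φ`.  (All `h_α` belong to the spaces `Φ`
to which this is applied, which are the Schwartz space and the nontrivial Gelfand–Shilov spaces;
the default value `0` is never used.) -/
def dualCoef {d : ℕ} {Φ : Type*} [AddCommGroup Φ] [Module ℂ Φ] [TopologicalSpace Φ]
    (ev : Φ → Eucl d → ℂ) (u : StrongDual ℂ Φ) : Seq d := fun α =>
  if h : ∃ f, ev f = hermiteFn α then u h.choose else 0

/-! ### The equation -/

/-- The eigenvalue `2⟨α,ϱ⟩ + sum(ϱ) + c` of `H_{x,ϱ,c} = ∑ ϱ_j (x_j² - ∂_j²) + c` at `h_α`. -/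
def eigen {d : ℕ} (ϱ : Fin d → ℂ) (c : ℂ) (α : MIdx d) : ℂ :=
  2 * ∑ j, (α j : ℂ) * ϱ j + ∑ j, ϱ j + c

/-- The eigenvalue of `H_{x,ϱ,c}^r` at `h_α` (principal branch of the power). -/
def eigenPow {d : ℕ} (ϱ : Fin d → ℂ) (c : ℂ) (r : ℝ) (α : MIdx d) : ℂ :=
  eigen ϱ c α ^ (r : ℂ)

/-- The multiplier of the propagator `e^{-itH^r}`, `H = H_{x,ϱ,c}`, on Hermite coefficients. -/
def propagator {d : ℕ} (ϱ : Fin d → ℂ) (c : ℂ) (r t : ℝ) (α : MIdx d) : ℂ :=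
  Complex.exp (-Complex.I * t * eigenPow ϱ c r α)

section Equation

variable {d : ℕ} (ϱ : Fin d → ℂ) (c : ℂ) (r T : ℝ)
variable {X : Type*} [AddCommGroup X] [TopologicalSpace X] (coef : X → Seq d)

/-- `u : [0,T] → X` solves `i ∂_t u - H_{x,ϱ,c}^r u = F`, `u(0) = u₀`: each Hermite coefficient of
`u` is an (absolutely continuous) solution of the corresponding ordinary differential equation,
written in integrated form.  Here `coef` gives the Hermite coefficients of the elements of `X`. -/
def IsSolution (F : ℝ → Seq d) (u₀ : X) (u : ℝ → X) : Prop :=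
  ∀ α : MIdx d, IntegrableOn (fun t => F t α) (Icc 0 T) ∧
    IntegrableOn (fun t => coef (u t) α) (Icc 0 T) ∧
    ∀ t ∈ Icc 0 T, Complex.I * (coef (u t) α - coef u₀ α) =
      ∫ s in (0 : ℝ)..t, (eigenPow ϱ c r α * coef (u s) α + F s α)

/-- The `X`-valued solutions depend continuously in `X` on the initial data in `X`, uniformly for
times in the set `J`. -/
def DependsContinuously (F : ℝ → Seq d) (J : Set ℝ) : Prop :=
  ∀ (u₀ : X) (u : ℝ → X), IsSolution ϱ c r T coef F u₀ u →
    ∀ V ∈ 𝓝 (0 : X), ∃ U ∈ 𝓝 (0 : X), ∀ (v₀ : X) (v : ℝ → X),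
      IsSolution ϱ c r T coef F v₀ v → v₀ - u₀ ∈ U → ∀ t ∈ J, v t - u t ∈ V

/-- Well-posedness in `X`, with the right-hand side `F`: all initial data in `X` have a unique
solution `u : [0,T] → X`, and it depends continuously on the initial data. -/
def WellPosed (F : ℝ → Seq d) : Prop :=
  (∀ u₀ : X, ∃ u : ℝ → X, IsSolution ϱ c r T coef F u₀ u ∧
    ∀ v : ℝ → X, IsSolution ϱ c r T coef F u₀ v → EqOn v u (Icc 0 T)) ∧
  DependsContinuously ϱ c r T coef F (Icc 0 T)

/-- Ill-posedness in `X`: for no right-hand side is the problem well-posed and, moreover, whenever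
there are `X`-valued solutions at all (as for `F = 0`), their values at any fixed time
`t ∈ (0,T]` do not depend continuously on the initial data. -/
def IllPosed : Prop :=
  ∀ F : ℝ → Seq d, ¬ WellPosed ϱ c r T coef F ∧
    ((∃ (u₀ : X) (u : ℝ → X), IsSolution ϱ c r T coef F u₀ u) →
      ∀ t ∈ Ioc 0 T, ¬ DependsContinuously ϱ c r T coef F {t})

variable [Module ℂ X]
variable {Y : Type*} [AddCommGroup Y] [TopologicalSpace Y] [Module ℂ Y] (fn : Y → ℝ → Seq d)

/-- The positive statement for a space `X` and the associated space `Y = L^1([0,T]; X)`: the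
problem is well-posed in `X` for all `F ∈ Y`; the propagators `e^{-itH^r}` are homeomorphisms of
`X`, and the operators
`S₁ F(t) = ∫_0^t e^{-i(t-s)H^r} F(s) ds` and `S₂ F(t) = ∫_0^T e^{-i(t-s)H^r} F(s) ds` are continuous
on `Y`. -/
def WellPosedWithPropagators : Prop :=
  (∀ F : Y, WellPosed ϱ c r T coef (fn F)) ∧
  (∀ t ∈ Icc 0 T, ∃ E : X ≃L[ℂ] X, ∀ u₀ α, coef (E u₀) α = propagator ϱ c r t α * coef u₀ α) ∧
  (∃ S₁ : Y →L[ℂ] Y, ∀ F : Y, ∀ᵐ t ∂volume.restrict (Icc 0 T), ∀ α,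
    fn (S₁ F) t α = ∫ s in (0 : ℝ)..t, propagator ϱ c r (t - s) α * fn F s α) ∧
  (∃ S₂ : Y →L[ℂ] Y, ∀ F : Y, ∀ᵐ t ∂volume.restrict (Icc 0 T), ∀ α,
    fn (S₂ F) t α = ∫ s in (0 : ℝ)..T, propagator ϱ c r (t - s) α * fn F s α)

end Equation

end Pilipovic

end

noncomputable section

namespace Pilipovic

/-! ### Continuous linear maps between limits of scales -/

namespace NormScale

variable {E E' : Type*} [AddCommGroup E] [Module ℂ E] [AddCommGroup E'] [Module ℂ E']
  (S : NormScale E) (S' : NormScale E')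

/-! In Hermite coefficients the problem is diagonal. Two solutions with the same right-hand side
differ, in the coefficient of index `α`, by the factor `exp (-itλ_α)` times the initial difference
(`IsSolution.coef_sub`), and this factor has modulus `exp (t Im λ_α)`. Everything depends on how
this size compares with the topology of the space.

Ill-posedness. Along a ray `α + k e_j` the eigenvalue of the harmonic operator is `2k (ϱ_j + o(1))`,
so `Im λ` is at least `L k` for some `L > 0`, because `r ≥ 1` (`exists_ray_growth`). The propagator
thus grows at least exponentially in the degree. In all the spaces of the first statement, a Hermite
function of degree `k` times `exp (-δ k)` tends to zero, while multiples of it of size at least `exp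
(δ k)` eventually avoid some neighbourhood of zero. Adding small multiples of eigenvectors to a
solution then destroys continuity at any `t > 0` (`illPosed_of_eigenvectors`). The upper bounds come
from the ladder relations: a word of length `n` in positions and derivatives applied to `h_α` is at
most `C exp (δ |α|) K ^ n √(n!)` with `δ` arbitrarily small (`exists_wordBound_le`), and `√(n!)`
matches the Gelfand–Shilov threshold `s = 1/2`. The lower bounds come from orthonormality, as the
`L^1` norm is continuous on each test space and controls all coefficients with a polynomial loss.
The structure `HermiteTestSpace` collects these facts and treats a space and its strong dual at the
same time.

Well-posedness. Since `|λ_α| ≤ B (|α| + 1) ^ r`, all multipliers that occur for times in `[0,T]` are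
at most `exp (A (|α| + 1) ^ r)`. Passing from one weight of the scale to another absorbs this
factor: for `1/(2s) ≥ r` if the parameter `ρ` may be worsened at will, and for `1/(2s) > r` if only
an arbitrarily small part of it may be lost (`AbsorbsExp`). For the indices `♭_σ` this forces `r =
1`, and the factor is then a rescaling of `ρ`. Solvability, equicontinuity and the Duhamel operators
all follow from this single majorant (`wellPosedWithPropagators_of_stable`). -/

theorem withSeminorms_projLim : WithSeminorms S.projSeminorm := ⟨rfl⟩

theorem withSeminorms_indLim : WithSeminorms S.indSeminorm := ⟨rfl⟩

instance : IsTopologicalAddGroup S.ProjLim := S.withSeminorms_projLim.topologicalAddGroup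

theorem ProjLim.val_injective : Function.Injective (ProjLim.val S) := Subtype.val_injective

theorem IndLim.val_injective : Function.Injective (IndLim.val S) := Subtype.val_injective

theorem ProjLim.val_mem (x : S.ProjLim) : ProjLim.val S x ∈ ⨅ ρ, S.step ρ := x.2

theorem IndLim.val_mem (x : S.IndLim) : IndLim.val S x ∈ ⨆ ρ, S.step ρ := x.2

variable {S}

theorem projSeminorm_apply (ρ : {ρ : ℝ // 0 < ρ}) (x : S.ProjLim) :
    S.projSeminorm ρ x = (S.N ρ (ProjLim.val S x)).toReal := rfl

/-- The limit is a supremum of submodules, so its elements are finite sums of elements of steps. No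
nesting of the steps is assumed. -/
theorem IndLim.induction {P : S.IndLim → Prop} (x : S.IndLim)
    (step : ∀ ρ, ∀ y : S.IndLim, S.N ρ (IndLim.val S y) < ∞ → P y)
    (add : ∀ y z, P y → P z → P (y + z)) : P x := by
  obtain ⟨x, hx⟩ := x
  refine Submodule.iSup_induction' S.step (motive := fun y hy => P ⟨y, hy⟩) ?_ ?_ ?_ hx
  · intro ρ y hy
    exact step ρ _ hy
  · refine step ⟨1, one_pos⟩ _ ?_
    change S.N _ 0 < ∞
    simp [S.zero_eq]
  · intro y z hy hz h1 h2
    exact add ⟨y, hy⟩ ⟨z, hz⟩ h1 h2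

/-- A linear map that is bounded between steps induces a continuous map of projective limits. -/
theorem exists_projMap (D : Submodule ℂ E) (hD : ⨅ ρ, S.step ρ ≤ D) (L : D →ₗ[ℂ] E')
    (h : ∀ ρ, ∃ ρ', ∃ K : ℝ≥0, ∀ x : D, S'.N ρ (L x) ≤ K * S.N ρ' x) :
    ∃ Lc : S.ProjLim →L[ℂ] S'.ProjLim,
      ∀ x, ProjLim.val S' (Lc x) = L ⟨ProjLim.val S x, hD (ProjLim.val_mem S x)⟩ := by
  have hmem : ∀ x : S.ProjLim, L ⟨ProjLim.val S x, hD (ProjLim.val_mem S x)⟩ ∈ ⨅ ρ, S'.step ρ := by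
    intro x
    refine (Submodule.mem_iInf _).2 fun ρ => ?_
    obtain ⟨ρ', K, hK⟩ := h ρ
    exact (hK _).trans_lt (ENNReal.mul_lt_top (by simp) (ProjLim.lt_top S x ρ'))
  let L' : S.ProjLim →ₗ[ℂ] S'.ProjLim :=
    { toFun := fun x => ⟨_, hmem x⟩
      map_add' := fun x y => Subtype.ext (by
        change L _ = L _ + L _
        rw [← map_add]; rfl)
      map_smul' := fun a x => Subtype.ext (by
        change L _ = a • L _
        rw [← map_smul]; rfl) }
  have hcont : Continuous L' := by
    refine WithSeminorms.continuous_of_isBounded S.withSeminorms_projLim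
      S'.withSeminorms_projLim L' fun ρ => ?_
    obtain ⟨ρ', K, hK⟩ := h ρ
    refine ⟨{ρ'}, K, fun x => ?_⟩
    rw [Finset.sup_singleton]
    change (S'.N ρ (L _)).toReal ≤ K * (S.N ρ' (ProjLim.val S x)).toReal
    have := ENNReal.toReal_mono (ENNReal.mul_lt_top (by simp) (ProjLim.lt_top S x ρ')).ne
      (hK ⟨ProjLim.val S x, hD (ProjLim.val_mem S x)⟩)
    simpa [ENNReal.toReal_mul] using this
  exact ⟨⟨L', hcont⟩, fun x => rfl⟩

/-- A linear map that is bounded between steps induces a continuous map of inductive limits. -/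
theorem exists_indMap (D : Submodule ℂ E) (hD : ⨆ ρ, S.step ρ ≤ D) (L : D →ₗ[ℂ] E')
    (h : ∀ ρ, ∃ ρ', ∃ K : ℝ≥0, ∀ x : D, S'.N ρ' (L x) ≤ K * S.N ρ x) :
    ∃ Lc : S.IndLim →L[ℂ] S'.IndLim,
      ∀ x, IndLim.val S' (Lc x) = L ⟨IndLim.val S x, hD (IndLim.val_mem S x)⟩ := by
  have hmem : ∀ x : S.IndLim, L ⟨IndLim.val S x, hD (IndLim.val_mem S x)⟩ ∈ ⨆ ρ, S'.step ρ := by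
    intro x
    refine IndLim.induction (P := fun x : S.IndLim =>
      L ⟨IndLim.val S x, hD (IndLim.val_mem S x)⟩ ∈ ⨆ ρ, S'.step ρ) x ?_ ?_
    · intro ρ y hy
      obtain ⟨ρ', K, hK⟩ := h ρ
      exact le_iSup S'.step ρ' ((hK ⟨IndLim.val S y, _⟩).trans_lt
        (ENNReal.mul_lt_top (by simp) hy))
    · intro y z hy hz
      have := add_mem hy hz
      rw [← map_add] at this
      exact this
  let L' : S.IndLim →ₗ[ℂ] S'.IndLim :=
    { toFun := fun x => ⟨_, hmem x⟩
      map_add' := fun x y => Subtype.ext (by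
        change L _ = L _ + L _
        rw [← map_add]; rfl)
      map_smul' := fun a x => Subtype.ext (by
        change L _ = a • L _
        rw [← map_smul]; rfl) }
  have hcont : Continuous L' := by
    refine WithSeminorms.continuous_of_isBounded S.withSeminorms_indLim
      S'.withSeminorms_indLim L' fun p => ?_
    -- The defining family contains every step-continuous seminorm, so the pullback of `p` is itself
    -- a member of it and bounds itself.
    have hp : S.IsStepContinuous (p.1.comp L') := by
      intro ρ
      obtain ⟨ρ', K, hK⟩ := h ρ
      obtain ⟨C, hC⟩ := p.2 ρ'
      refine ⟨C * K, fun x hx => ?_⟩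
      have h1 := hK ⟨IndLim.val S x, hD (IndLim.val_mem S x)⟩
      have h2 := hC (L' x) (h1.trans_lt (ENNReal.mul_lt_top (by simp) hx))
      refine h2.trans ?_
      rw [ENNReal.coe_mul, mul_assoc]
      gcongr
      exact h1
    refine ⟨{⟨_, hp⟩}, 1, fun x => ?_⟩
    rw [Finset.sup_singleton, one_smul]
    rfl
  exact ⟨⟨L', hcont⟩, fun x => rfl⟩

/-- A neighbourhood of zero involves only finitely many seminorms, so equicontinuity at zero can be
tested on one seminorm at a time. -/
theorem _root_.WithSeminorms.exists_nhds_forall_mem {X ι J : Type*} [AddCommGroup X] [Module ℂ X]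
    [TopologicalSpace X] [Nonempty ι] {p : SeminormFamily ℂ X ι} (hp : WithSeminorms p)
    (L : J → X → X)
    (h : ∀ i, ∀ r > 0, ∃ U ∈ 𝓝 (0 : X), ∀ x ∈ U, ∀ t, p i (L t x) < r)
    (V : Set X) (hV : V ∈ 𝓝 (0 : X)) : ∃ U ∈ 𝓝 (0 : X), ∀ x ∈ U, ∀ t, L t x ∈ V := by
  obtain ⟨s, r, hr, hs⟩ := (hp.mem_nhds_iff 0 V).1 hV
  choose U hU hUx using fun i => h i r hr
  refine ⟨⋂ i ∈ s, U i, (Filter.biInter_finset_mem s).2 fun i _ => hU i, fun x hx t => hs ?_⟩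
  rw [Seminorm.mem_ball_zero]
  exact Seminorm.finset_sup_apply_lt hr fun i hi => hUx i x (mem_iInter₂.1 hx i hi) t

/-- A family of linear maps that is uniformly bounded between steps is equicontinuous on the
projective limit. -/
theorem projLim_equicontinuous {J : Type*} (L : J → S.ProjLim → S.ProjLim)
    (h : ∀ ρ, ∃ ρ', ∃ K : ℝ≥0, ∀ t x,
      S.N ρ (ProjLim.val S (L t x)) ≤ K * S.N ρ' (ProjLim.val S x))
    (V : Set S.ProjLim) (hV : V ∈ 𝓝 (0 : S.ProjLim)) :
    ∃ U ∈ 𝓝 (0 : S.ProjLim), ∀ x ∈ U, ∀ t, L t x ∈ V := by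
  refine S.withSeminorms_projLim.exists_nhds_forall_mem L (fun ρ r hr => ?_) V hV
  obtain ⟨ρ', K, hK⟩ := h ρ
  have hc := S.withSeminorms_projLim.continuous_seminorm ρ'
  have : Tendsto (fun x => K * S.projSeminorm ρ' x) (𝓝 0) (𝓝 0) := by
    have := (hc.const_mul (K : ℝ)).tendsto (x := 0)
    simpa using this
  refine ⟨{x | K * S.projSeminorm ρ' x < r}, this.eventually (gt_mem_nhds hr), fun x hx t => ?_⟩
  refine lt_of_le_of_lt ?_ hx
  have := ENNReal.toReal_mono (ENNReal.mul_lt_top (by simp) (ProjLim.lt_top S x ρ')).ne (hK t x)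
  simpa [ENNReal.toReal_mul, projSeminorm_apply] using this

/-- A family of linear maps that is uniformly bounded between steps is equicontinuous on the
inductive limit. -/
theorem indLim_equicontinuous {J : Type*} [Nonempty J] (L : J → S.IndLim →ₗ[ℂ] S.IndLim)
    (h : ∀ ρ, ∃ ρ', ∃ K : ℝ≥0, ∀ t x,
      S.N ρ' (IndLim.val S (L t x)) ≤ K * S.N ρ (IndLim.val S x))
    (V : Set S.IndLim) (hV : V ∈ 𝓝 (0 : S.IndLim)) :
    ∃ U ∈ 𝓝 (0 : S.IndLim), ∀ x ∈ U, ∀ t, L t x ∈ V := by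
  refine S.withSeminorms_indLim.exists_nhds_forall_mem (fun t => L t) (fun p r hr => ?_) V hV
  have key : ∀ ρ, ∃ C : ℝ≥0, ∀ x : S.IndLim, S.N ρ (IndLim.val S x) < ∞ → ∀ t,
      ENNReal.ofReal (p.1 (L t x)) ≤ C * S.N ρ (IndLim.val S x) := by
    intro ρ
    obtain ⟨ρ', K, hK⟩ := h ρ
    obtain ⟨C, hC⟩ := p.2 ρ'
    refine ⟨C * K, fun x hx t => ?_⟩
    refine (hC _ ((hK t x).trans_lt (ENNReal.mul_lt_top (by simp) hx))).trans ?_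
    rw [ENNReal.coe_mul, mul_assoc]
    gcongr
    exact hK t x
  have hbdd : ∀ x, BddAbove (range fun t => p.1 (L t x)) := by
    intro x
    refine IndLim.induction (P := fun x => BddAbove (range fun t => p.1 (L t x))) x ?_ ?_
    · intro ρ y hy
      obtain ⟨C, hC⟩ := key ρ
      refine ⟨(C * S.N ρ (IndLim.val S y)).toReal, ?_⟩
      rintro _ ⟨t, rfl⟩
      exact (ENNReal.ofReal_le_iff_le_toReal (ENNReal.mul_lt_top (by simp) hy).ne).1 (hC y hy t)
    · rintro y z ⟨a, ha⟩ ⟨b, hb⟩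
      refine ⟨a + b, ?_⟩
      rintro _ ⟨t, rfl⟩
      simp only [map_add]
      exact (map_add_le_add p.1 _ _).trans (add_le_add (ha ⟨t, rfl⟩) (hb ⟨t, rfl⟩))
  -- The supremum over the whole family of maps is finite by `hbdd` and again step-continuous. It is
  -- therefore a continuous seminorm, and its ball serves all `t` at once.
  let q : Seminorm ℂ S.IndLim := Seminorm.of (fun x => ⨆ t, p.1 (L t x))
    (fun x y => ciSup_le fun t => by
      rw [map_add]
      exact (map_add_le_add p.1 _ _).trans (add_le_add (le_ciSup (hbdd x) t) (le_ciSup (hbdd y) t)))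
    (fun a x => by
      rw [Real.mul_iSup_of_nonneg (norm_nonneg a)]
      exact iSup_congr fun t => by rw [map_smul, map_smul_eq_mul])
  have hq : S.IsStepContinuous q := by
    intro ρ
    obtain ⟨C, hC⟩ := key ρ
    refine ⟨C, fun x hx => ?_⟩
    have hfin := (ENNReal.mul_lt_top (ENNReal.coe_lt_top (r := C)) hx).ne
    rw [ENNReal.ofReal_le_iff_le_toReal hfin]
    exact ciSup_le fun t => (ENNReal.ofReal_le_iff_le_toReal hfin).1 (hC x hx t)
  have hc := S.withSeminorms_indLim.continuous_seminorm ⟨q, hq⟩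
  have : Tendsto q (𝓝 0) (𝓝 0) := by
    have := hc.tendsto 0
    rw [map_zero] at this
    exact this
  refine ⟨{x | q x < r}, this.eventually (gt_mem_nhds hr), fun x hx t => ?_⟩
  exact lt_of_le_of_lt (le_ciSup (hbdd x) t) hx

end NormScale

/-! ### The scalar equation -/

/-- The integral equation makes an integrable `z` continuous and then differentiable, after which
`exp (itl) z` has zero derivative. -/
theorem eq_exp_mul_of_integral_eq {T : ℝ} {l z₀ : ℂ} {z : ℝ → ℂ}
    (hz : IntegrableOn z (Icc 0 T))
    (h : ∀ t ∈ Icc 0 T, Complex.I * (z t - z₀) = ∫ s in (0 : ℝ)..t, l * z s) :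
    ∀ t ∈ Icc 0 T, z t = Complex.exp (-Complex.I * t * l) * z₀ := by
  intro t ht
  have hT : (0 : ℝ) ≤ T := ht.1.trans ht.2
  have hzc : ContinuousOn z (Icc 0 T) := by
    have hc : ContinuousOn (fun t => z₀ - Complex.I * ∫ s in (0 : ℝ)..t, l * z s) (Icc 0 T) := by
      have := intervalIntegral.continuousOn_primitive_interval (μ := volume) (a := 0) (b := T)
        (f := fun s => l * z s) (by rw [uIcc_of_le hT]; exact hz.const_mul l)
      rw [uIcc_of_le hT] at this
      exact continuousOn_const.sub (continuousOn_const.mul this)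
    refine hc.congr fun t ht => ?_
    simp only
    rw [← h t ht, ← mul_assoc, Complex.I_mul_I]
    ring
  -- Extending `z` by constants to a continuous function on the line lets the fundamental theorem of
  -- calculus apply at every point, endpoints included.
  let w : ℝ → ℂ := IccExtend hT (domRestrict (Icc 0 T) z)
  have hw : Continuous w := (continuousOn_iff_continuous_domRestrict.1 hzc).Icc_extend'
  have hwz : ∀ s ∈ Icc 0 T, w s = z s := fun s hs => by
    exact IccExtend_of_mem hT _ hs
  have hint : ∀ t ∈ Icc 0 T, z t = z₀ - Complex.I * ∫ s in (0 : ℝ)..t, l * w s := by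
    intro t ht
    rw [intervalIntegral.integral_congr (g := fun s => l * z s) fun s hs => by
      rw [uIcc_of_le ht.1] at hs
      simp only
      rw [hwz s ⟨hs.1, hs.2.trans ht.2⟩], ← h t ht, ← mul_assoc, Complex.I_mul_I]
    ring
  have hd : ∀ t : ℝ, HasDerivAt (fun t : ℝ => Complex.exp (Complex.I * t * l) *
      (z₀ - Complex.I * ∫ s in (0 : ℝ)..t, l * w s))
      (Complex.exp (Complex.I * t * l) * (Complex.I * l) *
        (z₀ - Complex.I * ∫ s in (0 : ℝ)..t, l * w s) +
        Complex.exp (Complex.I * t * l) * (-(Complex.I * (l * w t)))) t := by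
    intro t
    have h1 : HasDerivAt (fun t : ℝ => Complex.exp (Complex.I * t * l))
        (Complex.exp (Complex.I * t * l) * (Complex.I * l)) t := by
      have : HasDerivAt (fun t : ℝ => Complex.I * t * l) (Complex.I * l) t := by
        simpa using ((Complex.ofRealCLM.hasDerivAt (x := t)).const_mul Complex.I).mul_const l
      exact this.cexp
    have h2 := (((continuous_const.mul hw).integral_hasStrictDerivAt 0 t).hasDerivAt.const_mul
      Complex.I).const_sub z₀ (f := fun t : ℝ => Complex.I * ∫ s in (0 : ℝ)..t, l * w s)
    exact h1.mul h2
  have hconst := constant_of_has_deriv_right_zero (a := 0) (b := T)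
    (fun t _ => (hd t).continuousAt.continuousWithinAt) (fun t ht => by
      have := (hd t).hasDerivWithinAt (s := Ici t)
      rw [← hint t ⟨ht.1, ht.2.le⟩, hwz t ⟨ht.1, ht.2.le⟩] at this
      convert this using 1
      ring) t ht
  simp only [← hint t ht, intervalIntegral.integral_same] at hconst
  have he : Complex.exp (-Complex.I * t * l) * Complex.exp (Complex.I * t * l) = 1 := by
    rw [← Complex.exp_add]; simp
  calc z t = Complex.exp (-Complex.I * t * l) * (Complex.exp (Complex.I * t * l) * z t) := by
        rw [← mul_assoc, he, one_mul]
    _ = _ := by rw [hconst]; simp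

theorem hasDerivAt_cexp_mul (l : ℂ) (t : ℝ) :
    HasDerivAt (fun t : ℝ => Complex.exp (-Complex.I * t * l))
      (Complex.exp (-Complex.I * t * l) * (-Complex.I * l)) t := by
  have : HasDerivAt (fun t : ℝ => -Complex.I * t * l) (-Complex.I * l) t := by
    simpa using ((Complex.ofRealCLM.hasDerivAt (x := t)).const_mul (-Complex.I)).mul_const l
  exact this.cexp

theorem continuous_cexp_mul (l : ℂ) : Continuous fun t : ℝ => Complex.exp (-Complex.I * t * l) := by
  fun_prop

theorem integral_mul_exp (l z₀ : ℂ) (t : ℝ) :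
    Complex.I * (Complex.exp (-Complex.I * t * l) * z₀ - z₀) =
      ∫ s in (0 : ℝ)..t, l * (Complex.exp (-Complex.I * s * l) * z₀) := by
  have := intervalIntegral.integral_eq_sub_of_hasDerivAt (a := 0) (b := t)
    (fun s _ => ((hasDerivAt_cexp_mul l s).const_mul Complex.I).mul_const z₀)
    (Continuous.intervalIntegrable (by fun_prop) _ _)
  simp only [Complex.ofReal_zero, mul_zero, zero_mul, Complex.exp_zero, mul_one] at this
  rw [mul_sub, ← mul_assoc, ← this]
  congr 1 with s
  linear_combination (-Complex.exp (-Complex.I * s * l) * l * z₀) * Complex.I_mul_I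

theorem norm_cexp_mul_le (l : ℂ) {t T : ℝ} (ht : |t| ≤ T) :
    ‖Complex.exp (-Complex.I * t * l)‖ ≤ Real.exp (T * ‖l‖) := by
  rw [Complex.norm_exp]
  refine Real.exp_le_exp.2 ((Complex.re_le_norm _).trans ?_)
  rw [norm_mul, norm_mul, norm_neg, Complex.norm_I, one_mul, Complex.norm_real, Real.norm_eq_abs]
  gcongr

/-- The inhomogeneous scalar equation with vanishing initial value. -/
theorem exists_scalar_solution {T : ℝ} (l : ℂ) {f : ℝ → ℂ} (hf : IntegrableOn f (Icc 0 T)) :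
    ∃ y : ℝ → ℂ, IntegrableOn y (Icc 0 T) ∧
      (∀ t ∈ Icc 0 T, Complex.I * y t = ∫ s in (0 : ℝ)..t, (l * y s + f s)) ∧
      ∀ t ∈ Icc 0 T, ‖y t‖ ≤ Real.exp (3 * (T * ‖l‖)) * ∫ s in Icc 0 T, ‖f s‖ := by
  let g : ℝ → ℂ := indicator (Icc 0 T) f
  have hg : Integrable g := hf.integrable_indicator measurableSet_Icc
  let K : ℝ → ℂ := fun t => ∫ s in (0 : ℝ)..t, g s
  have hK : Continuous K := intervalIntegral.continuous_primitive (fun a b => hg.intervalIntegrable) 0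
  let P : ℝ → ℂ := fun t => ∫ s in (0 : ℝ)..t, Complex.exp (Complex.I * s * l) * K s
  have hPd : ∀ t : ℝ, HasDerivAt P (Complex.exp (Complex.I * t * l) * K t) t := fun t =>
    (Continuous.integral_hasStrictDerivAt (by fun_prop) 0 t).hasDerivAt
  have hP : Continuous P := continuous_iff_continuousAt.2 fun t => (hPd t).continuousAt
  -- This is Duhamel's integral `-i ∫ exp (-i(t-s)l) f(s) ds` after an integration by parts that
  -- moves the derivative off the primitive `K`. Since `K` is continuous, the remaining integral is
  -- differentiable everywhere although `f` is only integrable.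
  let y : ℝ → ℂ := fun t =>
    -Complex.I * K t - l * (Complex.exp (-Complex.I * t * l) * P t)
  have hy : Continuous y := by fun_prop
  have hKb : ∀ t ∈ Icc 0 T, ‖K t‖ ≤ ∫ s in Icc 0 T, ‖f s‖ := by
    intro t ht
    refine (intervalIntegral.norm_integral_le_integral_norm ht.1).trans ?_
    rw [intervalIntegral.integral_of_le ht.1]
    calc ∫ s in Ioc 0 t, ‖g s‖ ≤ ∫ s, ‖g s‖ :=
          setIntegral_le_integral hg.norm (Eventually.of_forall fun s => norm_nonneg _)
      _ = _ := by
        rw [← integral_indicator measurableSet_Icc]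
        congr 1 with s
        exact norm_indicator_eq_indicator_norm _ _
  have hPb : ∀ t ∈ Icc 0 T, ‖P t‖ ≤ (Real.exp (T * ‖l‖) * ∫ s in Icc 0 T, ‖f s‖) * T := by
    intro t ht
    have := intervalIntegral.norm_integral_le_of_norm_le_const (a := 0) (b := t)
      (f := fun s : ℝ => Complex.exp (Complex.I * s * l) * K s)
      (C := Real.exp (T * ‖l‖) * ∫ s in Icc 0 T, ‖f s‖) fun s hs => by
        rw [uIoc_of_le ht.1] at hs
        have hs' : s ∈ Icc 0 T := ⟨hs.1.le, hs.2.trans ht.2⟩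
        rw [norm_mul]
        gcongr
        · have := norm_cexp_mul_le l (t := -s) (T := T) (by rw [abs_neg, abs_of_nonneg hs'.1]; exact hs'.2)
          simpa using this
        · exact hKb s hs'
    refine this.trans ?_
    rw [sub_zero, abs_of_nonneg ht.1]
    have : 0 ≤ Real.exp (T * ‖l‖) * ∫ s in Icc 0 T, ‖f s‖ :=
      mul_nonneg (Real.exp_nonneg _) (integral_nonneg fun _ => norm_nonneg _)
    exact mul_le_mul_of_nonneg_left ht.2 this
  refine ⟨y, hy.continuousOn.integrableOn_Icc, fun t ht => ?_, fun t ht => ?_⟩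
  · have hfg : ∫ s in (0 : ℝ)..t, f s = K t := by
      refine intervalIntegral.integral_congr fun s hs => ?_
      rw [uIcc_of_le ht.1] at hs
      simp [g, indicator_of_mem (show s ∈ Icc 0 T from ⟨hs.1, hs.2.trans ht.2⟩)]
    have hfi : IntervalIntegrable f volume 0 t :=
      (intervalIntegrable_iff_integrableOn_Icc_of_le ht.1).2
        (hf.mono_set (Icc_subset_Icc_right ht.2))
    rw [intervalIntegral.integral_add ((by fun_prop : Continuous fun s => l * y s).intervalIntegrable _ _) hfi, hfg]
    have := intervalIntegral.integral_eq_sub_of_hasDerivAt (a := 0) (b := t)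
      (f := fun s => Complex.I * (-l * (Complex.exp (-Complex.I * s * l) * P s)))
      (f' := fun s => l * y s)
      (fun s _ => by
        have h1 := (((hasDerivAt_cexp_mul l s).mul (hPd s)).const_mul (-l)).const_mul Complex.I
        refine h1.congr_deriv ?_
        have he : Complex.exp (-Complex.I * s * l) * Complex.exp (Complex.I * s * l) = 1 := by
          rw [← Complex.exp_add]; simp
        simp only [y]
        linear_combination (-(Complex.I * l * K s)) * he +
          (l ^ 2 * Complex.exp (-Complex.I * s * l) * P s) * Complex.I_mul_I)
      ((by fun_prop : Continuous fun s => l * y s).intervalIntegrable _ _)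
    rw [this]
    have h0 : P 0 = 0 := intervalIntegral.integral_same
    simp only [h0, y]
    linear_combination (-K t) * Complex.I_mul_I
  · set A := ∫ s in Icc 0 T, ‖f s‖ with hA
    have hA0 : 0 ≤ A := integral_nonneg fun _ => norm_nonneg _
    have hT : 0 ≤ T := ht.1.trans ht.2
    set a := T * ‖l‖ with ha
    have ha0 : 0 ≤ a := by positivity
    have h1 : ‖y t‖ ≤ A + ‖l‖ * (Real.exp a * ((Real.exp a * A) * T)) := by
      refine (norm_sub_le _ _).trans (add_le_add ?_ ?_)
      · simpa using hKb t ht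
      · rw [norm_mul, norm_mul]
        gcongr
        · exact norm_cexp_mul_le l (by rw [abs_of_nonneg ht.1]; exact ht.2)
        · exact hPb t ht
    refine h1.trans ?_
    -- The origin of the factor `3` in the majorant: the integrated-by-parts formula costs two
    -- exponentials and a linear factor `a = T‖l‖`.
    have h2 : 1 + a * Real.exp (2 * a) ≤ Real.exp (3 * a) := by
      have e3 : Real.exp (3 * a) = Real.exp a * Real.exp (2 * a) := by
        rw [← Real.exp_add]; ring_nf
      have e1 := Real.add_one_le_exp a
      have e2 : 1 ≤ Real.exp (2 * a) := Real.one_le_exp (by positivity)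
      rw [e3]
      nlinarith
    have e2 : Real.exp (2 * a) = Real.exp a * Real.exp a := by rw [← Real.exp_add]; ring_nf
    calc A + ‖l‖ * (Real.exp a * ((Real.exp a * A) * T)) = (1 + a * Real.exp (2 * a)) * A := by
          rw [e2, ha]; ring
      _ ≤ _ := by gcongr

/-! ### Duhamel operators on coefficientwise integrable functions -/

/-- The functions with integrable coefficients. -/
def coefIntegrable (d : ℕ) (T : ℝ) : Submodule ℂ (SeqFun d T) where
  carrier := {F | ∀ α, Integrable (fun t => F t α) (volume.restrict (Icc 0 T))}
  zero_mem' α := (integrable_zero _ ℂ _).congr (by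
    filter_upwards [AEEqFun.coeFn_zero (μ := volume.restrict (Icc 0 T)) (β := Seq d)] with t ht
    rw [ht]; rfl)
  add_mem' {F G} hF hG α := ((hF α).add (hG α)).congr (by
    filter_upwards [AEEqFun.coeFn_add F G] with t ht
    rw [ht]; rfl)
  smul_mem' a F hF α := ((hF α).const_mul a).congr (by
    filter_upwards [AEEqFun.coeFn_smul a F] with t ht
    rw [ht]; rfl)

theorem intervalIntegral_congr_of_ae_restrict {T b : ℝ} (hb : b ∈ Icc 0 T) {f g : ℝ → ℂ}
    (h : f =ᵐ[volume.restrict (Icc 0 T)] g) : ∫ s in (0 : ℝ)..b, f s = ∫ s in (0 : ℝ)..b, g s := by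
  refine intervalIntegral.integral_congr_ae ?_
  filter_upwards [(ae_restrict_iff' measurableSet_Icc).1 h] with s hs hsb
  rw [uIoc_of_le hb.1] at hsb
  exact hs ⟨hsb.1.le, hsb.2.trans hb.2⟩

theorem intervalIntegrable_of_mem_Icc {T b : ℝ} (hb : b ∈ Icc 0 T) {f : ℝ → ℂ}
    (hf : IntegrableOn f (Icc 0 T)) : IntervalIntegrable f volume 0 b :=
  (intervalIntegrable_iff_integrableOn_Icc_of_le hb.1).2
    (hf.mono_set (Icc_subset_Icc_right hb.2))

/-- The factor `exp (-itl)` comes out of the integral and leaves a continuous primitive evaluated at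
`b t`. -/
theorem aemeasurable_duhamel {T : ℝ} {b : ℝ → ℝ} (hb : Measurable b)
    (hbT : MapsTo b (Icc 0 T) (Icc 0 T)) (l : ℂ) {f : ℝ → ℂ} (hf : IntegrableOn f (Icc 0 T)) :
    AEMeasurable (fun t : ℝ => ∫ s in (0 : ℝ)..b t,
      Complex.exp (-Complex.I * (t - s : ℝ) * l) * f s) (volume.restrict (Icc 0 T)) := by
  let g : ℝ → ℂ := indicator (Icc 0 T) fun s => Complex.exp (-Complex.I * (-s : ℝ) * l) * f s
  have hg : Integrable g := by
    refine IntegrableOn.integrable_indicator ?_ measurableSet_Icc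
    exact hf.continuousOn_mul (Continuous.continuousOn (by fun_prop)) isCompact_Icc
  have hP : Continuous fun x => ∫ s in (0 : ℝ)..x, g s :=
    intervalIntegral.continuous_primitive (fun a b => hg.intervalIntegrable) 0
  have hm : Measurable fun t : ℝ => Complex.exp (-Complex.I * t * l) * ∫ s in (0 : ℝ)..b t, g s :=
    (continuous_cexp_mul l).measurable.mul (hP.measurable.comp hb)
  refine hm.aemeasurable.congr ?_
  filter_upwards [ae_restrict_mem measurableSet_Icc] with t ht
  rw [← intervalIntegral.integral_const_mul]
  refine intervalIntegral.integral_congr fun s hs => ?_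
  have hbt := hbT ht
  rw [uIcc_of_le hbt.1] at hs
  simp only [g, indicator_of_mem (show s ∈ Icc 0 T from ⟨hs.1, hs.2.trans hbt.2⟩)]
  rw [← mul_assoc, ← Complex.exp_add]
  congr 2
  push_cast
  ring

/-- One construction serves both operators: `b = id` gives `S₁` and `b = T` gives `S₂`. The domain
is restricted because linearity of the integral requires integrable coefficients. -/
theorem exists_duhamel {d : ℕ} {T : ℝ} {b : ℝ → ℝ} (hb : Measurable b)
    (hbT : MapsTo b (Icc 0 T) (Icc 0 T)) (l : MIdx d → ℂ) :
    ∃ L : coefIntegrable d T →ₗ[ℂ] SeqFun d T, ∀ F, ∀ᵐ t ∂volume.restrict (Icc 0 T), ∀ α,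
      L F t α = ∫ s in (0 : ℝ)..b t, Complex.exp (-Complex.I * (t - s : ℝ) * l α) * F.1 s α := by
  have hmeas : ∀ F : coefIntegrable d T, AEStronglyMeasurable (fun (t : ℝ) (α : MIdx d) =>
      ∫ s in (0 : ℝ)..b t, Complex.exp (-Complex.I * (t - s : ℝ) * l α) * F.1 s α)
      (volume.restrict (Icc 0 T)) := fun F =>
    (aemeasurable_pi_lambda _ fun α => aemeasurable_duhamel hb hbT (l α) (F.2 α)).aestronglyMeasurable
  have hint : ∀ (F : coefIntegrable d T) (α : MIdx d) (t : ℝ), IntegrableOn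
      (fun s : ℝ => Complex.exp (-Complex.I * (t - s : ℝ) * l α) * F.1 s α) (Icc 0 T) := fun F α t =>
    IntegrableOn.continuousOn_mul (Continuous.continuousOn (by fun_prop)) (F.2 α) isCompact_Icc
  refine ⟨{ toFun := fun F => AEEqFun.mk _ (hmeas F), map_add' := fun F G => ?_,
            map_smul' := fun a F => ?_ }, fun F => ?_⟩
  · refine AEEqFun.ext ?_
    filter_upwards [AEEqFun.coeFn_mk _ (hmeas (F + G)), AEEqFun.coeFn_mk _ (hmeas F),
      AEEqFun.coeFn_mk _ (hmeas G), AEEqFun.coeFn_add (AEEqFun.mk _ (hmeas F))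
        (AEEqFun.mk _ (hmeas G)), ae_restrict_mem measurableSet_Icc] with t h1 h2 h3 h4 ht
    rw [h1, h4, Pi.add_apply, h2, h3]
    funext α
    rw [Pi.add_apply, ← intervalIntegral.integral_add
      (intervalIntegrable_of_mem_Icc (hbT ht) (hint F α t))
      (intervalIntegrable_of_mem_Icc (hbT ht) (hint G α t))]
    refine intervalIntegral_congr_of_ae_restrict (hbT ht) ?_
    filter_upwards [AEEqFun.coeFn_add F.1 G.1] with s hs
    rw [show ((F + G : coefIntegrable d T) : SeqFun d T) = F.1 + G.1 from rfl, hs, Pi.add_apply,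
      Pi.add_apply, mul_add]
  · refine AEEqFun.ext ?_
    filter_upwards [AEEqFun.coeFn_mk _ (hmeas (a • F)), AEEqFun.coeFn_mk _ (hmeas F),
      AEEqFun.coeFn_smul a (AEEqFun.mk _ (hmeas F)), ae_restrict_mem measurableSet_Icc]
      with t h1 h2 h4 ht
    rw [RingHom.id_apply, h1, h4, Pi.smul_apply, h2]
    funext α
    rw [Pi.smul_apply, smul_eq_mul, ← intervalIntegral.integral_const_mul]
    refine intervalIntegral_congr_of_ae_restrict (hbT ht) ?_
    filter_upwards [AEEqFun.coeFn_smul a F.1] with s hs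
    rw [show ((a • F : coefIntegrable d T) : SeqFun d T) = a • F.1 from rfl, hs, Pi.smul_apply,
      Pi.smul_apply, smul_eq_mul]
    ring
  · filter_upwards [AEEqFun.coeFn_mk _ (hmeas F)] with t ht α
    exact congrFun ht α

/-- As `|t - s| ≤ T`, the exponent `T‖l‖` would suffice; the factor `3` only matches the majorant of
`exists_scalar_solution`. -/
theorem enorm_duhamel_le {T b t : ℝ} (hb : b ∈ Icc 0 T) (ht : t ∈ Icc 0 T) (l : ℂ) (f : ℝ → ℂ) :
    ‖∫ s in (0 : ℝ)..b, Complex.exp (-Complex.I * (t - s : ℝ) * l) * f s‖ₑ ≤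
      ENNReal.ofReal (Real.exp (3 * (T * ‖l‖))) * ∫⁻ s in Icc 0 T, ‖f s‖ₑ := by
  rw [intervalIntegral.integral_of_le hb.1]
  refine (enorm_integral_le_lintegral_enorm _).trans ?_
  rw [← lintegral_const_mul' _ _ (by simp)]
  refine (lintegral_mono_set (t := Icc 0 T) fun s hs => ⟨hs.1.le, hs.2.trans hb.2⟩).trans ?_
  refine setLIntegral_mono' measurableSet_Icc fun s hs => ?_
  rw [enorm_mul]
  gcongr
  rw [← ofReal_norm]
  refine ENNReal.ofReal_le_ofReal ((norm_cexp_mul_le l (T := T) ?_).trans ?_)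
  · rw [abs_le]; constructor <;> linarith [ht.1, ht.2, hs.1, hs.2]
  · refine Real.exp_le_exp.2 ?_
    have : 0 ≤ T * ‖l‖ := mul_nonneg (ht.1.trans ht.2) (norm_nonneg _)
    linarith

/-! ### Well-posedness in spaces that are stable under multipliers -/

/-- The right-hand side cancels in the difference, which leaves a homogeneous scalar equation.
Uniqueness and continuous dependence are both read off from this formula. -/
theorem IsSolution.coef_sub {d : ℕ} {ϱ : Fin d → ℂ} {c : ℂ} {r T : ℝ} {X : Type*} [AddCommGroup X]
    [TopologicalSpace X] [Module ℂ X] {coef : X →ₗ[ℂ] Seq d} {F : ℝ → Seq d} {u₀ v₀ : X}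
    {u v : ℝ → X} (hu : IsSolution ϱ c r T coef F u₀ u) (hv : IsSolution ϱ c r T coef F v₀ v)
    (α : MIdx d) {t : ℝ} (ht : t ∈ Icc 0 T) :
    coef (v t - u t) α = propagator ϱ c r t α * coef (v₀ - u₀) α := by
  obtain ⟨-, hvi, hve⟩ := hv α
  obtain ⟨hFi, hui, hue⟩ := hu α
  have hz : ∀ t, coef (v t - u t) α = coef (v t) α - coef (u t) α := fun t => by
    rw [map_sub, Pi.sub_apply]
  refine eq_exp_mul_of_integral_eq (T := T) (z := fun t => coef (v t - u t) α) ?_ ?_ t ht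
  · simp only [hz]
    exact hvi.sub hui
  · intro t ht
    have h1 : IntervalIntegrable (fun s => eigenPow ϱ c r α * coef (v s) α + F s α) volume 0 t :=
      intervalIntegrable_of_mem_Icc ht ((hvi.const_mul _).add hFi)
    have h2 : IntervalIntegrable (fun s => eigenPow ϱ c r α * coef (u s) α + F s α) volume 0 t :=
      intervalIntegrable_of_mem_Icc ht ((hui.const_mul _).add hFi)
    calc _ = Complex.I * (coef (v t) α - coef v₀ α) - Complex.I * (coef (u t) α - coef u₀ α) := by
          simp only [map_sub, Pi.sub_apply]; ring
      _ = _ := by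
        rw [hve t ht, hue t ht, ← intervalIntegral.integral_sub h1 h2]
        congr 1 with s
        rw [map_sub, Pi.sub_apply]
        ring

/-- All operators involved are dominated coefficientwise by the one majorant `G`, so the space
enters only through its stability under domination by `G`: for single multipliers, for families of
maps, for time integrals of `F`, and for operators on `Y`. -/
theorem wellPosedWithPropagators_of_stable {d : ℕ} {ϱ : Fin d → ℂ} {c : ℂ} {r T : ℝ} (hT : 0 < T)
    {X : Type*} [AddCommGroup X] [TopologicalSpace X] [Module ℂ X]
    {Y : Type*} [AddCommGroup Y] [TopologicalSpace Y] [Module ℂ Y]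
    (coef : X →ₗ[ℂ] Seq d) (hcoef : Function.Injective coef) (val : Y →ₗ[ℂ] SeqFun d T)
    (G : MIdx d → ℝ≥0∞) (hG : ∀ α, G α = ENNReal.ofReal (Real.exp (3 * (T * ‖eigenPow ϱ c r α‖))))
    (hval : ∀ F : Y, val F ∈ coefIntegrable d T)
    (hmul : ∀ m : MIdx d → ℂ, (∀ α, ‖m α‖ₑ ≤ G α) →
      ∃ E : X →L[ℂ] X, ∀ x α, coef (E x) α = m α * coef x α)
    (hequi : ∀ L : Icc 0 T → X →ₗ[ℂ] X, (∀ t x α, ‖coef (L t x) α‖ₑ ≤ G α * ‖coef x α‖ₑ) →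
      ∀ V ∈ 𝓝 (0 : X), ∃ U ∈ 𝓝 (0 : X), ∀ x ∈ U, ∀ t, L t x ∈ V)
    (hint : ∀ (F : Y) (a : Seq d), (∀ α, ‖a α‖ₑ ≤ G α * ∫⁻ t in Icc 0 T, ‖val F t α‖ₑ) →
      ∃ x, coef x = a)
    (hop : ∀ L : coefIntegrable d T →ₗ[ℂ] SeqFun d T, (∀ F, ∀ᵐ t ∂volume.restrict (Icc 0 T), ∀ α,
      ‖L F t α‖ₑ ≤ G α * ∫⁻ t in Icc 0 T, ‖F.1 t α‖ₑ) →
      ∃ S : Y →L[ℂ] Y, ∀ F, val (S F) = L ⟨val F, hval F⟩) :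
    WellPosedWithPropagators ϱ c r T coef fun F : Y => ⇑(val F) := by
  have hprop : ∀ t, |t| ≤ T → ∀ α, ‖propagator ϱ c r t α‖ₑ ≤ G α := by
    intro t ht α
    rw [hG, ← ofReal_norm]
    refine ENNReal.ofReal_le_ofReal ((norm_cexp_mul_le _ ht).trans (Real.exp_le_exp.2 ?_))
    have : 0 ≤ T * ‖eigenPow ϱ c r α‖ := by positivity
    linarith
  have habs : ∀ t ∈ Icc 0 T, |t| ≤ T := fun t ht => by rw [abs_of_nonneg ht.1]; exact ht.2
  choose E hE using fun t : Icc 0 T => hmul _ (hprop t (habs t t.2))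
  have hduh : ∀ b : ℝ → ℝ, Measurable b → MapsTo b (Icc 0 T) (Icc 0 T) → ∃ S : Y →L[ℂ] Y,
      ∀ F : Y, ∀ᵐ t ∂volume.restrict (Icc 0 T), ∀ α,
        val (S F) t α = ∫ s in (0 : ℝ)..b t, propagator ϱ c r (t - s) α * val F s α := by
    intro b hb hbT
    obtain ⟨L, hL⟩ := exists_duhamel hb hbT (eigenPow ϱ c r)
    obtain ⟨S, hS⟩ := hop L fun F => by
      filter_upwards [hL F, ae_restrict_mem measurableSet_Icc] with t ht htT α
      rw [ht α, hG]
      exact enorm_duhamel_le (hbT htT) htT _ _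
    refine ⟨S, fun F => ?_⟩
    rw [hS]
    exact hL ⟨val F, hval F⟩
  refine ⟨fun F => ⟨fun u₀ => ?_, ?_⟩, fun t ht => ?_, ?_, ?_⟩
  · choose y hyi hye hyb using fun α => exists_scalar_solution (eigenPow ϱ c r α) (hval F α)
    have hx : ∀ t : Icc 0 T, ∃ x, coef x = fun α => y α t := fun t => hint F _ fun α => by
      rw [hG, ← ofReal_integral_norm_eq_lintegral_enorm (hval F α),
        ← ENNReal.ofReal_mul (Real.exp_nonneg _), ← ofReal_norm]
      exact ENNReal.ofReal_le_ofReal (hyb α t t.2)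
    choose x hx using hx
    -- Propagated initial value plus the solution with zero initial value. The default outside
    -- `[0,T]` never enters, since solutions are tested only there.
    let u : ℝ → X := fun t => if ht : t ∈ Icc 0 T then E ⟨t, ht⟩ u₀ + x ⟨t, ht⟩ else 0
    have hu : ∀ t (ht : t ∈ Icc 0 T) α,
        coef (u t) α = propagator ϱ c r t α * coef u₀ α + y α t := by
      intro t ht α
      simp only [u, dif_pos ht, map_add, Pi.add_apply, hE, hx]
    have hsol : IsSolution ϱ c r T coef (val F) u₀ u := by
      intro α
      have hpc : Continuous fun t => propagator ϱ c r t α * coef u₀ α :=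
        (continuous_cexp_mul _).mul continuous_const
      refine ⟨hval F α, ?_, fun t ht => ?_⟩
      · refine IntegrableOn.congr_fun (f := fun t => propagator ϱ c r t α * coef u₀ α + y α t) ?_
          (fun t ht => (hu t ht α).symm) measurableSet_Icc
        exact hpc.continuousOn.integrableOn_Icc.add (hyi α)
      · rw [hu t ht α]
        have h1 := integral_mul_exp (eigenPow ϱ c r α) (coef u₀ α) t
        have h2 := hye α t ht
        have i1 : IntervalIntegrable
            (fun s => eigenPow ϱ c r α * (propagator ϱ c r s α * coef u₀ α)) volume 0 t :=
          (continuous_const.mul hpc).intervalIntegrable _ _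
        have i2 : IntervalIntegrable
            (fun s => eigenPow ϱ c r α * y α s + val F s α) volume 0 t :=
          intervalIntegrable_of_mem_Icc ht (((hyi α).const_mul _).add (hval F α))
        calc _ = Complex.I * (propagator ϱ c r t α * coef u₀ α - coef u₀ α) +
              Complex.I * y α t := by ring
          _ = _ := by
            rw [h2]
            erw [h1]
            erw [← intervalIntegral.integral_add i1 i2]
            refine intervalIntegral.integral_congr fun s hs => ?_
            rw [uIcc_of_le ht.1] at hs
            simp only [hu s ⟨hs.1, hs.2.trans ht.2⟩]
            ring
    refine ⟨u, hsol, fun v hv t ht => hcoef (funext fun α => ?_)⟩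
    have := IsSolution.coef_sub hsol hv α ht
    rw [sub_self, map_zero, Pi.zero_apply, mul_zero, map_sub, Pi.sub_apply, sub_eq_zero] at this
    exact this
  · intro u₀ u hu V hV
    obtain ⟨U, hU, hUV⟩ := hequi (fun t => (E t).toLinearMap) (fun t x α => by
      change ‖coef (E t x) α‖ₑ ≤ _
      rw [hE, enorm_mul]
      gcongr
      exact hprop t (habs t t.2) α) V hV
    refine ⟨U, hU, fun v₀ v hv hvU t ht => ?_⟩
    have : v t - u t = E ⟨t, ht⟩ (v₀ - u₀) := hcoef (funext fun α => by
      rw [IsSolution.coef_sub hu hv α ht, hE])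
    rw [this]
    exact hUV _ hvU ⟨t, ht⟩
  -- The majorant is symmetric in time, so the backward propagator is continuous as well and
  -- provides the inverse.
  · obtain ⟨E', hE'⟩ := hmul _ (hprop (-t) (by rw [abs_neg]; exact habs t ht))
    have he : ∀ α, propagator ϱ c r t α * propagator ϱ c r (-t) α = 1 := fun α => by
      rw [propagator, propagator, ← Complex.exp_add]
      simp
    refine ⟨ContinuousLinearEquiv.equivOfInverse (E ⟨t, ht⟩) E' (fun x => ?_) (fun x => ?_),
      fun u₀ α => hE ⟨t, ht⟩ u₀ α⟩
    · refine hcoef (funext fun α => ?_)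
      rw [hE', hE]
      linear_combination (coef x α) * he α
    · refine hcoef (funext fun α => ?_)
      rw [hE, hE']
      linear_combination (coef x α) * he α
  · exact hduh id measurable_id (mapsTo_id _)
  · exact hduh (fun _ => T) measurable_const fun _ _ => ⟨hT.le, le_rfl⟩

/-! ### Weights that absorb the multipliers -/

theorem norm_eigen_le {d : ℕ} (ϱ : Fin d → ℂ) (c : ℂ) :
    ∃ B : ℝ, 0 ≤ B ∧ ∀ α, ‖eigen ϱ c α‖ ≤ B * ((len α : ℝ) + 1) := by
  refine ⟨2 * ∑ j, ‖ϱ j‖ + ∑ j, ‖ϱ j‖ + ‖c‖, by positivity, fun α => ?_⟩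
  have h1 : ‖∑ j, (α j : ℂ) * ϱ j‖ ≤ (∑ j, ‖ϱ j‖) * len α := by
    refine (norm_sum_le _ _).trans ?_
    rw [Finset.sum_mul]
    refine Finset.sum_le_sum fun j _ => ?_
    rw [norm_mul, Complex.norm_natCast, mul_comm]
    gcongr
    exact Finset.single_le_sum (f := α) (fun _ _ => Nat.zero_le _) (Finset.mem_univ j)
  have h2 : ‖∑ j, ϱ j‖ ≤ ∑ j, ‖ϱ j‖ := norm_sum_le _ _
  have h3 : ‖eigen ϱ c α‖ ≤ 2 * ‖∑ j, (α j : ℂ) * ϱ j‖ + ‖∑ j, ϱ j‖ + ‖c‖ := by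
    refine (norm_add_le _ _).trans (add_le_add_left ((norm_add_le _ _).trans ?_) _)
    rw [norm_mul]
    norm_num
  have h4 : 0 ≤ ∑ j, ‖ϱ j‖ := Finset.sum_nonneg fun _ _ => norm_nonneg _
  have h5 : (0 : ℝ) ≤ len α := Nat.cast_nonneg _
  nlinarith [norm_nonneg c, mul_nonneg h4 h5, mul_nonneg (norm_nonneg c) h5]

theorem norm_eigenPow_le {d : ℕ} (ϱ : Fin d → ℂ) (c : ℂ) {r : ℝ} (hr : 0 ≤ r) :
    ∃ B : ℝ, 0 ≤ B ∧ ∀ α, ‖eigenPow ϱ c r α‖ ≤ B * ((len α : ℝ) + 1) ^ r := by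
  obtain ⟨B, hB, h⟩ := norm_eigen_le ϱ c
  refine ⟨B ^ r, by positivity, fun α => ?_⟩
  rw [eigenPow, Complex.norm_cpow_real, ← Real.mul_rpow hB (by positivity)]
  exact Real.rpow_le_rpow (norm_nonneg _) (h α) hr

/-- For `n ≥ 1` one has `n + 1 ≤ 2n`; the additive constant is there for `n = 0`. -/
theorem mul_add_one_rpow_le {A r q : ℝ} (hA : 0 ≤ A) (hr : 0 ≤ r) (hq : r ≤ q) (n : ℕ) :
    A * ((n : ℝ) + 1) ^ r ≤ A * 2 ^ r * (n : ℝ) ^ q + A * 2 ^ r := by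
  rcases Nat.eq_zero_or_pos n with rfl | hn
  · have h1 : (1 : ℝ) ≤ 2 ^ r := Real.one_le_rpow (by norm_num) hr
    have h2 : 0 ≤ A * 2 ^ r * ((0 : ℕ) : ℝ) ^ q := by positivity
    simp only [Nat.cast_zero, zero_add, Real.one_rpow] at *
    nlinarith
  · have hn' : (1 : ℝ) ≤ n := by exact_mod_cast hn
    have h1 : ((n : ℝ) + 1) ^ r ≤ (2 * n) ^ r :=
      Real.rpow_le_rpow (by positivity) (by linarith) hr
    rw [Real.mul_rpow (by norm_num) (by positivity)] at h1
    have h2 : (n : ℝ) ^ r ≤ (n : ℝ) ^ q := Real.rpow_le_rpow_of_exponent_le hn' hq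
    have h3 : A * ((n : ℝ) + 1) ^ r ≤ A * (2 ^ r * (n : ℝ) ^ q) := by
      gcongr
      exact h1.trans (by gcongr)
    have : 0 ≤ A * 2 ^ r := by positivity
    linarith

/-- Strict inequality of the exponents makes the factor in front of `n ^ q` as small as desired, the
finitely many small `n` being absorbed by `K`. This is what separates the strict condition on `s₂`
from the weak one on `s₁`. -/
theorem exists_mul_add_one_rpow_le {A r q ε : ℝ} (hA : 0 ≤ A) (hr : 0 ≤ r) (hq : r < q)
    (hε : 0 < ε) : ∃ K, 0 ≤ K ∧ ∀ n : ℕ, A * ((n : ℝ) + 1) ^ r ≤ ε * (n : ℝ) ^ q + K := by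
  have ht : Tendsto (fun n : ℕ => (n : ℝ) ^ (q - r)) atTop atTop :=
    (tendsto_rpow_atTop (sub_pos.2 hq)).comp tendsto_natCast_atTop_atTop
  obtain ⟨N, hN⟩ := eventually_atTop.1 (ht.eventually_ge_atTop (A * 2 ^ r / ε))
  refine ⟨A * ((N : ℝ) + 1) ^ r + A * 2 ^ r, by positivity, fun n => ?_⟩
  rcases le_or_gt n N with h | h
  · have h1 : A * ((n : ℝ) + 1) ^ r ≤ A * ((N : ℝ) + 1) ^ r := by gcongr
    have h2 : 0 ≤ ε * (n : ℝ) ^ q := by positivity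
    have h3 : 0 ≤ A * 2 ^ r := by positivity
    linarith
  · have h1 := mul_add_one_rpow_le hA hr le_rfl n
    have hn : (0 : ℝ) < n := by exact_mod_cast (Nat.zero_le N).trans_lt h
    have h2 : A * 2 ^ r * (n : ℝ) ^ r ≤ ε * (n : ℝ) ^ q := by
      have h3 := (div_le_iff₀' hε).1 (hN n h.le)
      calc A * 2 ^ r * (n : ℝ) ^ r ≤ ε * (n : ℝ) ^ (q - r) * (n : ℝ) ^ r := by gcongr
        _ = ε * (n : ℝ) ^ q := by rw [mul_assoc, ← Real.rpow_add hn]; ring_nf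
    have h3 : 0 ≤ A * ((N : ℝ) + 1) ^ r := by positivity
    linarith

/-- Multiplication by `exp (A (|α| + 1) ^ r)` is bounded from the step `ρ'` to the step `ρ`. -/
def AbsorbsExp {d : ℕ} (r A : ℝ) (w : {ρ : ℝ // 0 < ρ} → MIdx d → ℝ≥0∞)
    (ρ ρ' : {ρ : ℝ // 0 < ρ}) : Prop :=
  ∃ K : ℝ≥0, ∀ α, ENNReal.ofReal (Real.exp (A * ((len α : ℝ) + 1) ^ r)) * w ρ α ≤ K * w ρ' α

theorem absorbsExp_of_real {d : ℕ} {r A : ℝ} {w : {ρ : ℝ // 0 < ρ} → MIdx d → ℝ≥0∞}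
    {ρ ρ' : {ρ : ℝ // 0 < ρ}} {v v' : MIdx d → ℝ} (hv : ∀ α, w ρ α = ENNReal.ofReal (v α))
    (hv' : ∀ α, w ρ' α = ENNReal.ofReal (v' α)) (K : ℝ) (hK : 0 ≤ K)
    (h : ∀ α, Real.exp (A * ((len α : ℝ) + 1) ^ r) * v α ≤ K * v' α) : AbsorbsExp r A w ρ ρ' := by
  refine ⟨K.toNNReal, fun α => ?_⟩
  rw [hv, hv', ← ENNReal.ofReal_mul (Real.exp_nonneg _)]
  change _ ≤ ENNReal.ofReal K * _
  rw [← ENNReal.ofReal_mul hK]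
  exact ENNReal.ofReal_le_ofReal (h α)

section
variable {d : ℕ} {r A : ℝ}

/-! ### Absorption of the multipliers for each type of weight. -/

theorem absorbsExp_decay_real {s : ℝ≥0} (hs : s ≠ 0) {ρ ρ' : {ρ : ℝ // 0 < ρ}} {K : ℝ}
    (h : ∀ n : ℕ, A * ((n : ℝ) + 1) ^ r ≤ (ρ' - ρ) * (n : ℝ) ^ (1 / (2 * (s : ℝ))) + K) :
    AbsorbsExp r A (decayWeight (d := d) (.real s)) ρ ρ' := by
  refine absorbsExp_of_real (fun α => by simp only [decayWeight, if_neg hs]; rfl)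
    (fun α => by simp only [decayWeight, if_neg hs]; rfl) (Real.exp K) (Real.exp_nonneg _)
    fun α => ?_
  rw [← Real.exp_add, ← Real.exp_add]
  refine Real.exp_le_exp.2 ?_
  linarith [h (len α)]

theorem absorbsExp_growth_real {s : ℝ≥0} (hs : s ≠ 0) {ρ ρ' : {ρ : ℝ // 0 < ρ}} {K : ℝ}
    (h : ∀ n : ℕ, A * ((n : ℝ) + 1) ^ r ≤ (ρ - ρ') * (n : ℝ) ^ (1 / (2 * (s : ℝ))) + K) :
    AbsorbsExp r A (growthWeight (d := d) (.real s)) ρ ρ' := by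
  refine absorbsExp_of_real (fun α => by simp only [growthWeight, if_neg hs]; rfl)
    (fun α => by simp only [growthWeight, if_neg hs]; rfl) (Real.exp K) (Real.exp_nonneg _)
    fun α => ?_
  rw [← Real.exp_add, ← Real.exp_add]
  refine Real.exp_le_exp.2 ?_
  linarith [h (len α)]

/-- For `r = 1` the multiplier is geometric in the degree, so rescaling `ρ` by `exp A` compensates
it exactly and the factorial part `f` plays no role. -/
theorem exp_mul_inv_pow (A : ℝ) {ρ ρ' : ℝ} (h : ρ = ρ' * Real.exp A) (n : ℕ) (f : ℝ) :
    Real.exp (A * ((n : ℝ) + 1) ^ (1 : ℝ)) * (ρ⁻¹ ^ n * f) = Real.exp A * (ρ'⁻¹ ^ n * f) := by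
  have : Real.exp (A * ((n : ℝ) + 1)) = Real.exp A * Real.exp A ^ n := by
    rw [← Real.exp_nat_mul, ← Real.exp_add]; ring_nf
  rw [Real.rpow_one, this, h, mul_inv, mul_pow]
  have h1 : Real.exp A ^ n * (Real.exp A)⁻¹ ^ n = 1 := by
    rw [← mul_pow, mul_inv_cancel₀ (Real.exp_ne_zero _), one_pow]
  linear_combination (Real.exp A * (ρ'⁻¹ ^ n * f)) * h1

theorem absorbsExp_decay_flat (σ : {σ : ℝ // 0 < σ}) {ρ ρ' : {ρ : ℝ // 0 < ρ}}
    (h : (ρ : ℝ) = ρ' * Real.exp A) : AbsorbsExp 1 A (decayWeight (d := d) (.flat σ)) ρ ρ' :=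
  absorbsExp_of_real (fun _ => rfl) (fun _ => rfl) (Real.exp A) (Real.exp_nonneg _) fun _ =>
    (exp_mul_inv_pow A h _ _).le

theorem absorbsExp_growth_flat (σ : {σ : ℝ // 0 < σ}) {ρ ρ' : {ρ : ℝ // 0 < ρ}}
    (h : (ρ : ℝ) = ρ' * Real.exp A) : AbsorbsExp 1 A (growthWeight (d := d) (.flat σ)) ρ ρ' :=
  absorbsExp_of_real (fun _ => rfl) (fun _ => rfl) (Real.exp A) (Real.exp_nonneg _) fun _ =>
    (exp_mul_inv_pow A h _ _).le

theorem exp_le_of_len_le (hA : 0 ≤ A) (hr : 0 ≤ r) {ρ : ℝ} {α : MIdx d} (h : (len α : ℝ) ≤ ρ) :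
    ENNReal.ofReal (Real.exp (A * ((len α : ℝ) + 1) ^ r)) ≤
      (Real.exp (A * (ρ + 1) ^ r)).toNNReal :=
  ENNReal.ofReal_le_ofReal (by gcongr)

/-- Only degrees at most `ρ` matter, where the multiplier is bounded; beyond them both sides are
infinite because the exponentials do not vanish. -/
theorem absorbsExp_decay_zero (hA : 0 ≤ A) (hr : 0 ≤ r) (ρ : {ρ : ℝ // 0 < ρ}) :
    AbsorbsExp r A (decayWeight (d := d) (.real 0)) ρ ρ := by
  refine ⟨(Real.exp (A * (ρ + 1) ^ r)).toNNReal, fun α => ?_⟩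
  simp only [decayWeight, if_true]
  split_ifs with h
  · exact mul_le_mul_left (exp_le_of_len_le hA hr h) _
  · rw [ENNReal.mul_top (by simp [Real.exp_pos]), ENNReal.mul_top (by simp [Real.exp_pos])]

theorem absorbsExp_growth_zero (hA : 0 ≤ A) (hr : 0 ≤ r) (ρ : {ρ : ℝ // 0 < ρ}) :
    AbsorbsExp r A (growthWeight (d := d) (.real 0)) ρ ρ := by
  refine ⟨(Real.exp (A * (ρ + 1) ^ r)).toNNReal, fun α => ?_⟩
  simp only [growthWeight, if_true]
  split_ifs with h
  · exact mul_le_mul_left (exp_le_of_len_le hA hr h) _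
  · simp

theorem PilOrder.le_real {s : ℝ≥0} (hs : s ≠ 0) (hr : 1 ≤ r)
    (h : PilOrder.real s ≤ .real (1 / (2 * r)).toNNReal) : r ≤ 1 / (2 * (s : ℝ)) := by
  have h' : s ≤ (1 / (2 * r)).toNNReal := by
    rcases h with h | h
    · exact le_of_lt h
    · exact (PilOrder.real.inj h).le
  have hs0 : (0 : ℝ) < s := by exact_mod_cast pos_iff_ne_zero.2 hs
  have h2 : (s : ℝ) ≤ 1 / (2 * r) := (Real.le_toNNReal_iff_coe_le (by positivity)).1 h'
  rw [le_div_iff₀ (by positivity)] at h2 ⊢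
  linarith

theorem PilOrder.lt_real {s : ℝ≥0} (hs : s ≠ 0) (hr : 1 ≤ r)
    (h : PilOrder.real s < .real (1 / (2 * r)).toNNReal) : r < 1 / (2 * (s : ℝ)) := by
  have h' : s < (1 / (2 * r)).toNNReal := h
  have hs0 : (0 : ℝ) < s := by exact_mod_cast pos_iff_ne_zero.2 hs
  have h2 : (s : ℝ) < 1 / (2 * r) := Real.lt_toNNReal_iff_coe_lt.1 h'
  rw [lt_div_iff₀ (by positivity)] at h2 ⊢
  linarith

/-- In the order on indices, the hypothesis unfolds to `1/2 ≤ 1/(2r)`, that is `r ≤ 1`. -/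
theorem PilOrder.eq_one_of_flat_lt {σ : {σ : ℝ // 0 < σ}} (hr : 1 ≤ r)
    (h : PilOrder.flat σ < .real (1 / (2 * r)).toNNReal) : r = 1 := by
  have h' : (1 / 2 : ℝ≥0) ≤ (1 / (2 * r)).toNNReal := h
  have h2 := (Real.le_toNNReal_iff_coe_le (by positivity)).1 h'
  rw [le_div_iff₀ (by positivity)] at h2
  push_cast at h2
  linarith

/-- In this projective limit the norm on the right may be taken as strong as needed. The loss may
thus be a fixed multiple of `|α| ^ (1/(2s))`, which admits the endpoint `1/(2r)`. -/
theorem decayWeight_absorbs_proj (hr : 1 ≤ r) (hA : 0 ≤ A) {s : PilOrder} (h0 : 0 < s)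
    (hs : s ≤ .real (1 / (2 * r)).toNNReal) (ρ : {ρ : ℝ // 0 < ρ}) :
    ∃ ρ', AbsorbsExp r A (decayWeight (d := d) s) ρ ρ' := by
  have hr0 : 0 ≤ r := by linarith
  match s with
  | .real s =>
    have hs0 : s ≠ 0 := (show (0 : ℝ≥0) < s from h0).ne'
    refine ⟨⟨ρ + A * 2 ^ r, add_pos_of_pos_of_nonneg ρ.2 (by positivity)⟩,
      absorbsExp_decay_real (K := A * 2 ^ r) hs0 fun n => ?_⟩
    rw [add_sub_cancel_left]
    exact mul_add_one_rpow_le hA hr0 (PilOrder.le_real hs0 hr hs) n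
  | .flat σ =>
    obtain rfl : r = 1 := PilOrder.eq_one_of_flat_lt hr (hs.resolve_right (by simp))
    refine ⟨⟨ρ * Real.exp (-A), mul_pos ρ.2 (Real.exp_pos _)⟩, absorbsExp_decay_flat σ ?_⟩
    rw [mul_assoc, ← Real.exp_add]
    simp

/-- Here `ρ` is given and some decay must survive: half of `ρ` is sacrificed, which requires a
strict inequality of exponents when `s` is real and positive. -/
theorem decayWeight_absorbs_ind (hr : 1 ≤ r) (hA : 0 ≤ A) {s : PilOrder}
    (hs : s < .real (1 / (2 * r)).toNNReal) (ρ : {ρ : ℝ // 0 < ρ}) :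
    ∃ ρ', AbsorbsExp r A (decayWeight (d := d) s) ρ' ρ := by
  have hr0 : 0 ≤ r := by linarith
  match s with
  | .real s =>
    rcases eq_or_ne s 0 with rfl | hs0
    · exact ⟨ρ, absorbsExp_decay_zero hA hr0 ρ⟩
    obtain ⟨K, -, hK⟩ := exists_mul_add_one_rpow_le hA hr0 (PilOrder.lt_real hs0 hr hs)
      (half_pos ρ.2)
    refine ⟨⟨ρ / 2, half_pos ρ.2⟩, absorbsExp_decay_real (K := K) hs0 fun n => ?_⟩
    rw [sub_half]
    exact hK n
  | .flat σ =>
    obtain rfl : r = 1 := PilOrder.eq_one_of_flat_lt hr hs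
    exact ⟨⟨ρ * Real.exp A, mul_pos ρ.2 (Real.exp_pos _)⟩, absorbsExp_decay_flat σ rfl⟩

/-- For growth weights the roles are exchanged: in the projective limit the allowed growth has to
stay below an arbitrarily small rate, so the strict case appears here and the endpoint in the
inductive limit. -/
theorem growthWeight_absorbs_proj (hr : 1 ≤ r) (hA : 0 ≤ A) {s : PilOrder}
    (hs : s < .real (1 / (2 * r)).toNNReal) (ρ : {ρ : ℝ // 0 < ρ}) :
    ∃ ρ', AbsorbsExp r A (growthWeight (d := d) s) ρ ρ' := by
  have hr0 : 0 ≤ r := by linarith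
  match s with
  | .real s =>
    rcases eq_or_ne s 0 with rfl | hs0
    · exact ⟨ρ, absorbsExp_growth_zero hA hr0 ρ⟩
    obtain ⟨K, -, hK⟩ := exists_mul_add_one_rpow_le hA hr0 (PilOrder.lt_real hs0 hr hs)
      (half_pos ρ.2)
    refine ⟨⟨ρ / 2, half_pos ρ.2⟩, absorbsExp_growth_real (K := K) hs0 fun n => ?_⟩
    rw [sub_half]
    exact hK n
  | .flat σ =>
    obtain rfl : r = 1 := PilOrder.eq_one_of_flat_lt hr hs
    refine ⟨⟨ρ * Real.exp (-A), mul_pos ρ.2 (Real.exp_pos _)⟩, absorbsExp_growth_flat σ ?_⟩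
    rw [mul_assoc, ← Real.exp_add]
    simp

theorem growthWeight_absorbs_ind (hr : 1 ≤ r) (hA : 0 ≤ A) {s : PilOrder} (h0 : 0 < s)
    (hs : s ≤ .real (1 / (2 * r)).toNNReal) (ρ : {ρ : ℝ // 0 < ρ}) :
    ∃ ρ', AbsorbsExp r A (growthWeight (d := d) s) ρ' ρ := by
  have hr0 : 0 ≤ r := by linarith
  match s with
  | .real s =>
    have hs0 : s ≠ 0 := (show (0 : ℝ≥0) < s from h0).ne'
    refine ⟨⟨ρ + A * 2 ^ r, add_pos_of_pos_of_nonneg ρ.2 (by positivity)⟩,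
      absorbsExp_growth_real (K := A * 2 ^ r) hs0 fun n => ?_⟩
    rw [add_sub_cancel_left]
    exact mul_add_one_rpow_le hA hr0 (PilOrder.le_real hs0 hr hs) n
  | .flat σ =>
    obtain rfl : r = 1 := PilOrder.eq_one_of_flat_lt hr (hs.resolve_right (by simp))
    exact ⟨⟨ρ * Real.exp A, mul_pos ρ.2 (Real.exp_pos _)⟩, absorbsExp_growth_flat σ rfl⟩

end

/-! ### Positivity, monotonicity and directedness of the weights. -/

theorem fact_pos {d : ℕ} (α : MIdx d) : 0 < fact α := Finset.prod_pos fun _ _ => Nat.factorial_pos _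

theorem decayWeight_ne_zero {d : ℕ} (s : PilOrder) (ρ : {ρ : ℝ // 0 < ρ}) (α : MIdx d) :
    decayWeight s ρ α ≠ 0 := by
  match s with
  | .real s =>
    simp only [decayWeight]
    split_ifs <;> simp [Real.exp_pos]
  | .flat σ =>
    have h1 : (0 : ℝ) < fact α := by exact_mod_cast fact_pos α
    have h2 : (0 : ℝ) < (ρ : ℝ) := ρ.2
    simp only [decayWeight, ne_eq, ENNReal.ofReal_eq_zero, not_le]
    positivity

theorem growthWeight_ne_zero {d : ℕ} (s : PilOrder) (ρ : {ρ : ℝ // 0 < ρ}) (α : MIdx d)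
    (h : s ≠ 0 ∨ (len α : ℝ) ≤ ρ) : growthWeight s ρ α ≠ 0 := by
  match s with
  | .real s =>
    simp only [growthWeight]
    split_ifs with h1 h2
    · simp
    · subst h1
      exact absurd (h.resolve_left fun h => h rfl) h2
    · simp [Real.exp_pos]
  | .flat σ =>
    have h1 : (0 : ℝ) < fact α := by exact_mod_cast fact_pos α
    have h2 : (0 : ℝ) < (ρ : ℝ) := ρ.2
    simp only [growthWeight, ne_eq, ENNReal.ofReal_eq_zero, not_le]
    positivity

theorem growthWeight_antitone {d : ℕ} (s : PilOrder) (h0 : 0 < s) :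
    Antitone (growthWeight (d := d) s) := by
  intro ρ ρ' h α
  have hp : (0 : ℝ) < (ρ : ℝ) := ρ.2
  have hp' : (0 : ℝ) < (ρ' : ℝ) := ρ'.2
  have h' : (ρ : ℝ) ≤ ρ' := h
  match s with
  | .real s =>
    have hs0 : s ≠ 0 := (show (0 : ℝ≥0) < s from h0).ne'
    simp only [growthWeight, if_neg hs0]
    refine ENNReal.ofReal_le_ofReal (Real.exp_le_exp.2 ?_)
    gcongr
  | .flat σ =>
    refine ENNReal.ofReal_le_ofReal ?_
    gcongr

/-- The weights increase with `ρ` for real `s > 0` but decrease for `s = 0` and `♭_σ`, so the common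
minorant sits at the minimum or at the maximum of the parameters. -/
theorem decayWeight_directed {d : ℕ} (s : PilOrder) (ρ ρ' : {ρ : ℝ // 0 < ρ}) :
    ∃ ρ'', decayWeight (d := d) s ρ'' ≤ decayWeight s ρ ∧
      decayWeight (d := d) s ρ'' ≤ decayWeight s ρ' := by
  have anti : Antitone (decayWeight (d := d) s) ∨ Monotone (decayWeight (d := d) s) := by
    match s with
    | .real s =>
      rcases eq_or_ne s 0 with rfl | hs
      · left
        intro ρ ρ' h α
        have h' : (ρ : ℝ) ≤ ρ' := h
        simp only [decayWeight, if_true]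
        split_ifs with h1 h2
        · exact le_rfl
        · simp
        · exact absurd (le_trans ‹_› h') h1
        · exact le_rfl
      · right
        intro ρ ρ' h α
        have h' : (ρ : ℝ) ≤ ρ' := h
        simp only [decayWeight, if_neg hs]
        refine ENNReal.ofReal_le_ofReal (Real.exp_le_exp.2 ?_)
        gcongr
    | .flat σ =>
      left
      intro ρ ρ' h α
      have hp : (0 : ℝ) < (ρ : ℝ) := ρ.2
      have hp' : (0 : ℝ) < (ρ' : ℝ) := ρ'.2
      have h' : (ρ : ℝ) ≤ ρ' := h
      refine ENNReal.ofReal_le_ofReal ?_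
      gcongr
  rcases anti with h | h
  · exact ⟨max ρ ρ', h (le_max_left _ _), h (le_max_right _ _)⟩
  · exact ⟨min ρ ρ', h (min_le_left _ _), h (min_le_right _ _)⟩

/-! ### Well-posedness in the limits of weighted sequence spaces -/

section
variable {d : ℕ} {T : ℝ} {w : {ρ : ℝ // 0 < ρ} → MIdx d → ℝ≥0∞}

theorem le_seqNorm (ρ : {ρ : ℝ // 0 < ρ}) (x : Seq d) (α : MIdx d) :
    w ρ α * ‖x α‖ₑ ≤ (seqScale w).N ρ x := le_iSup (fun α => w ρ α * ‖x α‖ₑ) α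

/-- The auxiliary `A` lets one estimate cover both uses: `|x α|` for multipliers and `∫ |F(t) α| dt`
for Duhamel integrals. -/
theorem seqNorm_le {G A : MIdx d → ℝ≥0∞} {K : ℝ≥0} {ρ ρ' : {ρ : ℝ // 0 < ρ}}
    (hK : ∀ α, G α * w ρ α ≤ K * w ρ' α) {b : Seq d} (hb : ∀ α, ‖b α‖ₑ ≤ G α * A α) {B : ℝ≥0∞}
    (hB : ∀ α, w ρ' α * A α ≤ B) : (seqScale w).N ρ b ≤ K * B := by
  refine iSup_le fun α => ?_
  calc w ρ α * ‖b α‖ₑ ≤ w ρ α * (G α * A α) := by gcongr; exact hb α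
    _ = G α * w ρ α * A α := by ring
    _ ≤ K * w ρ' α * A α := mul_le_mul_left (hK α) _
    _ = K * (w ρ' α * A α) := mul_assoc _ _ _
    _ ≤ K * B := by gcongr; exact hB α

theorem aestronglyMeasurable_coef (F : SeqFun d T) (α : MIdx d) :
    AEStronglyMeasurable (fun t => F t α) (volume.restrict (Icc 0 T)) :=
  (continuous_apply α).comp_aestronglyMeasurable F.aestronglyMeasurable

theorem mul_lintegral_le_l1Norm (ρ : {ρ : ℝ // 0 < ρ}) (F : SeqFun d T) (α : MIdx d) :
    w ρ α * ∫⁻ t in Icc 0 T, ‖F t α‖ₑ ≤ (l1Scale T w).N ρ F := by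
  rw [← lintegral_const_mul'' _ (aestronglyMeasurable_coef F α).enorm]
  exact lintegral_mono fun t => le_seqNorm ρ (F t) α

theorem mem_coefIntegrable_of_lt_top {F : SeqFun d T}
    (h : ∀ α, ∃ ρ, w ρ α ≠ 0 ∧ (l1Scale T w).N ρ F < ∞) : F ∈ coefIntegrable d T := by
  intro α
  obtain ⟨ρ, h0, hρ⟩ := h α
  refine ⟨aestronglyMeasurable_coef F α, ?_⟩
  have := (mul_lintegral_le_l1Norm ρ F α).trans_lt hρ
  exact ENNReal.lt_top_of_mul_ne_top_right this.ne h0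

theorem l1Norm_le {G : MIdx d → ℝ≥0∞} {K : ℝ≥0} {ρ ρ' : {ρ : ℝ // 0 < ρ}}
    (hK : ∀ α, G α * w ρ α ≤ K * w ρ' α) {F H : SeqFun d T}
    (h : ∀ᵐ t ∂volume.restrict (Icc 0 T), ∀ α, ‖H t α‖ₑ ≤ G α * ∫⁻ t in Icc 0 T, ‖F t α‖ₑ) :
    (l1Scale T w).N ρ H ≤ (K * T.toNNReal : ℝ≥0) * (l1Scale T w).N ρ' F := by
  calc (l1Scale T w).N ρ H ≤ ∫⁻ _ in Icc 0 T, K * (l1Scale T w).N ρ' F := by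
        refine lintegral_mono_ae ?_
        filter_upwards [h] with t ht
        exact seqNorm_le hK ht fun α => mul_lintegral_le_l1Norm ρ' F α
    _ = _ := by
      rw [lintegral_const, Measure.restrict_apply_univ, Real.volume_Icc, sub_zero, ENNReal.coe_mul]
      change _ = K * ENNReal.ofReal T * _
      ring

theorem coef_mul_linear {m : MIdx d → ℂ} :
    ∃ L : (⊤ : Submodule ℂ (Seq d)) →ₗ[ℂ] Seq d, ∀ x α, L x α = m α * x.1 α :=
  ⟨{ toFun := fun x α => m α * x.1 α
     map_add' := fun x y => funext fun α => mul_add _ _ _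
     map_smul' := fun a x => funext fun α => by
      change m α * (a * x.1 α) = a * (m α * x.1 α)
      ring }, fun _ _ => rfl⟩

theorem wellPosed_projLim {ϱ : Fin d → ℂ} {c : ℂ} {r : ℝ} (hr : 0 ≤ r) (hT : 0 < T)
    (hw : ∀ A, 0 ≤ A → ∀ ρ, ∃ ρ', AbsorbsExp r A w ρ ρ') (h0 : ∀ α, ∃ ρ, w ρ α ≠ 0) :
    WellPosedWithPropagators ϱ c r T (X := (seqScale w).ProjLim) (NormScale.ProjLim.val _)
      (Y := (l1Scale T w).ProjLim) (fun F => ⇑(NormScale.ProjLim.val _ F)) := by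
  obtain ⟨B, hB, hBe⟩ := norm_eigenPow_le ϱ c hr
  let G : MIdx d → ℝ≥0∞ := fun α => ENNReal.ofReal (Real.exp (3 * (T * ‖eigenPow ϱ c r α‖)))
  have hG : ∀ ρ, ∃ ρ', ∃ K : ℝ≥0, ∀ α, G α * w ρ α ≤ K * w ρ' α := fun ρ => by
    obtain ⟨ρ', K, hK⟩ := hw (3 * (T * B)) (by positivity) ρ
    refine ⟨ρ', K, fun α => le_trans ?_ (hK α)⟩
    gcongr
    refine ENNReal.ofReal_le_ofReal (Real.exp_le_exp.2 ?_)
    calc _ ≤ 3 * (T * (B * ((len α : ℝ) + 1) ^ r)) := by gcongr; exact hBe α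
      _ = _ := by ring
  have hmem : ⨅ ρ, (l1Scale T w).step ρ ≤ coefIntegrable d T := fun F hF =>
    mem_coefIntegrable_of_lt_top (w := w) fun α => (h0 α).imp fun ρ hρ =>
      ⟨hρ, (Submodule.mem_iInf _).1 hF ρ⟩
  refine wellPosedWithPropagators_of_stable hT _ (NormScale.ProjLim.val_injective _) _ G
    (fun _ => rfl) (fun F => hmem (NormScale.ProjLim.val_mem _ F)) (fun m hm => ?_)
    (fun L hL => NormScale.projLim_equicontinuous (fun t => L t) fun ρ => ?_) (fun F a ha => ?_)
    (fun L hL => ?_)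
  · obtain ⟨L, hL⟩ := coef_mul_linear (m := m)
    obtain ⟨E, hE⟩ := NormScale.exists_projMap (S := seqScale w) (S' := seqScale w) ⊤ le_top L
      fun ρ => by
        obtain ⟨ρ', K, hK⟩ := hG ρ
        refine ⟨ρ', K, fun x => seqNorm_le hK (fun α => ?_) fun α => le_seqNorm ρ' x.1 α⟩
        rw [hL, enorm_mul]
        gcongr
        exact hm α
    exact ⟨E, fun x α => by rw [hE, hL]⟩
  · obtain ⟨ρ', K, hK⟩ := hG ρ
    exact ⟨ρ', K, fun t x => seqNorm_le hK (hL t x) fun α => le_seqNorm ρ' _ α⟩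
  · refine ⟨⟨a, (Submodule.mem_iInf _).2 fun ρ => ?_⟩, rfl⟩
    obtain ⟨ρ', K, hK⟩ := hG ρ
    exact (seqNorm_le hK ha fun α => mul_lintegral_le_l1Norm ρ' _ α).trans_lt
      (ENNReal.mul_lt_top (by simp) (NormScale.ProjLim.lt_top _ F ρ'))
  · refine NormScale.exists_projMap (S := l1Scale T w) (S' := l1Scale T w) _ hmem L fun ρ => ?_
    obtain ⟨ρ', K, hK⟩ := hG ρ
    exact ⟨ρ', _, fun F => l1Norm_le hK (hL F)⟩

theorem wellPosed_indLim {ϱ : Fin d → ℂ} {c : ℂ} {r : ℝ} (hr : 0 ≤ r) (hT : 0 < T)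
    (hw : ∀ A, 0 ≤ A → ∀ ρ, ∃ ρ', AbsorbsExp r A w ρ' ρ) (h0 : ∀ ρ α, w ρ α ≠ 0)
    (hdir : ∀ ρ ρ', ∃ ρ'', w ρ'' ≤ w ρ ∧ w ρ'' ≤ w ρ') :
    WellPosedWithPropagators ϱ c r T (X := (seqScale w).IndLim) (NormScale.IndLim.val _)
      (Y := (l1Scale T w).IndLim) (fun F => ⇑(NormScale.IndLim.val _ F)) := by
  obtain ⟨B, hB, hBe⟩ := norm_eigenPow_le ϱ c hr
  let G : MIdx d → ℝ≥0∞ := fun α => ENNReal.ofReal (Real.exp (3 * (T * ‖eigenPow ϱ c r α‖)))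
  have hG : ∀ ρ, ∃ ρ', ∃ K : ℝ≥0, ∀ α, G α * w ρ' α ≤ K * w ρ α := fun ρ => by
    obtain ⟨ρ', K, hK⟩ := hw (3 * (T * B)) (by positivity) ρ
    refine ⟨ρ', K, fun α => le_trans ?_ (hK α)⟩
    gcongr
    refine ENNReal.ofReal_le_ofReal (Real.exp_le_exp.2 ?_)
    calc _ ≤ 3 * (T * (B * ((len α : ℝ) + 1) ^ r)) := by gcongr; exact hBe α
      _ = _ := by ring
  have hmem : ⨆ ρ, (l1Scale T w).step ρ ≤ coefIntegrable d T := iSup_le fun ρ F hF =>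
    mem_coefIntegrable_of_lt_top (w := w) fun α => ⟨ρ, h0 ρ α, hF⟩
  have hstep : ∀ ρ ρ', w ρ ≤ w ρ' → (l1Scale T w).step ρ' ≤ (l1Scale T w).step ρ := by
    intro ρ ρ' h F hF
    refine lt_of_le_of_lt (lintegral_mono fun t => iSup_mono fun α => ?_) hF
    exact mul_le_mul_left (h α) _
  have hdirected : Directed (· ≤ ·) (l1Scale T w).step := fun ρ ρ' => by
    obtain ⟨ρ'', h1, h2⟩ := hdir ρ ρ'
    exact ⟨ρ'', hstep _ _ h1, hstep _ _ h2⟩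
  refine wellPosedWithPropagators_of_stable hT _ (NormScale.IndLim.val_injective _) _ G
    (fun _ => rfl) (fun F => hmem (NormScale.IndLim.val_mem _ F)) (fun m hm => ?_)
    (fun L hL => ?_) (fun F a ha => ?_) (fun L hL => ?_)
  · obtain ⟨L, hL⟩ := coef_mul_linear (m := m)
    obtain ⟨E, hE⟩ := NormScale.exists_indMap (S := seqScale w) (S' := seqScale w) ⊤ le_top L
      fun ρ => by
        obtain ⟨ρ', K, hK⟩ := hG ρ
        refine ⟨ρ', K, fun x => seqNorm_le hK (fun α => ?_) fun α => le_seqNorm ρ x.1 α⟩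
        rw [hL, enorm_mul]
        gcongr
        exact hm α
    exact ⟨E, fun x α => by rw [hE, hL]⟩
  · have : Nonempty (Icc 0 T) := ⟨⟨0, left_mem_Icc.2 hT.le⟩⟩
    refine NormScale.indLim_equicontinuous L fun ρ => ?_
    obtain ⟨ρ', K, hK⟩ := hG ρ
    exact ⟨ρ', K, fun t x => seqNorm_le hK (hL t x) fun α => le_seqNorm ρ _ α⟩
  -- The sequence `a` need not depend linearly on `F`, so a decomposition of `F` into summands would
  -- not help; directedness puts `F` into a single step.
  · obtain ⟨ρ, hρ⟩ := (Submodule.mem_iSup_of_directed _ hdirected).1 (NormScale.IndLim.val_mem _ F)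
    obtain ⟨ρ', K, hK⟩ := hG ρ
    refine ⟨⟨a, le_iSup (seqScale w).step ρ' ?_⟩, rfl⟩
    exact (seqNorm_le hK ha fun α => mul_lintegral_le_l1Norm ρ _ α).trans_lt
      (ENNReal.mul_lt_top (by simp) hρ)
  · refine NormScale.exists_indMap (S := l1Scale T w) (S' := l1Scale T w) _ hmem L fun ρ => ?_
    obtain ⟨ρ', K, hK⟩ := hG ρ
    exact ⟨ρ', _, fun F => l1Norm_le hK (hL F)⟩

end

theorem wellPosed_pilipovic {d : ℕ} {ϱ : Fin d → ℂ} {c : ℂ} {r T : ℝ} (hr : 1 ≤ r) (hT : 0 < T)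
    (s₁ s₂ : PilOrder) (h0 : 0 < s₁) (h1 : s₁ ≤ .real (1 / (2 * r)).toNNReal)
    (h2 : s₂ < .real (1 / (2 * r)).toNNReal) :
    WellPosedWithPropagators ϱ c r T
        (X := HBeurling d s₁) (NormScale.ProjLim.val _)
        (Y := L1HBeurling d T s₁) (fun F => ⇑(NormScale.ProjLim.val _ F)) ∧
      WellPosedWithPropagators ϱ c r T
        (X := HRoumieu d s₂) (NormScale.IndLim.val _)
        (Y := L1HRoumieu d T s₂) (fun F => ⇑(NormScale.IndLim.val _ F)) ∧
      WellPosedWithPropagators ϱ c r T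
        (X := HRoumieuDual d s₂) (NormScale.ProjLim.val _)
        (Y := L1HRoumieuDual d T s₂) (fun F => ⇑(NormScale.ProjLim.val _ F)) ∧
      WellPosedWithPropagators ϱ c r T
        (X := HBeurlingDual d s₁) (NormScale.IndLim.val _)
        (Y := L1HBeurlingDual d T s₁) (fun F => ⇑(NormScale.IndLim.val _ F)) := by
  have hr0 : 0 ≤ r := by linarith
  have hne : s₁ ≠ 0 := by
    rintro rfl
    exact lt_irrefl (0 : ℝ≥0) h0
  refine ⟨wellPosed_projLim hr0 hT (fun A hA => decayWeight_absorbs_proj hr hA h0 h1)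
      fun α => ⟨⟨1, one_pos⟩, decayWeight_ne_zero _ _ _⟩,
    wellPosed_indLim hr0 hT (fun A hA => decayWeight_absorbs_ind hr hA h2)
      (decayWeight_ne_zero _) (decayWeight_directed _),
    wellPosed_projLim hr0 hT (fun A hA => growthWeight_absorbs_proj hr hA h2)
      -- For `s₂ = 0` the weight vanishes on degrees above `ρ`, so `ρ` has to depend on `α`.
      fun α => ⟨⟨len α + 1, by positivity⟩, growthWeight_ne_zero _ _ _ (.inr (by simp))⟩,
    wellPosed_indLim hr0 hT (fun A hA => growthWeight_absorbs_ind hr hA h0 h1)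
      (fun _ _ => growthWeight_ne_zero _ _ _ (.inl hne)) fun ρ ρ' =>
        ⟨max ρ ρ', growthWeight_antitone _ h0 (le_max_left _ _),
          growthWeight_antitone _ h0 (le_max_right _ _)⟩⟩

/-! ### Hermite functions on the line -/

theorem contDiff_gaussian : ContDiff ℝ ((⊤ : ℕ∞) : WithTop ℕ∞) fun y : ℝ => Real.exp (-y ^ 2) := by fun_prop

theorem hasDerivAt_iteratedDeriv_gaussian (n : ℕ) (x : ℝ) :
    HasDerivAt (iteratedDeriv n fun y : ℝ => Real.exp (-y ^ 2))
      (iteratedDeriv (n + 1) (fun y : ℝ => Real.exp (-y ^ 2)) x) x := by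
  rw [iteratedDeriv_succ]
  exact ((contDiff_gaussian.differentiable_iteratedDeriv n
    (mod_cast ENat.natCast_lt_top n)) x).hasDerivAt

theorem iteratedDeriv_one_gaussian (x : ℝ) :
    iteratedDeriv 1 (fun y : ℝ => Real.exp (-y ^ 2)) x = -2 * x * Real.exp (-x ^ 2) := by
  rw [iteratedDeriv_one]
  have h := ((hasDerivAt_pow 2 x).fun_neg.exp).deriv
  rw [h]
  norm_num
  ring

/-- The Gaussian satisfies `g' = -2xg`; each further differentiation of this relation contributes
one more lower-order term. -/
theorem iteratedDeriv_gaussian_succ_succ (n : ℕ) (x : ℝ) :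
    iteratedDeriv (n + 2) (fun y : ℝ => Real.exp (-y ^ 2)) x =
      -2 * x * iteratedDeriv (n + 1) (fun y : ℝ => Real.exp (-y ^ 2)) x -
        2 * (n + 1) * iteratedDeriv n (fun y : ℝ => Real.exp (-y ^ 2)) x := by
  induction n generalizing x with
  | zero =>
    have h1 := hasDerivAt_iteratedDeriv_gaussian 1 x
    have h0 := hasDerivAt_iteratedDeriv_gaussian 0 x
    have h2 := ((hasDerivAt_id x).const_mul (-2)).mul h0
    have h3 : iteratedDeriv 1 (fun y : ℝ => Real.exp (-y ^ 2)) =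
        (fun x => -2 * id x) * iteratedDeriv 0 fun y : ℝ => Real.exp (-y ^ 2) := by
      funext x
      simp [iteratedDeriv_one_gaussian]
    rw [← h3] at h2
    rw [h1.unique h2]
    simp
    ring
  | succ n ih =>
    have h1 := hasDerivAt_iteratedDeriv_gaussian (n + 2) x
    have h2 := (((hasDerivAt_id x).const_mul (-2)).mul
      (hasDerivAt_iteratedDeriv_gaussian (n + 1) x)).sub
      ((hasDerivAt_iteratedDeriv_gaussian n x).const_mul (2 * ((n : ℝ) + 1)))
    have h3 : iteratedDeriv (n + 2) (fun y : ℝ => Real.exp (-y ^ 2)) =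
        ((fun x => -2 * id x) * iteratedDeriv (n + 1) fun y : ℝ => Real.exp (-y ^ 2)) -
          fun x => 2 * ((n : ℝ) + 1) * iteratedDeriv n (fun y : ℝ => Real.exp (-y ^ 2)) x := by
      funext x
      simp [ih]
    rw [← h3] at h2
    rw [h1.unique h2]
    push_cast
    simp
    ring

/-- The normalizing constant of the Hermite function. -/
def hermiteConst (n : ℕ) : ℝ :=
  Real.pi ^ (-(1 / 4 : ℝ)) * (-1) ^ n * ((2 : ℝ) ^ n * n !) ^ (-(1 / 2 : ℝ))

theorem hermite1_eq (n : ℕ) (x : ℝ) : hermite1 n x = hermiteConst n * Real.exp (x ^ 2 / 2) *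
    iteratedDeriv n (fun y => Real.exp (-y ^ 2)) x := rfl

theorem hermiteConst_eq_neg (n : ℕ) :
    hermiteConst n = -√(2 * (n + 1)) * hermiteConst (n + 1) := by
  have h1 : (2 : ℝ) ^ (n + 1) * (n + 1)! = (2 * (n + 1)) * (2 ^ n * n !) := by
    rw [Nat.factorial_succ]
    push_cast
    ring
  have h2 : √(2 * ((n : ℝ) + 1)) * (2 * ((n : ℝ) + 1)) ^ (-(1 / 2 : ℝ)) = 1 := by
    rw [Real.sqrt_eq_rpow, ← Real.rpow_add (by positivity)]
    norm_num
  rw [hermiteConst, hermiteConst, h1, Real.mul_rpow (x := 2 * ((n : ℝ) + 1)) (by positivity) (by positivity),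
    pow_succ]
  linear_combination (-(Real.pi ^ (-(1 / 4 : ℝ)) * (-1) ^ n *
    ((2 : ℝ) ^ n * n !) ^ (-(1 / 2 : ℝ)))) * h2

theorem hasDerivAt_hermite1_raising (n : ℕ) (x : ℝ) :
    HasDerivAt (hermite1 n) (x * hermite1 n x - √(2 * (n + 1)) * hermite1 (n + 1) x) x := by
  have h1 : HasDerivAt (fun x : ℝ => Real.exp (x ^ 2 / 2)) (Real.exp (x ^ 2 / 2) * x) x := by
    have := ((hasDerivAt_pow 2 x).div_const 2).exp
    refine this.congr_deriv ?_
    norm_num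
  have h2 := (h1.const_mul (hermiteConst n)).mul (hasDerivAt_iteratedDeriv_gaussian n x)
  refine h2.congr_deriv ?_
  rw [hermite1_eq, hermite1_eq]
  have := hermiteConst_eq_neg n
  linear_combination (Real.exp (x ^ 2 / 2) *
    iteratedDeriv (n + 1) (fun y => Real.exp (-y ^ 2)) x) * this

theorem mul_hermite1_zero (x : ℝ) : √(2 * (0 + 1)) * hermite1 1 x = 2 * x * hermite1 0 x := by
  have := hermiteConst_eq_neg 0
  rw [hermite1_eq, hermite1_eq, iteratedDeriv_one_gaussian, iteratedDeriv_zero, this]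
  push_cast
  ring

theorem mul_hermite1_succ (n : ℕ) (x : ℝ) : √(2 * ((n : ℝ) + 1 + 1)) * hermite1 (n + 2) x =
    2 * x * hermite1 (n + 1) x - √(2 * (n + 1)) * hermite1 n x := by
  have h1 := hermiteConst_eq_neg n
  have h2 := hermiteConst_eq_neg (n + 1)
  push_cast at h2
  have h3 : √(2 * ((n : ℝ) + 1)) * √(2 * ((n : ℝ) + 1)) = 2 * (n + 1) :=
    Real.mul_self_sqrt (by positivity)
  rw [hermite1_eq, hermite1_eq, hermite1_eq, iteratedDeriv_gaussian_succ_succ]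
  generalize iteratedDeriv (n + 1) (fun y => Real.exp (-y ^ 2)) x = a
  generalize iteratedDeriv n (fun y => Real.exp (-y ^ 2)) x = b
  rw [h1, h2]
  linear_combination (Real.exp (x ^ 2 / 2) * b * √(2 * ((n : ℝ) + 1 + 1)) *
    hermiteConst (n + 2)) * h3

theorem sqrt_two_mul (a : ℝ) : √(2 * a) = 2 * √(a / 2) := by
  rw [show 2 * a = 2 ^ 2 * (a / 2) by ring, Real.sqrt_mul (by positivity),
    Real.sqrt_sq (by norm_num)]

/-- At `n = 0` the truncated index `n - 1` is harmless because its coefficient `√(n/2)` vanishes. -/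
theorem mul_hermite1 (n : ℕ) (x : ℝ) : x * hermite1 n x =
    √(n / 2) * hermite1 (n - 1) x + √((n + 1) / 2) * hermite1 (n + 1) x := by
  rcases n with - | n
  · have := mul_hermite1_zero x
    rw [sqrt_two_mul] at this
    simp at this ⊢
    linarith
  · have := mul_hermite1_succ n x
    rw [sqrt_two_mul, sqrt_two_mul] at this
    push_cast
    linarith

theorem hasDerivAt_hermite1 (n : ℕ) (x : ℝ) : HasDerivAt (hermite1 n)
    (√(n / 2) * hermite1 (n - 1) x - √((n + 1) / 2) * hermite1 (n + 1) x) x := by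
  refine (hasDerivAt_hermite1_raising n x).congr_deriv ?_
  rw [mul_hermite1, sqrt_two_mul]
  ring

theorem continuous_hermite1 (n : ℕ) : Continuous (hermite1 n) :=
  continuous_iff_continuousAt.2 fun x => (hasDerivAt_hermite1 n x).continuousAt

theorem contDiff_hermite1 (n : ℕ) : ContDiff ℝ ((⊤ : ℕ∞) : WithTop ℕ∞) (hermite1 n) := by
  have h1 : ContDiff ℝ ((⊤ : ℕ∞) : WithTop ℕ∞) fun x : ℝ => hermiteConst n * Real.exp (x ^ 2 / 2) := by fun_prop
  have h2 : ContDiff ℝ ((⊤ : ℕ∞) : WithTop ℕ∞) (iteratedDeriv n fun y : ℝ => Real.exp (-y ^ 2)) := by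
    rw [iteratedDeriv_eq_iterate]
    exact contDiff_gaussian.iterate_deriv n
  exact h1.mul h2

theorem hermite1_zero (x : ℝ) :
    hermite1 0 x = Real.pi ^ (-(1 / 4 : ℝ)) * Real.exp (-(x ^ 2 / 2)) := by
  rw [hermite1]
  simp only [pow_zero, Nat.factorial_zero, Nat.cast_one, mul_one, Real.one_rpow, iteratedDeriv_zero]
  rw [mul_assoc, ← Real.exp_add]
  ring_nf

/-- Solving the three-term recurrence for `h_{n+1}` costs one power of `x` on `h_n`, so decay of all
orders propagates from the Gaussian by a two-step induction. -/
theorem exists_pow_mul_hermite1_le (n k : ℕ) : ∃ C, ∀ x, |x| ^ k * |hermite1 n x| ≤ C := by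
  have step : ∀ n, (∀ k, ∃ C, ∀ x, |x| ^ k * |hermite1 n x| ≤ C) →
      (∀ k, ∃ C, ∀ x, |x| ^ k * |√(n / 2) * hermite1 (n - 1) x| ≤ C) →
      ∀ k, ∃ C, ∀ x, |x| ^ k * |hermite1 (n + 1) x| ≤ C := by
    intro n h1 h2 k
    obtain ⟨C, hC⟩ := h1 (k + 1)
    obtain ⟨C', hC'⟩ := h2 k
    have hs : 0 < √(((n : ℝ) + 1) / 2) := Real.sqrt_pos.2 (by positivity)
    refine ⟨(C + C') / √(((n : ℝ) + 1) / 2), fun x => ?_⟩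
    rw [le_div_iff₀ hs]
    have h3 : √(((n : ℝ) + 1) / 2) * hermite1 (n + 1) x =
        x * hermite1 n x - √(n / 2) * hermite1 (n - 1) x := by
      rw [mul_hermite1]; ring
    calc |x| ^ k * |hermite1 (n + 1) x| * √(((n : ℝ) + 1) / 2)
        = |x| ^ k * |√(((n : ℝ) + 1) / 2) * hermite1 (n + 1) x| := by
          rw [abs_mul, abs_of_pos hs]; ring
      _ ≤ |x| ^ k * (|x * hermite1 n x| + |√(n / 2) * hermite1 (n - 1) x|) := by
          rw [h3]
          gcongr
          exact abs_sub _ _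
      _ = |x| ^ (k + 1) * |hermite1 n x| + |x| ^ k * |√(n / 2) * hermite1 (n - 1) x| := by
          rw [abs_mul x]; ring
      _ ≤ C + C' := add_le_add (hC x) (hC' x)
  have base : ∀ k, ∃ C, ∀ x, |x| ^ k * |hermite1 0 x| ≤ C := by
    intro k
    refine ⟨k ! * Real.exp 1 * Real.pi ^ (-(1 / 4 : ℝ)), fun x => ?_⟩
    rw [hermite1_zero, abs_mul, abs_of_pos (Real.exp_pos _),
      abs_of_nonneg (by positivity : (0 : ℝ) ≤ Real.pi ^ (-(1 / 4 : ℝ)))]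
    have h1 : |x| ^ k ≤ k ! * Real.exp |x| := by
      have := Real.pow_div_factorial_le_exp |x| (abs_nonneg x) k
      rwa [div_le_iff₀' (by positivity)] at this
    have h2 : Real.exp |x| * Real.exp (-(x ^ 2 / 2)) ≤ Real.exp 1 := by
      rw [← Real.exp_add]
      refine Real.exp_le_exp.2 ?_
      nlinarith [sq_nonneg (|x| - 1), sq_abs x]
    calc |x| ^ k * (Real.pi ^ (-(1 / 4 : ℝ)) * Real.exp (-(x ^ 2 / 2)))
        ≤ (k ! * Real.exp |x|) * (Real.pi ^ (-(1 / 4 : ℝ)) * Real.exp (-(x ^ 2 / 2))) := by gcongr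
      _ = k ! * (Real.exp |x| * Real.exp (-(x ^ 2 / 2))) * Real.pi ^ (-(1 / 4 : ℝ)) := by ring
      _ ≤ k ! * Real.exp 1 * Real.pi ^ (-(1 / 4 : ℝ)) := by gcongr
  have key : ∀ n, (∀ k, ∃ C, ∀ x, |x| ^ k * |hermite1 n x| ≤ C) ∧
      (∀ k, ∃ C, ∀ x, |x| ^ k * |hermite1 (n + 1) x| ≤ C) := by
    intro n
    induction n with
    | zero => exact ⟨base, step 0 base fun k => ⟨0, by simp⟩⟩
    | succ n ih =>
      refine ⟨ih.2, step (n + 1) ih.2 fun k => ?_⟩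
      obtain ⟨C, hC⟩ := ih.1 k
      refine ⟨√((n + 1 : ℕ) / 2) * C, fun x => ?_⟩
      rw [abs_mul, abs_of_nonneg (Real.sqrt_nonneg _), mul_left_comm]
      exact mul_le_mul_of_nonneg_left (hC x) (Real.sqrt_nonneg _)
  exact (key n).1 k

theorem exists_one_add_sq_mul_hermite1_le (n : ℕ) :
    ∃ C, 0 ≤ C ∧ ∀ x, |hermite1 n x| ≤ C * (1 + x ^ 2)⁻¹ := by
  obtain ⟨C, hC⟩ := exists_pow_mul_hermite1_le n 0
  obtain ⟨C', hC'⟩ := exists_pow_mul_hermite1_le n 2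
  have hC0 := (by positivity : (0 : ℝ) ≤ _).trans (hC 0)
  have hC0' := (by positivity : (0 : ℝ) ≤ _).trans (hC' 0)
  refine ⟨C + C', by positivity, fun x => ?_⟩
  rw [← div_eq_mul_inv, le_div_iff₀ (by positivity)]
  have h1 := hC x
  have h2 := hC' x
  rw [sq_abs] at h2
  linarith

theorem integrable_hermite1_mul (m n : ℕ) : Integrable fun x => hermite1 m x * hermite1 n x := by
  obtain ⟨C, hC0, hC⟩ := exists_one_add_sq_mul_hermite1_le m
  obtain ⟨C', hC'⟩ := exists_pow_mul_hermite1_le n 0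
  refine (integrable_inv_one_add_sq.const_mul (C * C')).mono'
    ((continuous_hermite1 m).mul (continuous_hermite1 n)).aestronglyMeasurable
    (Eventually.of_forall fun x => ?_)
  have h := hC' x
  rw [pow_zero, one_mul] at h
  rw [norm_mul, Real.norm_eq_abs, Real.norm_eq_abs]
  calc _ ≤ (C * (1 + x ^ 2)⁻¹) * C' := mul_le_mul (hC x) h (abs_nonneg _) (by positivity)
    _ = _ := by ring

theorem tendsto_hermite1_cocompact (n : ℕ) : Tendsto (hermite1 n) (cocompact ℝ) (𝓝 0) := by
  obtain ⟨C, hC0, hC⟩ := exists_one_add_sq_mul_hermite1_le n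
  refine squeeze_zero_norm (a := fun x => C * (1 + ‖x‖ ^ 2)⁻¹) (fun x => ?_) ?_
  · rw [Real.norm_eq_abs, Real.norm_eq_abs, sq_abs]
    exact hC x
  · have h1 : Tendsto (fun x : ℝ => 1 + ‖x‖ ^ 2) (cocompact ℝ) atTop :=
      tendsto_atTop_add_const_left _ _
        ((tendsto_pow_atTop two_ne_zero).comp (tendsto_norm_cocompact_atTop (E := ℝ)))
    simpa using h1.inv_tendsto_atTop.const_mul C

theorem tendsto_hermite1_mul (m n : ℕ) :
    Tendsto (fun x => hermite1 m x * hermite1 n x) (cocompact ℝ) (𝓝 0) := by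
  simpa using (tendsto_hermite1_cocompact m).mul (tendsto_hermite1_cocompact n)

/-- The derivative of `h_m h_n` integrates to zero; the recurrence for `x h_m h_n`, applied through
either factor, leaves only one lowering and one raising term. -/
theorem integral_hermite1_succ_mul (m n : ℕ) :
    √((m + 1) / 2) * ∫ x, hermite1 (m + 1) x * hermite1 n x =
      √(n / 2) * ∫ x, hermite1 m x * hermite1 (n - 1) x := by
  have hd : ∀ x, HasDerivAt (fun x => hermite1 m x * hermite1 n x)
      (2 * (√(n / 2) * (hermite1 m x * hermite1 (n - 1) x) -
        √((m + 1) / 2) * (hermite1 (m + 1) x * hermite1 n x))) x := by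
    intro x
    refine ((hasDerivAt_hermite1 m x).mul (hasDerivAt_hermite1 n x)).congr_deriv ?_
    linear_combination hermite1 m x * mul_hermite1 n x - hermite1 n x * mul_hermite1 m x
  have i1 := (integrable_hermite1_mul m (n - 1)).const_mul √(n / 2)
  have i2 := (integrable_hermite1_mul (m + 1) n).const_mul √((m + 1) / 2)
  have h := integral_of_hasDerivAt_of_tendsto hd ((i1.sub i2).const_mul 2)
    ((tendsto_hermite1_mul m n).mono_left atBot_le_cocompact)
    ((tendsto_hermite1_mul m n).mono_left atTop_le_cocompact)
  rw [integral_const_mul, integral_sub i1 i2, integral_const_mul, integral_const_mul] at h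
  linarith

/-- Both indices are lowered together until one of them is zero, where a Gaussian integral or the
vanishing factor `√0` decides. -/
theorem integral_hermite1_mul (m n : ℕ) :
    ∫ x, hermite1 m x * hermite1 n x = if m = n then 1 else 0 := by
  have hzero : ∀ m, ∫ x, hermite1 (m + 1) x * hermite1 0 x = 0 := by
    intro m
    have h := integral_hermite1_succ_mul m 0
    have hs : 0 < √(((m : ℝ) + 1) / 2) := Real.sqrt_pos.2 (by positivity)
    rw [Nat.cast_zero, zero_div, Real.sqrt_zero, zero_mul] at h
    exact (mul_eq_zero.1 h).resolve_left hs.ne'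
  induction m generalizing n with
  | zero =>
    rcases n with - | n
    · have h1 : ∀ x, hermite1 0 x * hermite1 0 x =
          Real.pi ^ (-(1 / 2 : ℝ)) * Real.exp (-1 * x ^ 2) := by
        intro x
        rw [hermite1_zero, mul_mul_mul_comm, ← Real.exp_add, ← Real.rpow_add Real.pi_pos]
        rw [show (-(1 / 4) + -(1 / 4) : ℝ) = -(1 / 2) by norm_num]
        congr 2
        ring
      simp only [h1]
      rw [integral_const_mul, integral_gaussian, div_one, Real.sqrt_eq_rpow,
        ← Real.rpow_add Real.pi_pos]
      norm_num
    · simp only [mul_comm (hermite1 0 _)]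
      rw [hzero]
      simp
  | succ m ih =>
    rcases n with - | n
    · rw [hzero]; simp
    · have h := integral_hermite1_succ_mul m (n + 1)
      rw [Nat.add_sub_cancel, ih] at h
      have hs : 0 < √(((m : ℝ) + 1) / 2) := Real.sqrt_pos.2 (by positivity)
      by_cases hmn : m = n
      · subst hmn
        rw [if_pos rfl, Nat.cast_succ] at h
        rw [if_pos rfl]
        exact mul_left_cancel₀ hs.ne' h
      · rw [if_neg hmn, mul_zero] at h
        rw [if_neg (by omega)]
        exact (mul_eq_zero.1 h).resolve_left hs.ne'

/-- By `h_n(x)² = ∫_{-∞}^x 2 h_n h_n' ≤ ∫ (h_n² + h_n'²) = n + 3/2`, the last value following from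
orthonormality. Polynomial growth in `n` is all that is needed. -/
theorem abs_hermite1_le (n : ℕ) (x : ℝ) : |hermite1 n x| ≤ n + 2 := by
  let D : ℝ → ℝ := fun x => √(n / 2) * hermite1 (n - 1) x - √((n + 1) / 2) * hermite1 (n + 1) x
  have hn : (n - 1 : ℕ) ≠ n + 1 := by omega
  have hDD : ∀ x, D x * D x = n / 2 * (hermite1 (n - 1) x * hermite1 (n - 1) x) -
      2 * √(n / 2) * √((n + 1) / 2) * (hermite1 (n - 1) x * hermite1 (n + 1) x) +
      (n + 1) / 2 * (hermite1 (n + 1) x * hermite1 (n + 1) x) := by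
    intro x
    have h1 : √((n : ℝ) / 2) * √(n / 2) = n / 2 := Real.mul_self_sqrt (by positivity)
    have h2 : √(((n : ℝ) + 1) / 2) * √((n + 1) / 2) = (n + 1) / 2 :=
      Real.mul_self_sqrt (by positivity)
    simp only [D]
    linear_combination hermite1 (n - 1) x * hermite1 (n - 1) x * h1 +
      hermite1 (n + 1) x * hermite1 (n + 1) x * h2
  have i1 := (integrable_hermite1_mul (n - 1) (n - 1)).const_mul ((n : ℝ) / 2)
  have i2 := (integrable_hermite1_mul (n - 1) (n + 1)).const_mul (2 * √(n / 2) * √((n + 1) / 2))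
  have i3 := (integrable_hermite1_mul (n + 1) (n + 1)).const_mul (((n : ℝ) + 1) / 2)
  have iDD : Integrable fun x => D x * D x := by
    simp only [hDD]
    exact (i1.sub i2).add i3
  have hDDi : ∫ x, D x * D x = n + 1 / 2 := by
    simp only [hDD]
    rw [integral_add (f := fun x => n / 2 * (hermite1 (n - 1) x * hermite1 (n - 1) x) -
      2 * √(n / 2) * √((n + 1) / 2) * (hermite1 (n - 1) x * hermite1 (n + 1) x)) (i1.sub i2) i3,
      integral_sub i1 i2, integral_const_mul, integral_const_mul, integral_const_mul,
      integral_hermite1_mul, integral_hermite1_mul, integral_hermite1_mul,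
      if_neg hn]
    simp
    ring
  have iS := (integrable_hermite1_mul n n).add iDD
  have iHD : Integrable fun x => D x * hermite1 n x + hermite1 n x * D x := by
    have h1 := (integrable_hermite1_mul (n - 1) n).const_mul √(n / 2)
    have h2 := (integrable_hermite1_mul (n + 1) n).const_mul √((n + 1) / 2)
    refine ((h1.sub h2).const_mul 2).congr (Eventually.of_forall fun x => ?_)
    simp only [D, Pi.sub_apply]
    ring
  have hI := integral_Iic_of_hasDerivAt_of_tendsto' (a := x)
    (fun x _ => (hasDerivAt_hermite1 n x).mul (hasDerivAt_hermite1 n x)) iHD.integrableOn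
    ((tendsto_hermite1_mul n n).mono_left atBot_le_cocompact)
  have h1 : hermite1 n x * hermite1 n x ≤ n + 3 / 2 := by
    calc hermite1 n x * hermite1 n x
        = ∫ x in Iic x, (D x * hermite1 n x + hermite1 n x * D x) := by
          rw [sub_zero] at hI
          exact hI.symm
      _ ≤ ∫ x in Iic x, (hermite1 n x * hermite1 n x + D x * D x) := by
          refine setIntegral_mono iHD.integrableOn iS.integrableOn fun x => ?_
          simp only
          nlinarith [sq_nonneg (D x - hermite1 n x)]
      _ ≤ ∫ x, (hermite1 n x * hermite1 n x + D x * D x) :=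
          setIntegral_le_integral iS (Eventually.of_forall fun x =>
            add_nonneg (mul_self_nonneg _) (mul_self_nonneg _))
      _ = n + 3 / 2 := by
          rw [integral_add (integrable_hermite1_mul n n) iDD, hDDi, integral_hermite1_mul]
          simp
          ring
  refine abs_le_of_sq_le_sq ?_ (by positivity)
  have : (0 : ℝ) ≤ n := Nat.cast_nonneg _
  nlinarith

/-! ### Bounds for words in the position and derivative operators -/

/-- A bound, at a Hermite function of degree `m`, for words of length `n` in the position and
derivative operators. -/
def wordBound (d : ℕ) : ℕ → ℕ → ℝ
  | 0, m => ((m : ℝ) + 2) ^ d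
  | n + 1, m => √(2 * (m + 1)) * wordBound d n (m + 1)

theorem wordBound_nonneg (d n m : ℕ) : 0 ≤ wordBound d n m := by
  induction n generalizing m with
  | zero => exact pow_nonneg (by positivity) _
  | succ n ih => exact mul_nonneg (Real.sqrt_nonneg _) (ih _)

theorem wordBound_mono (d n : ℕ) {m m' : ℕ} (h : m ≤ m') : wordBound d n m ≤ wordBound d n m' := by
  have h' : (m : ℝ) ≤ m' := by exact_mod_cast h
  induction n generalizing m m' with
  | zero =>
    simp only [wordBound]
    gcongr
  | succ n ih =>
    refine mul_le_mul (Real.sqrt_le_sqrt (by linarith)) (ih (by omega) (by push_cast; linarith))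
      (wordBound_nonneg _ _ _) (Real.sqrt_nonneg _)

theorem wordBound_eq (d n m : ℕ) :
    wordBound d n m = √(2 ^ n * (m + 1).ascFactorial n) * ((m : ℝ) + n + 2) ^ d := by
  induction n generalizing m with
  | zero => simp [wordBound]
  | succ n ih =>
    have h : ((m + 1).ascFactorial (n + 1) : ℝ) = (m + 1) * (m + 1 + 1).ascFactorial n := by
      have := Nat.succ_ascFactorial (m + 1) n
      rw [Nat.ascFactorial_succ, ← this]
      push_cast
      rfl
    rw [wordBound, ih, h, ← mul_assoc, ← Real.sqrt_mul (by positivity)]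
    push_cast
    congr 2 <;> ring

/-- Words of length `n` are bounded by `√(n!)` up to exponential factors, of which the one that
depends on the degree is arbitrarily small. -/
theorem exists_wordBound_le (d : ℕ) {δ : ℝ} (hδ : 0 < δ) : ∃ C K : ℝ, 0 < C ∧ 1 ≤ K ∧
    ∀ n m : ℕ, wordBound d n m ≤ C * Real.exp (δ * m) * (K ^ n * √(n !)) := by
  set ε := δ / 2 with hε
  have hε0 : 0 < ε := by positivity
  set θ := 1 - Real.exp (-ε) with hθ
  have hexp : Real.exp (-ε) < 1 := by
    have := Real.exp_lt_exp.2 (neg_lt_zero.2 hε0)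
    rwa [Real.exp_zero] at this
  have hθ0 : 0 < θ := by linarith
  have hθ1 : θ < 1 := by have := Real.exp_pos (-ε); linarith
  have hchoose : ∀ n m : ℕ, ((m + n).choose n : ℝ) ≤ Real.exp (ε * m) * (θ⁻¹) ^ n := by
    intro n m
    -- This is a single term of the binomial expansion of `(θ + exp (-ε)) ^ (m + n) = 1`; `θ` was
    -- chosen to make the base one.
    have h1 : θ ^ n * Real.exp (-ε) ^ m * ((m + n).choose n : ℝ) ≤ 1 := by
      have h2 : (θ + Real.exp (-ε)) ^ (m + n) = 1 := by rw [hθ]; simp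
      rw [add_pow] at h2
      have h3 := Finset.single_le_sum
        (f := fun k => θ ^ k * Real.exp (-ε) ^ (m + n - k) * ((m + n).choose k : ℝ))
        (s := Finset.range (m + n + 1)) (fun k _ => by positivity)
        (Finset.mem_range.2 (by omega : n < m + n + 1))
      rw [h2] at h3
      simpa using h3
    have h4 : Real.exp (ε * m) * Real.exp (-ε) ^ m = 1 := by
      rw [← Real.exp_nat_mul, ← Real.exp_add]
      ring_nf
      exact Real.exp_zero
    have h5 : (θ⁻¹) ^ n * θ ^ n = 1 := by rw [← mul_pow, inv_mul_cancel₀ hθ0.ne', one_pow]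
    calc ((m + n).choose n : ℝ) = Real.exp (ε * m) * (θ⁻¹) ^ n *
          (θ ^ n * Real.exp (-ε) ^ m * ((m + n).choose n : ℝ)) := by
          linear_combination (-((m + n).choose n : ℝ) * ((θ⁻¹) ^ n * θ ^ n)) * h4 -
            ((m + n).choose n : ℝ) * h5
      _ ≤ Real.exp (ε * m) * (θ⁻¹) ^ n * 1 := by gcongr
      _ = _ := mul_one _
  have hpow : ∀ n m : ℕ, ((m : ℝ) + n + 2) ^ d ≤
      (d ! / ε ^ d * Real.exp (2 * ε)) * Real.exp (ε * m) * Real.exp ε ^ n := by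
    intro n m
    have h1 := Real.pow_div_factorial_le_exp (ε * ((m : ℝ) + n + 2)) (by positivity) d
    rw [div_le_iff₀ (by positivity), mul_pow] at h1
    have h2 : Real.exp (ε * ((m : ℝ) + n + 2)) =
        Real.exp (2 * ε) * Real.exp (ε * m) * Real.exp ε ^ n := by
      rw [← Real.exp_nat_mul, ← Real.exp_add, ← Real.exp_add]
      ring_nf
    rw [h2] at h1
    have h3 : 0 < ε ^ d := by positivity
    calc ((m : ℝ) + n + 2) ^ d = (ε ^ d * ((m : ℝ) + n + 2) ^ d) / ε ^ d := by field_simp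
      _ ≤ (Real.exp (2 * ε) * Real.exp (ε * m) * Real.exp ε ^ n * d !) / ε ^ d := by gcongr
      _ = _ := by ring
  refine ⟨d ! / ε ^ d * Real.exp (2 * ε), √(2 * θ⁻¹) * Real.exp ε, by positivity, ?_, fun n m => ?_⟩
  · have h1 : 1 ≤ √(2 * θ⁻¹) := by
      rw [Real.one_le_sqrt]
      have := (one_le_inv₀ hθ0).2 hθ1.le
      linarith
    have h2 : 1 ≤ Real.exp ε := Real.one_le_exp hε0.le
    nlinarith
  · rw [wordBound_eq]
    have h1 : √(2 ^ n * ((m + 1).ascFactorial n : ℝ)) ≤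
        √(2 * θ⁻¹) ^ n * √(n !) * Real.exp (ε * m) := by
      have h3 : (2 : ℝ) ^ n * ((m + 1).ascFactorial n : ℝ) ≤
          (√(2 * θ⁻¹) ^ n * √(n !) * Real.exp (ε * m)) ^ 2 := by
        have e1 : (√(2 * θ⁻¹) ^ n) ^ 2 = 2 ^ n * (θ⁻¹) ^ n := by
          rw [← pow_mul, mul_comm n 2, pow_mul, Real.sq_sqrt (by positivity), mul_pow]
        have e2 : √((n ! : ℕ) : ℝ) ^ 2 = n ! := Real.sq_sqrt (by positivity)
        have e3 : (1 : ℝ) ≤ Real.exp (ε * m) := Real.one_le_exp (by positivity)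
        rw [mul_pow, mul_pow, e1, e2, Nat.ascFactorial_eq_factorial_mul_choose]
        push_cast
        calc (2 : ℝ) ^ n * (n ! * ((m + n).choose n : ℝ))
            ≤ 2 ^ n * (n ! * (Real.exp (ε * m) * (θ⁻¹) ^ n)) := by gcongr; exact hchoose n m
          _ = 2 ^ n * θ⁻¹ ^ n * n ! * Real.exp (ε * m) := by ring
          _ ≤ 2 ^ n * θ⁻¹ ^ n * n ! * Real.exp (ε * m) ^ 2 := by
              gcongr
              nlinarith
      exact (Real.sqrt_le_sqrt h3).trans (by rw [Real.sqrt_sq (by positivity)])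
    have h4 : Real.exp (δ * m) = Real.exp (ε * m) * Real.exp (ε * m) := by
      rw [← Real.exp_add, hε]; ring_nf
    calc _ ≤ (√(2 * θ⁻¹) ^ n * √(n !) * Real.exp (ε * m)) *
          ((d ! / ε ^ d * Real.exp (2 * ε)) * Real.exp (ε * m) * Real.exp ε ^ n) := by
          gcongr
          exact hpow n m
      _ = _ := by rw [h4, mul_pow]; ring

/-! ### Hermite functions on `ℝ^d` -/

section
variable {d : ℕ}

/-- The multi-index with `α j` raised by one. -/
def raise (α : MIdx d) (j : Fin d) : MIdx d := Function.update α j (α j + 1)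

/-- The multi-index with `α j` lowered by one. -/
def lower (α : MIdx d) (j : Fin d) : MIdx d := Function.update α j (α j - 1)

theorem len_raise (α : MIdx d) (j : Fin d) : len (raise α j) = len α + 1 := by
  have := Finset.add_sum_erase Finset.univ α (Finset.mem_univ j)
  rw [len, raise, Finset.sum_update_of_mem (Finset.mem_univ j), len,
    Finset.sdiff_singleton_eq_erase]
  omega

theorem len_lower_le (α : MIdx d) (j : Fin d) : len (lower α j) ≤ len α :=
  Finset.sum_le_sum fun i _ => by
    rw [lower]
    rcases eq_or_ne i j with rfl | h
    · simp
    · simp [h]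

theorem le_len (α : MIdx d) (j : Fin d) : α j ≤ len α :=
  Finset.single_le_sum (f := α) (fun _ _ => Nat.zero_le _) (Finset.mem_univ j)

/-- One more letter: a position or derivative operator turns `h_α` into its two neighbours with
exactly these coefficients. Leaving `Q` arbitrary covers pointwise values, iterated derivatives and
functionals alike. -/
theorem le_wordBound_succ {n : ℕ} {M : ℝ} {Q : MIdx d → ℝ} (hM : 0 ≤ M)
    (hQ : ∀ α, Q α ≤ M * wordBound d n (len α)) (j : Fin d) (α : MIdx d) :
    √(α j / 2) * Q (lower α j) + √((α j + 1) / 2) * Q (raise α j) ≤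
      M * wordBound d (n + 1) (len α) := by
  have h0 : (α j : ℝ) ≤ len α := by exact_mod_cast le_len α j
  have h1 : Q (lower α j) ≤ M * wordBound d n (len α + 1) :=
    (hQ _).trans (mul_le_mul_of_nonneg_left
      (wordBound_mono d n ((len_lower_le α j).trans (Nat.le_succ _))) hM)
  have h2 : Q (raise α j) ≤ M * wordBound d n (len α + 1) := by
    have := hQ (raise α j)
    rwa [len_raise] at this
  have h3 : √((α j : ℝ) / 2) ≤ √((len α + 1) / 2) := Real.sqrt_le_sqrt (by linarith)
  have h4 : √(((α j : ℝ) + 1) / 2) ≤ √((len α + 1) / 2) := Real.sqrt_le_sqrt (by linarith)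
  have h5 : 0 ≤ M * wordBound d n (len α + 1) := mul_nonneg hM (wordBound_nonneg _ _ _)
  calc _ ≤ √((len α + 1) / 2) * (M * wordBound d n (len α + 1)) +
        √((len α + 1) / 2) * (M * wordBound d n (len α + 1)) := by
        refine add_le_add ?_ ?_
        · exact (mul_le_mul_of_nonneg_left h1 (Real.sqrt_nonneg _)).trans
            (mul_le_mul_of_nonneg_right h3 h5)
        · exact (mul_le_mul_of_nonneg_left h2 (Real.sqrt_nonneg _)).trans
            (mul_le_mul_of_nonneg_right h4 h5)
    _ = _ := by rw [wordBound, sqrt_two_mul]; ring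

theorem hermiteFn_update (α : MIdx d) (j : Fin d) (n : ℕ) (x : Eucl d) :
    hermiteFn (Function.update α j n) x =
      hermite1 n (x j) * ((∏ i ∈ Finset.univ \ {j}, hermite1 (α i) (x i) : ℝ) : ℂ) := by
  have h : (fun i => hermite1 (Function.update α j n i) (x i)) =
      Function.update (fun i => hermite1 (α i) (x i)) j (hermite1 n (x j)) := by
    funext i
    rcases eq_or_ne i j with rfl | h
    · simp
    · simp [h]
  rw [hermiteFn, h, Finset.prod_update_of_mem (Finset.mem_univ j)]
  push_cast
  rfl

theorem hermiteFn_eq (α : MIdx d) (j : Fin d) (x : Eucl d) : hermiteFn α x =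
    hermite1 (α j) (x j) * ((∏ i ∈ Finset.univ \ {j}, hermite1 (α i) (x i) : ℝ) : ℂ) := by
  rw [← hermiteFn_update, Function.update_eq_self]

theorem coord_mul_hermiteFn (α : MIdx d) (j : Fin d) (x : Eucl d) :
    (x j : ℂ) * hermiteFn α x = (√(α j / 2) : ℝ) * hermiteFn (lower α j) x +
      (√((α j + 1) / 2) : ℝ) * hermiteFn (raise α j) x := by
  have h := congrArg (fun y : ℝ => (y : ℂ)) (mul_hermite1 (α j) (x j))
  simp only [Complex.ofReal_mul, Complex.ofReal_add] at h
  rw [hermiteFn_eq α j, lower, raise, hermiteFn_update, hermiteFn_update]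
  linear_combination ((∏ i ∈ Finset.univ \ {j}, hermite1 (α i) (x i) : ℝ) : ℂ) * h

/-- The partial derivatives of the Hermite functions. -/
def hermitePartial (α : MIdx d) (j : Fin d) : Eucl d → ℂ :=
  √(α j / 2) • hermiteFn (lower α j) - √((α j + 1) / 2) • hermiteFn (raise α j)

theorem hasFDerivAt_hermiteFn (α : MIdx d) (x : Eucl d) : HasFDerivAt (hermiteFn α)
    (∑ j, ContinuousLinearMap.smulRightL ℝ (Eucl d) ℂ (EuclideanSpace.proj j)
      (hermitePartial α j x)) x := by
  have h1 : HasFDerivAt (fun x : Eucl d => ∏ j, hermite1 (α j) (x j))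
      (∑ j, (∏ i ∈ Finset.univ.erase j, hermite1 (α i) (x i)) •
        ((√(α j / 2) * hermite1 (α j - 1) (x j) -
          √((α j + 1) / 2) * hermite1 (α j + 1) (x j)) •
            (EuclideanSpace.proj j : Eucl d →L[ℝ] ℝ))) x :=
    HasFDerivAt.finsetProd fun j _ => by
      have h := (EuclideanSpace.proj j : Eucl d →L[ℝ] ℝ).hasFDerivAt (x := x)
      exact HasDerivAt.comp_hasFDerivAt (h₂ := hermite1 (α j)) x (hasDerivAt_hermite1 (α j) (x j)) h
  have h2 := Complex.ofRealCLM.hasFDerivAt.comp x h1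
  refine h2.congr_fderiv ?_
  ext v
  simp only [ContinuousLinearMap.comp_apply, sum_apply, map_sum]
  refine Finset.sum_congr rfl fun j _ => ?_
  rw [ContinuousLinearMap.smulRightL_apply_apply]
  simp only [ContinuousLinearMap.smulRight_apply, smul_apply, hermitePartial,
    Pi.sub_apply, Pi.smul_apply, lower, raise, hermiteFn_update, Complex.real_smul, smul_eq_mul,
    Complex.ofRealCLM_apply, Finset.sdiff_singleton_eq_erase]
  push_cast
  ring

theorem fderiv_hermiteFn (α : MIdx d) : fderiv ℝ (hermiteFn α) = fun x =>
    ∑ j, ContinuousLinearMap.smulRightL ℝ (Eucl d) ℂ (EuclideanSpace.proj j)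
      (hermitePartial α j x) :=
  funext fun x => (hasFDerivAt_hermiteFn α x).fderiv

theorem contDiff_hermiteFn (α : MIdx d) :
    ContDiff ℝ ((⊤ : ℕ∞) : WithTop ℕ∞) (hermiteFn α) := by
  have h : ContDiff ℝ ((⊤ : ℕ∞) : WithTop ℕ∞) fun x : Eucl d => ∏ j, hermite1 (α j) (x j) :=
    contDiff_prod fun j _ =>
      (contDiff_hermite1 (α j)).comp (EuclideanSpace.proj j : Eucl d →L[ℝ] ℝ).contDiff
  exact Complex.ofRealCLM.contDiff.comp h

theorem norm_hermiteFn_le (α : MIdx d) (x : Eucl d) :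
    ‖hermiteFn α x‖ ≤ wordBound d 0 (len α) := by
  rw [hermiteFn, Complex.norm_real, Real.norm_eq_abs, Finset.abs_prod]
  calc ∏ j, |hermite1 (α j) (x j)| ≤ ∏ _j : Fin d, ((len α : ℝ) + 2) := by
        refine Finset.prod_le_prod (fun _ _ => abs_nonneg _) fun j _ => ?_
        refine (abs_hermite1_le _ _).trans ?_
        have : (α j : ℝ) ≤ len α := by exact_mod_cast le_len α j
        linarith
    _ = _ := by simp [wordBound]

theorem norm_le_sum_coord (x : Eucl d) : ‖x‖ ≤ ∑ j, ‖x j‖ := by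
  conv_lhs => rw [← (EuclideanSpace.basisFun (Fin d) ℝ).sum_repr x]
  refine (norm_sum_le _ _).trans (Finset.sum_le_sum fun j _ => ?_)
  rw [norm_smul, OrthonormalBasis.norm_eq_one, mul_one]
  rfl

theorem pow_norm_mul_hermiteFn_le (k : ℕ) (α : MIdx d) (x : Eucl d) :
    ‖x‖ ^ k * ‖hermiteFn α x‖ ≤ (d : ℝ) ^ k * wordBound d k (len α) := by
  induction k generalizing α with
  | zero => simpa using norm_hermiteFn_le α x
  | succ k ih =>
    calc ‖x‖ ^ (k + 1) * ‖hermiteFn α x‖ = ‖x‖ ^ k * (‖x‖ * ‖hermiteFn α x‖) := by ring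
      _ ≤ ‖x‖ ^ k * ((∑ j, ‖x j‖) * ‖hermiteFn α x‖) := by gcongr; exact norm_le_sum_coord x
      _ = ∑ j, ‖x‖ ^ k * ‖(x j : ℂ) * hermiteFn α x‖ := by
          simp only [norm_mul, Complex.norm_real]
          rw [Finset.sum_mul, Finset.mul_sum]
      _ ≤ ∑ _j : Fin d, (d : ℝ) ^ k * wordBound d (k + 1) (len α) := by
          refine Finset.sum_le_sum fun j _ => ?_
          refine le_trans ?_ (le_wordBound_succ (Q := fun α => ‖x‖ ^ k * ‖hermiteFn α x‖)
            (by positivity) ih j α)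
          rw [coord_mul_hermiteFn]
          calc _ ≤ ‖x‖ ^ k * (√(α j / 2) * ‖hermiteFn (lower α j) x‖ +
                √((α j + 1) / 2) * ‖hermiteFn (raise α j) x‖) := by
                gcongr
                refine (norm_add_le _ _).trans ?_
                rw [norm_mul, norm_mul, Complex.norm_real, Complex.norm_real,
                  Real.norm_of_nonneg (Real.sqrt_nonneg _), Real.norm_of_nonneg (Real.sqrt_nonneg _)]
            _ = _ := by ring
      _ = _ := by
          rw [Finset.sum_const, Finset.card_univ, Fintype.card_fin, nsmul_eq_mul]
          ring

/-- Each derivative replaces `h_α` by neighbouring Hermite functions and is paid for by one step of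
`wordBound`. That `M` does not depend on `α` makes the growth of the Schwartz seminorms in the
degree visible. -/
theorem exists_decay_hermiteFn (k n : ℕ) : ∃ M : ℝ, 0 ≤ M ∧ ∀ (α : MIdx d) (x : Eucl d),
    ‖x‖ ^ k * ‖iteratedFDeriv ℝ n (hermiteFn α) x‖ ≤ M * wordBound d (k + n) (len α) := by
  induction n with
  | zero =>
    exact ⟨(d : ℝ) ^ k, by positivity, fun α x => by
      simpa using pow_norm_mul_hermiteFn_le k α x⟩
  | succ n ih =>
    obtain ⟨M, hM, h⟩ := ih
    let Λ : Fin d → ℂ →L[ℝ] Eucl d →L[ℝ] ℂ := fun j =>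
      ContinuousLinearMap.smulRightL ℝ (Eucl d) ℂ (EuclideanSpace.proj j)
    have hsm : ∀ α : MIdx d, ContDiff ℝ n (hermiteFn α) := fun α =>
      (contDiff_hermiteFn α).of_le (by exact_mod_cast le_top)
    have hcs : ∀ (a : ℝ) (α : MIdx d), ContDiff ℝ n (a • hermiteFn α) := fun a α =>
      (hsm α).const_smul a
    have hps : ∀ (α : MIdx d) j, ContDiff ℝ n (hermitePartial α j) := fun α j =>
      (hcs √(α j / 2) (lower α j)).sub (hcs √((α j + 1) / 2) (raise α j))
    refine ⟨(∑ j, ‖Λ j‖) * M, by positivity, fun α x => ?_⟩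
    have h1 : ‖iteratedFDeriv ℝ (n + 1) (hermiteFn α) x‖ ≤
        ∑ j, ‖Λ j‖ * ‖iteratedFDeriv ℝ n (hermitePartial α j) x‖ := by
      have e := iteratedFDeriv_fun_sum_apply (𝕜 := ℝ) (n := n) (x := x) (u := Finset.univ)
        (f := fun j x => Λ j (hermitePartial α j x)) fun j _ => 
          ((Λ j).contDiff.comp (hps α j)).contDiffAt
      rw [← norm_iteratedFDeriv_fderiv, fderiv_hermiteFn, e]
      refine (norm_sum_le _ _).trans (Finset.sum_le_sum fun j _ => ?_)
      exact (Λ j).norm_iteratedFDeriv_comp_left (hps α j).contDiffAt le_rfl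
    have h2 : ∀ j, ‖iteratedFDeriv ℝ n (hermitePartial α j) x‖ ≤
        √(α j / 2) * ‖iteratedFDeriv ℝ n (hermiteFn (lower α j)) x‖ +
        √((α j + 1) / 2) * ‖iteratedFDeriv ℝ n (hermiteFn (raise α j)) x‖ := by
      intro j
      rw [hermitePartial, iteratedFDeriv_sub_apply (hcs _ _).contDiffAt (hcs _ _).contDiffAt,
        iteratedFDeriv_const_smul_apply (hsm _).contDiffAt,
        iteratedFDeriv_const_smul_apply (hsm _).contDiffAt]
      refine (norm_sub_le _ _).trans ?_
      rw [norm_smul, norm_smul, Real.norm_of_nonneg (Real.sqrt_nonneg _),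
        Real.norm_of_nonneg (Real.sqrt_nonneg _)]
    calc ‖x‖ ^ k * ‖iteratedFDeriv ℝ (n + 1) (hermiteFn α) x‖
        ≤ ‖x‖ ^ k * ∑ j, ‖Λ j‖ * (√(α j / 2) * ‖iteratedFDeriv ℝ n (hermiteFn (lower α j)) x‖ +
          √((α j + 1) / 2) * ‖iteratedFDeriv ℝ n (hermiteFn (raise α j)) x‖) := by
          gcongr
          refine h1.trans (Finset.sum_le_sum fun j _ => ?_)
          gcongr
          exact h2 j
      _ = ∑ j, ‖Λ j‖ *
          (√(α j / 2) * (‖x‖ ^ k * ‖iteratedFDeriv ℝ n (hermiteFn (lower α j)) x‖) +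
          √((α j + 1) / 2) * (‖x‖ ^ k * ‖iteratedFDeriv ℝ n (hermiteFn (raise α j)) x‖)) := by
          rw [Finset.mul_sum]
          refine Finset.sum_congr rfl fun j _ => ?_
          ring
      _ ≤ ∑ j, ‖Λ j‖ * (M * wordBound d (k + n + 1) (len α)) := by
          refine Finset.sum_le_sum fun j _ => ?_
          gcongr
          exact le_wordBound_succ
            (Q := fun α => ‖x‖ ^ k * ‖iteratedFDeriv ℝ n (hermiteFn α) x‖) hM (fun α => h α x) j α
      _ = _ := by rw [← Finset.sum_mul, ← mul_assoc]; rfl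

/-- The Hermite functions as Schwartz functions. -/
def hermiteS (α : MIdx d) : 𝓢(Eucl d, ℂ) where
  toFun := hermiteFn α
  smooth' := contDiff_hermiteFn α
  decay' k n := by
    obtain ⟨M, -, h⟩ := exists_decay_hermiteFn (d := d) k n
    exact ⟨_, h α⟩

theorem hermiteS_apply (α : MIdx d) (x : Eucl d) : hermiteS α x = hermiteFn α x := rfl

theorem coe_hermiteS (α : MIdx d) : ⇑(hermiteS α) = hermiteFn α := rfl

theorem exists_seminorm_hermiteS_le (k n : ℕ) : ∃ M : ℝ, 0 ≤ M ∧ ∀ α : MIdx d,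
    SchwartzMap.seminorm ℂ k n (hermiteS α) ≤ M * wordBound d (k + n) (len α) := by
  obtain ⟨M, hM, h⟩ := exists_decay_hermiteFn (d := d) k n
  exact ⟨M, hM, fun α => SchwartzMap.seminorm_le_bound ℂ k n _
    (mul_nonneg hM (wordBound_nonneg _ _ _)) (h α)⟩

end

/-! ### Orthonormality and Hermite coefficients -/

section
variable {d : ℕ}

theorem integral_prod_coord (f : Fin d → ℝ → ℝ) :
    ∫ x : Eucl d, ∏ j, f j (x j) = ∏ j, ∫ t, f j t := by
  rw [← integral_fintype_prod_volume_eq_prod,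
    ← (EuclideanSpace.volume_preserving_symm_measurableEquiv_toLp (Fin d)).integral_comp']
  rfl

theorem integrable_prod_coord {f : Fin d → ℝ → ℝ} (hf : ∀ j, Integrable (f j)) :
    Integrable fun x : Eucl d => ∏ j, f j (x j) :=
  (EuclideanSpace.volume_preserving_symm_measurableEquiv_toLp (Fin d)).integrable_comp_of_integrable
    (Integrable.fintype_prod hf)

theorem schwartzCoef_hermiteS (α β : MIdx d) :
    schwartzCoef (hermiteS α) β = if α = β then 1 else 0 := by
  have h : ∀ x : Eucl d, hermiteS α x * hermiteFn β x =
      ((∏ j, hermite1 (α j) (x j) * hermite1 (β j) (x j) : ℝ) : ℂ) := fun x => by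
    rw [hermiteS_apply, hermiteFn, hermiteFn, Finset.prod_mul_distrib]
    push_cast
    rfl
  simp only [schwartzCoef, h]
  rw [integral_complex_ofReal,
    integral_prod_coord fun j t => hermite1 (α j) t * hermite1 (β j) t]
  simp only [integral_hermite1_mul, Finset.prod_ite_zero, Finset.mem_univ, true_imp_iff,
    Finset.prod_const_one, funext_iff]
  split_ifs <;> simp

theorem integrable_mul_hermiteFn (f : 𝓢(Eucl d, ℂ)) (α : MIdx d) :
    Integrable fun x => f x * hermiteFn α x :=
  f.integrable.mul_bdd (contDiff_hermiteFn α).continuous.aestronglyMeasurable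
    (Eventually.of_forall fun x => norm_hermiteFn_le α x)

/-- The Hermite coefficients as linear functionals. -/
def coefS (α : MIdx d) : 𝓢(Eucl d, ℂ) →ₗ[ℂ] ℂ where
  toFun f := schwartzCoef f α
  map_add' f g := by
    simp only [schwartzCoef, add_apply, add_mul]
    exact integral_add (integrable_mul_hermiteFn f α) (integrable_mul_hermiteFn g α)
  map_smul' a f := by
    simp only [schwartzCoef, smul_apply, smul_eq_mul, mul_assoc, RingHom.id_apply]
    exact integral_const_mul _ _

/-- The `L^1` norm on the Schwartz space. -/
def l1Seminorm (d : ℕ) : Seminorm ℂ 𝓢(Eucl d, ℂ) :=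
  (normSeminorm ℂ (Lp ℂ 1 (volume : Measure (Eucl d)))).comp
    (SchwartzMap.toLpCLM ℂ ℂ 1 (volume : Measure (Eucl d))).toLinearMap

theorem l1Seminorm_apply (f : 𝓢(Eucl d, ℂ)) : l1Seminorm d f = ∫ x, ‖f x‖ :=
  SchwartzMap.norm_toLp_one

theorem continuous_l1Seminorm : Continuous (l1Seminorm d) :=
  continuous_norm.comp (SchwartzMap.toLpCLM ℂ ℂ 1 (volume : Measure (Eucl d))).continuous

/-- Applied to `f = h_α`, whose coefficient is one, this bounds the `L^1` norm of `h_α` from below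
by an inverse polynomial in the degree. -/
theorem norm_schwartzCoef_le (f : 𝓢(Eucl d, ℂ)) (α : MIdx d) :
    ‖schwartzCoef f α‖ ≤ wordBound d 0 (len α) * l1Seminorm d f := by
  rw [l1Seminorm_apply, ← integral_const_mul]
  refine (norm_integral_le_integral_norm _).trans ?_
  refine integral_mono_of_nonneg (Eventually.of_forall fun _ => norm_nonneg _)
    (f.integrable.norm.const_mul _) (Eventually.of_forall fun x => ?_)
  simp only [norm_mul]
  rw [mul_comm]
  gcongr
  exact norm_hermiteFn_le α x

/-! ### Control of the `L^1` norm by the Gelfand–Shilov norms. -/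

theorem enorm_gsFunctional_le {s : ℝ} (h : {ρ : ℝ // 0 < ρ}) (f : 𝓢(Eucl d, ℂ))
    (i : MIdx d × MIdx d × Eucl d) : ‖gsFunctional i f‖ₑ ≤
      ENNReal.ofReal ((h : ℝ) ^ (len i.1 + len i.2.1) * ((fact i.1 * fact i.2.1 : ℕ) : ℝ) ^ s) *
        (gsScale d s).N h f := by
  have h0 : 0 < (h : ℝ) ^ (len i.1 + len i.2.1) * ((fact i.1 * fact i.2.1 : ℕ) : ℝ) ^ s := by
    have h1 : (0 : ℝ) < (fact i.1 * fact i.2.1 : ℕ) := by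
      exact_mod_cast Nat.mul_pos (fact_pos _) (fact_pos _)
    have h2 : (0 : ℝ) < (h : ℝ) := h.2
    positivity
  set W := (h : ℝ) ^ (len i.1 + len i.2.1) * ((fact i.1 * fact i.2.1 : ℕ) : ℝ) ^ s
  have h1 : ENNReal.ofReal W⁻¹ * ‖gsFunctional i f‖ₑ ≤ (gsScale d s).N h f :=
    le_iSup (fun i : MIdx d × MIdx d × Eucl d => ENNReal.ofReal
      (((h : ℝ) ^ (len i.1 + len i.2.1) * ((fact i.1 * fact i.2.1 : ℕ) : ℝ) ^ s)⁻¹) *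
        ‖gsFunctional i f‖ₑ) i
  calc ‖gsFunctional i f‖ₑ = ENNReal.ofReal W * (ENNReal.ofReal W⁻¹ * ‖gsFunctional i f‖ₑ) := by
        rw [← mul_assoc, ← ENNReal.ofReal_mul h0.le, mul_inv_cancel₀ h0.ne', ENNReal.ofReal_one,
          one_mul]
    _ ≤ _ := by gcongr

theorem multiDeriv_zero : multiDeriv (0 : MIdx d) = LinearMap.id := by
  simp [multiDeriv]
  rfl

/-- The weight `∏ (1 + x_j²)` has an integrable inverse and expands into the monomials `x ^ β` with
`β ∈ {0,2}^d`, each controlled by the norm without derivatives. -/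
theorem exists_l1Seminorm_le_gs (s : ℝ) (h : {ρ : ℝ // 0 < ρ}) : ∃ C : ℝ≥0, ∀ f : 𝓢(Eucl d, ℂ),
    ENNReal.ofReal (l1Seminorm d f) ≤ C * (gsScale d s).N h f := by
  let β : Finset (Fin d) → MIdx d := fun t j => if j ∈ t then 2 else 0
  let W : Finset (Fin d) → ℝ≥0 := fun t => ((h : ℝ) ^ (len (0 : MIdx d) + len (β t)) *
    ((fact (0 : MIdx d) * fact (β t) : ℕ) : ℝ) ^ s).toNNReal
  let I : ℝ≥0∞ := ∫⁻ x : Eucl d, ‖∏ j, (1 + x j ^ 2)⁻¹‖ₑ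
  have hI : I < ∞ :=
    (integrable_prod_coord (f := fun _ t => (1 + t ^ 2)⁻¹) fun _ => integrable_inv_one_add_sq).2
  refine ⟨(∑ t : Finset (Fin d), W t) * I.toNNReal, fun f => ?_⟩
  have hp : ∀ x : Eucl d, ‖f x‖ₑ ≤
      ‖∏ j, (1 + x j ^ 2)⁻¹‖ₑ * ((∑ t : Finset (Fin d), W t : ℝ≥0) * (gsScale d s).N h f) := by
    intro x
    have h1 : (∏ j, (1 + x j ^ 2)) = ∑ t : Finset (Fin d), ∏ j, x j ^ β t j := by
      rw [Finset.prod_one_add, Finset.powerset_univ]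
      refine Finset.sum_congr rfl fun t _ => ?_
      rw [← Finset.prod_subset (Finset.subset_univ t) fun j _ hj => by simp [β, hj]]
      exact Finset.prod_congr rfl fun j hj => by simp [β, hj]
    have h2 : ∀ t, ((∏ j, x j ^ β t j : ℝ) : ℂ) * f x = gsFunctional (0, β t, x) f := by
      intro t
      simp [gsFunctional, multiDeriv_zero]
    have h0 : (∏ j, (1 + x j ^ 2)) ≠ 0 :=
      Finset.prod_ne_zero_iff.2 fun j _ => by positivity
    have h3 : f x = ((∏ j, (1 + x j ^ 2)⁻¹ : ℝ) : ℂ) *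
        ∑ t : Finset (Fin d), gsFunctional (0, β t, x) f := by
      simp only [← h2]
      rw [← Finset.sum_mul, ← Complex.ofReal_sum, ← h1, ← mul_assoc, ← Complex.ofReal_mul,
        Finset.prod_inv_distrib, inv_mul_cancel₀ h0, Complex.ofReal_one, one_mul]
    calc ‖f x‖ₑ = ‖∏ j, (1 + x j ^ 2)⁻¹‖ₑ *
          ‖∑ t : Finset (Fin d), gsFunctional (0, β t, x) f‖ₑ := by
          conv_lhs => rw [h3]
          rw [enorm_mul, ← ofReal_norm (_ : ℂ), Complex.norm_real, ofReal_norm]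
      _ ≤ _ := by
          gcongr
          refine (enorm_sum_le _ _).trans ?_
          rw [ENNReal.ofNNReal_finsetSum, Finset.sum_mul]
          exact Finset.sum_le_sum fun t _ => enorm_gsFunctional_le h f (0, β t, x)
  rw [l1Seminorm_apply, ofReal_integral_norm_eq_lintegral_enorm f.integrable]
  refine (lintegral_mono hp).trans ?_
  rw [lintegral_mul_const'' _ (by
    refine (Continuous.aestronglyMeasurable ?_).enorm
    exact continuous_finsetProd _ fun j _ => Continuous.inv₀ (by fun_prop) fun x => by positivity)]
  rw [ENNReal.coe_mul, ENNReal.coe_toNNReal hI.ne]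
  change I * _ ≤ _
  exact le_of_eq (by ring)

/-! ### Gelfand–Shilov norms of the Hermite functions -/

/-- The partial derivative on the Schwartz space. -/
def partialEnd (j : Fin d) : Module.End ℂ 𝓢(Eucl d, ℂ) :=
  (LineDeriv.lineDerivOpCLM ℂ 𝓢(Eucl d, ℂ) (EuclideanSpace.single j (1 : ℝ))).toLinearMap

theorem partialEnd_hermiteS (j : Fin d) (α : MIdx d) : partialEnd j (hermiteS α) =
    ((√(α j / 2) : ℝ) : ℂ) • hermiteS (lower α j) -
      ((√((α j + 1) / 2) : ℝ) : ℂ) • hermiteS (raise α j) := by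
  ext x
  change LineDeriv.lineDerivOp (EuclideanSpace.single j (1 : ℝ)) (hermiteS α) x = _
  rw [SchwartzMap.lineDerivOp_apply_eq_fderiv, coe_hermiteS, fderiv_hermiteFn]
  simp only [sum_apply, ContinuousLinearMap.smulRightL_apply_apply,
    ContinuousLinearMap.smulRight_apply, sub_apply, smul_apply]
  rw [Finset.sum_eq_single j]
  · simp [hermitePartial, hermiteS_apply]
  · intro i _ hij
    simp [hij]
  · simp

/-- Functionals that satisfy on Hermite functions the bounds of words of length `n`. -/
def WordBounded (n : ℕ) (ev : 𝓢(Eucl d, ℂ) →ₗ[ℂ] ℂ) : Prop :=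
  ∀ α, ‖ev (hermiteS α)‖ ≤ wordBound d n (len α)

theorem WordBounded.partial_comp {n : ℕ} {ev : 𝓢(Eucl d, ℂ) →ₗ[ℂ] ℂ} (h : WordBounded n ev)
    (j : Fin d) : WordBounded (n + 1) (ev ∘ₗ partialEnd j) := by
  intro α
  rw [LinearMap.comp_apply, partialEnd_hermiteS, map_sub, map_smul, map_smul]
  have := le_wordBound_succ (M := 1) (Q := fun α => ‖ev (hermiteS α)‖) zero_le_one
    (fun α => by simpa using h α) j α
  rw [one_mul] at this
  refine le_trans ((norm_sub_le _ _).trans ?_) this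
  rw [norm_smul, norm_smul, Complex.norm_real, Complex.norm_real,
    Real.norm_of_nonneg (Real.sqrt_nonneg _), Real.norm_of_nonneg (Real.sqrt_nonneg _)]

theorem WordBounded.partial_pow_comp {n : ℕ} {ev : 𝓢(Eucl d, ℂ) →ₗ[ℂ] ℂ} (h : WordBounded n ev)
    (j : Fin d) (k : ℕ) : WordBounded (n + k) (ev ∘ₗ (partialEnd j ^ k)) := by
  induction k with
  | zero => exact h
  | succ k ih =>
    rw [pow_succ]
    exact ih.partial_comp j

theorem WordBounded.multiDeriv_comp {n : ℕ} {ev : 𝓢(Eucl d, ℂ) →ₗ[ℂ] ℂ} (h : WordBounded n ev)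
    (a : MIdx d) : WordBounded (n + len a) (ev ∘ₗ multiDeriv a) := by
  have key : ∀ (l : List (Fin d)) (n : ℕ) (ev : 𝓢(Eucl d, ℂ) →ₗ[ℂ] ℂ), WordBounded n ev →
      WordBounded (n + (l.map a).sum) (ev ∘ₗ (l.map fun j => partialEnd j ^ a j).prod) := by
    intro l
    induction l with
    | nil => exact fun n ev h => h
    | cons j l ih =>
      intro n ev h
      rw [List.map_cons, List.map_cons, List.sum_cons, List.prod_cons, ← add_assoc]
      exact ih _ _ (h.partial_pow_comp j (a j))
  have := key (List.finRange d) n ev h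
  rwa [← Fin.sum_univ_def] at this

theorem norm_monomial_mul_hermiteFn_le (b : MIdx d) (x : Eucl d) (α : MIdx d) :
    ‖((∏ j, x j ^ b j : ℝ) : ℂ) * hermiteFn α x‖ ≤ wordBound d (len b) (len α) := by
  have step : ∀ (c : ℂ) (n : ℕ) (j : Fin d), (∀ α, ‖c * hermiteFn α x‖ ≤ wordBound d n (len α)) →
      ∀ α, ‖(c * x j) * hermiteFn α x‖ ≤ wordBound d (n + 1) (len α) := by
    intro c n j h α
    have := le_wordBound_succ (M := 1) (Q := fun α => ‖c * hermiteFn α x‖) zero_le_one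
      (fun α => by simpa using h α) j α
    rw [one_mul] at this
    refine le_trans ?_ this
    rw [mul_assoc, coord_mul_hermiteFn, mul_add, mul_left_comm, mul_left_comm c]
    refine (norm_add_le _ _).trans ?_
    rw [norm_mul, norm_mul _ (c * hermiteFn (raise α j) x), Complex.norm_real, Complex.norm_real,
      Real.norm_of_nonneg (Real.sqrt_nonneg _), Real.norm_of_nonneg (Real.sqrt_nonneg _)]
  have pow : ∀ (c : ℂ) (n : ℕ) (j : Fin d) (k : ℕ),
      (∀ α, ‖c * hermiteFn α x‖ ≤ wordBound d n (len α)) →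
      ∀ α, ‖(c * (x j : ℂ) ^ k) * hermiteFn α x‖ ≤ wordBound d (n + k) (len α) := by
    intro c n j k h
    induction k with
    | zero => simpa using h
    | succ k ih =>
      rw [pow_succ, ← mul_assoc]
      exact step _ _ j ih
  have key : ∀ t : Finset (Fin d), ∀ α, ‖((∏ j ∈ t, (x j : ℂ) ^ b j)) * hermiteFn α x‖ ≤
      wordBound d (∑ j ∈ t, b j) (len α) := by
    intro t
    induction t using Finset.induction_on with
    | empty => simpa using fun α => norm_hermiteFn_le α x
    | insert j t hj ih =>
      rw [Finset.prod_insert hj, Finset.sum_insert hj, mul_comm, add_comm]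
      exact pow _ _ j (b j) ih
  have := key Finset.univ α
  push_cast
  exact this

theorem norm_gsFunctional_hermiteS_le (i : MIdx d × MIdx d × Eucl d) (α : MIdx d) :
    ‖gsFunctional i (hermiteS α)‖ ≤ wordBound d (len i.1 + len i.2.1) (len α) := by
  obtain ⟨a, b, x⟩ := i
  have h0 : WordBounded (len b) (gsFunctional (0, b, x)) := by
    intro α
    simpa [gsFunctional, multiDeriv_zero, hermiteS_apply] using
      norm_monomial_mul_hermiteFn_le b x α
  have h1 := h0.multiDeriv_comp a α
  have h2 : (gsFunctional (0, b, x) ∘ₗ multiDeriv a) (hermiteS α) =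
      gsFunctional (a, b, x) (hermiteS α) := by
    simp [gsFunctional, multiDeriv_zero]
  rw [h2, add_comm] at h1
  exact h1

theorem factorial_add_le (a b : ℕ) : (a + b)! ≤ 2 ^ (a + b) * (a ! * b !) := by
  rw [← Nat.add_choose_mul_factorial_mul_factorial, mul_assoc]
  exact Nat.mul_le_mul_right _ (Nat.choose_le_two_pow _ _)

/-- Used to replace `√(n!)` in the word bound by `√(α! β!)` at a geometric cost, which the constant
`K` absorbs. -/
theorem factorial_len_le (a : MIdx d) : (len a)! ≤ 2 ^ (d * len a) * fact a := by
  have key : ∀ t : Finset (Fin d), (∑ j ∈ t, a j)! ≤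
      2 ^ (t.card * ∑ j ∈ t, a j) * ∏ j ∈ t, (a j)! := by
    intro t
    induction t using Finset.induction_on with
    | empty => simp
    | insert j t hj ih =>
      rw [Finset.prod_insert hj, Finset.sum_insert hj, Finset.card_insert_of_notMem hj]
      set S := ∑ j ∈ t, a j
      calc (a j + S)! ≤ 2 ^ (a j + S) * ((a j)! * S !) := factorial_add_le _ _
        _ ≤ 2 ^ (a j + S) * ((a j)! * (2 ^ (t.card * S) * ∏ j ∈ t, (a j)!)) := by gcongr
        _ = 2 ^ (a j + S + t.card * S) * ((a j)! * ∏ j ∈ t, (a j)!) := by rw [pow_add _ (a j + S)]; ring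
        _ ≤ 2 ^ ((t.card + 1) * (a j + S)) * ((a j)! * ∏ j ∈ t, (a j)!) := by
            gcongr
            · norm_num
            · nlinarith [Nat.zero_le (t.card * a j)]
  simpa [len, fact] using key Finset.univ

theorem factorial_len_add_le (a b : MIdx d) :
    (len a + len b)! ≤ (2 ^ (d + 1)) ^ (len a + len b) * (fact a * fact b) := by
  calc (len a + len b)! ≤ 2 ^ (len a + len b) * ((len a)! * (len b)!) := factorial_add_le _ _
    _ ≤ 2 ^ (len a + len b) * ((2 ^ (d * len a) * fact a) * (2 ^ (d * len b) * fact b)) := by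
        gcongr <;> exact factorial_len_le _
    _ = _ := by rw [← pow_mul]; ring

/-- The factorials carry the exponent `1/2`: for `s = 1/2` the factor `K ^ n` fixes the step, while
for `s > 1/2` the surplus factorials beat any geometric factor. -/
theorem exists_gsFunctional_hermiteS_le (d : ℕ) {δ : ℝ} (hδ : 0 < δ) : ∃ C K : ℝ, 0 < C ∧ 0 < K ∧
    ∀ (i : MIdx d × MIdx d × Eucl d) (α : MIdx d), ‖gsFunctional i (hermiteS α)‖ ≤
      C * Real.exp (δ * len α) *
        (K ^ (len i.1 + len i.2.1) * ((fact i.1 * fact i.2.1 : ℕ) : ℝ) ^ (1 / 2 : ℝ)) := by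
  obtain ⟨C, K, hC, hK, h⟩ := exists_wordBound_le d hδ
  refine ⟨C, K * 2 ^ (d + 1), hC, by positivity, fun i α => ?_⟩
  refine (norm_gsFunctional_hermiteS_le i α).trans ((h _ _).trans ?_)
  set n := len i.1 + len i.2.1
  have h1 : √(n ! : ℝ) ≤ (2 ^ (d + 1)) ^ n * √((fact i.1 * fact i.2.1 : ℕ) : ℝ) := by
    have h2 : (n ! : ℝ) ≤ ((2 ^ (d + 1)) ^ n) ^ 2 * (fact i.1 * fact i.2.1 : ℕ) := by
      have h3 : (n ! : ℝ) ≤ (2 ^ (d + 1)) ^ n * (fact i.1 * fact i.2.1 : ℕ) := by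
        exact_mod_cast factorial_len_add_le i.1 i.2.1
      have h4 : (1 : ℝ) ≤ (2 ^ (d + 1)) ^ n := one_le_pow₀ (one_le_pow₀ (by norm_num))
      refine h3.trans (mul_le_mul_of_nonneg_right ?_ (Nat.cast_nonneg _))
      nlinarith
    refine (Real.sqrt_le_sqrt h2).trans ?_
    rw [Real.sqrt_mul (by positivity), Real.sqrt_sq (by positivity)]
  rw [← Real.sqrt_eq_rpow, mul_pow, mul_assoc (K ^ n)]
  gcongr

theorem gsNorm_hermiteS_le {s : ℝ} {h : {ρ : ℝ // 0 < ρ}} {C C' K δ : ℝ} {α : MIdx d}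
    (hC : 0 ≤ C) (hi : ∀ i : MIdx d × MIdx d × Eucl d, ‖gsFunctional i (hermiteS α)‖ ≤
      C * Real.exp (δ * len α) *
        (K ^ (len i.1 + len i.2.1) * ((fact i.1 * fact i.2.1 : ℕ) : ℝ) ^ (1 / 2 : ℝ)))
    (hK : ∀ a b : MIdx d, K ^ (len a + len b) * ((fact a * fact b : ℕ) : ℝ) ^ (1 / 2 : ℝ) ≤
      C' * ((h : ℝ) ^ (len a + len b) * ((fact a * fact b : ℕ) : ℝ) ^ s)) :
    (gsScale d s).N h (hermiteS α) ≤ ENNReal.ofReal (C * C' * Real.exp (δ * len α)) := by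
  refine iSup_le fun i => ?_
  have h0 : 0 < (h : ℝ) ^ (len i.1 + len i.2.1) * ((fact i.1 * fact i.2.1 : ℕ) : ℝ) ^ s := by
    have h1 : (0 : ℝ) < (fact i.1 * fact i.2.1 : ℕ) := by
      exact_mod_cast Nat.mul_pos (fact_pos _) (fact_pos _)
    have h2 : (0 : ℝ) < (h : ℝ) := h.2
    positivity
  rw [← ofReal_norm, ← ENNReal.ofReal_mul (inv_nonneg.2 h0.le)]
  refine ENNReal.ofReal_le_ofReal ?_
  rw [inv_mul_le_iff₀ h0]
  calc _ ≤ _ := hi i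
    _ ≤ C * Real.exp (δ * len α) * (C' * ((h : ℝ) ^ (len i.1 + len i.2.1) *
        ((fact i.1 * fact i.2.1 : ℕ) : ℝ) ^ s)) :=
        mul_le_mul_of_nonneg_left (hK i.1 i.2.1) (by positivity)
    _ = _ := by ring

theorem one_le_fact_mul (a b : MIdx d) : (1 : ℝ) ≤ (fact a * fact b : ℕ) := by
  exact_mod_cast Nat.mul_pos (fact_pos _) (fact_pos _)

/-- In every Gelfand–Shilov space of Roumieu type, the Hermite functions grow subexponentially. -/
theorem exists_step_gsNorm_hermiteS_le (d : ℕ) {s : ℝ} (hs : 1 / 2 ≤ s) {δ : ℝ} (hδ : 0 < δ) :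
    ∃ h, ∃ C : ℝ, 0 ≤ C ∧ ∀ α : MIdx d,
      (gsScale d s).N h (hermiteS α) ≤ ENNReal.ofReal (C * Real.exp (δ * len α)) := by
  obtain ⟨C, K, hC, hK, h⟩ := exists_gsFunctional_hermiteS_le d hδ
  -- The step depends on `δ` through `K`. This is allowed, since continuous seminorms on the
  -- inductive limit are bounded on every step.
  refine ⟨⟨K, hK⟩, C * 1, by positivity, fun α =>
    gsNorm_hermiteS_le hC.le (fun i => h i α) fun a b => ?_⟩
  rw [one_mul]
  gcongr
  exact one_le_fact_mul a b

/-- In every Gelfand–Shilov space of Beurling type, the Hermite functions grow subexponentially. -/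
theorem exists_gsNorm_hermiteS_le (d : ℕ) {s : ℝ} (hs : 1 / 2 < s) (h : {ρ : ℝ // 0 < ρ}) {δ : ℝ}
    (hδ : 0 < δ) : ∃ C : ℝ, 0 ≤ C ∧ ∀ α : MIdx d,
      (gsScale d s).N h (hermiteS α) ≤ ENNReal.ofReal (C * Real.exp (δ * len α)) := by
  obtain ⟨C, K, hC, hK, hi⟩ := exists_gsFunctional_hermiteS_le d hδ
  have hh : (0 : ℝ) < h := h.2
  set ε := s - 1 / 2 with hε
  have hε0 : 0 < ε := by linarith
  -- Chosen so that `y ^ n ≤ exp y * n!` gives `(K/h) ^ n ≤ (exp y * P) ^ ε`: the surplus `P ^ ε` of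
  -- the factorials pays for shrinking `K` to the prescribed `h`.
  set y : ℝ := (K / h) ^ ε⁻¹ * 2 ^ (d + 1) with hy
  have hy0 : 0 < y := by positivity
  refine ⟨C * Real.exp y ^ ε, by positivity, fun α =>
    gsNorm_hermiteS_le hC.le (fun i => hi i α) fun a b => ?_⟩
  have hfac : ((len a + len b)! : ℝ) ≤
      (2 ^ (d + 1)) ^ (len a + len b) * ((fact a * fact b : ℕ) : ℝ) := by
    exact_mod_cast factorial_len_add_le a b
  set n := len a + len b
  set P : ℝ := ((fact a * fact b : ℕ) : ℝ) with hP
  have hP0 : 0 < P := zero_lt_one.trans_le (one_le_fact_mul a b)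
  have h1 : ((K / h) ^ ε⁻¹) ^ n ≤ Real.exp y * P := by
    have h2 := Real.pow_div_factorial_le_exp y hy0.le n
    rw [div_le_iff₀ (by positivity)] at h2
    have h4 : y ^ n ≤ Real.exp y * ((2 ^ (d + 1)) ^ n * P) := h2.trans (by gcongr)
    rw [hy, mul_pow] at h4
    have h5 : (0 : ℝ) < (2 ^ (d + 1)) ^ n := by positivity
    refine le_of_mul_le_mul_right (h4.trans_eq ?_) h5
    rw [hy]
    ring
  have h2 : (K / h) ^ n ≤ Real.exp y ^ ε * P ^ ε := by
    have h3 := Real.rpow_le_rpow (by positivity) h1 hε0.le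
    rw [Real.mul_rpow (Real.exp_nonneg _) hP0.le, ← Real.rpow_natCast, ← Real.rpow_mul (by positivity),
      ← Real.rpow_mul (by positivity)] at h3
    rw [← Real.rpow_natCast]
    convert h3 using 2
    field_simp
  have h3 : P ^ s = P ^ ε * P ^ (1 / 2 : ℝ) := by
    rw [← Real.rpow_add hP0, hε]
    ring_nf
  have h4 : K ^ n = (K / h) ^ n * (h : ℝ) ^ n := by
    rw [← mul_pow, div_mul_cancel₀ _ hh.ne']
  rw [h3, h4]
  calc (K / h) ^ n * (h : ℝ) ^ n * P ^ (1 / 2 : ℝ)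
      ≤ (Real.exp y ^ ε * P ^ ε) * (h : ℝ) ^ n * P ^ (1 / 2 : ℝ) := by gcongr
    _ = _ := by ring

end

/-! ### Growth of the propagator along a ray of multi-indices -/

theorem eigen_add_single {d : ℕ} (ϱ : Fin d → ℂ) (c : ℂ) (α : MIdx d) (j : Fin d) (k : ℕ) :
    eigen ϱ c (α + Pi.single j k) = eigen ϱ c α + 2 * k * ϱ j := by
  have h : ∑ i, ((α + Pi.single j k : MIdx d) i : ℂ) * ϱ i = ∑ i, (α i : ℂ) * ϱ i + k * ϱ j := by
    have h1 : ∀ i, ((α + Pi.single j k : MIdx d) i : ℂ) * ϱ i =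
        (α i : ℂ) * ϱ i + if i = j then (k : ℂ) * ϱ j else 0 := by
      intro i
      rcases eq_or_ne i j with rfl | h
      · simp [add_mul]
      · simp [h]
    rw [Finset.sum_congr rfl fun i _ => h1 i, Finset.sum_add_distrib]
    simp
  rw [eigen, eigen, h]
  ring

theorem len_add_single {d : ℕ} (α : MIdx d) (j : Fin d) (k : ℕ) :
    len (α + Pi.single j k) = len α + k := by
  simp [len, Finset.sum_add_distrib]

theorem ofReal_mul_cpow {x : ℝ} (hx : 0 < x) (z : ℂ) {r : ℝ} (hr : r ≠ 0) :
    ((x : ℂ) * z) ^ (r : ℂ) = ((x ^ r : ℝ) : ℂ) * z ^ (r : ℂ) := by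
  have hr' : (r : ℂ) ≠ 0 := by exact_mod_cast hr
  rcases eq_or_ne z 0 with rfl | hz
  · simp [Complex.zero_cpow hr']
  · have hx' : (x : ℂ) ≠ 0 := by exact_mod_cast hx.ne'
    rw [Complex.cpow_def_of_ne_zero (mul_ne_zero hx' hz), Complex.log_ofReal_mul hx hz, add_mul,
      Complex.exp_add, Complex.cpow_def_of_ne_zero hz, Complex.ofReal_cpow hx.le,
      Complex.cpow_def_of_ne_zero hx', Complex.ofReal_log hx.le]

/-- On the cut the principal argument is `π`, and the logarithm is continuous there from the closed
upper half-plane. -/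
theorem tendsto_cpow_of_im_nonneg {z : ℕ → ℂ} {w : ℂ} (hw : w ∉ Complex.slitPlane) (hw0 : w ≠ 0)
    (hz : Tendsto z atTop (𝓝 w)) (him : ∀ k, 0 ≤ (z k).im) (s : ℂ) :
    Tendsto (fun k => z k ^ s) atTop (𝓝 (w ^ s)) := by
  rw [Complex.mem_slitPlane_iff, not_or, not_lt, not_not] at hw
  have hre : w.re < 0 := lt_of_le_of_ne hw.1 fun h => hw0 (Complex.ext h hw.2)
  have hlog : Tendsto (fun k => Complex.log (z k)) atTop (𝓝 (Complex.log w)) :=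
    (Complex.continuousWithinAt_log_of_re_neg_of_im_zero hre hw.2).tendsto.comp
      (tendsto_nhdsWithin_iff.2 ⟨hz, Eventually.of_forall him⟩)
  rw [Complex.cpow_def_of_ne_zero hw0]
  refine Tendsto.congr' ?_ (Complex.continuous_exp.continuousAt.tendsto.comp (hlog.mul_const s))
  filter_upwards [hz.eventually_ne hw0] with k hk
  rw [Complex.cpow_def_of_ne_zero hk]
  rfl

/-- The eigenvalue at `α + k e_j` is `2k (ϱ_j + μ_α/(2k))`. Off the cut, or for integer `r`, the
power is continuous at `ϱ_j` and the ray may start at `α = 0`; on the cut it starts where `Im μ_α ≥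
0`, so that `ϱ_j` is approached from above. -/
theorem exists_ray_growth {d : ℕ} {r : ℝ} (hr : 1 ≤ r) (c : ℂ) (ϱ : Fin d → ℂ)
    (hϱ : ∃ j, 0 < (ϱ j ^ (r : ℂ)).im ∧
      (ϱ j ∈ Complex.slitPlane ∨ (∃ k : ℕ, r = k) ∨ ∃ α : MIdx d, 0 ≤ (eigen ϱ c α).im)) :
    ∃ (a : ℕ → MIdx d) (m : ℕ) (L : ℝ), (∀ k, len (a k) = m + k) ∧ 0 < L ∧
      ∀ᶠ k in atTop, L * k ≤ (eigenPow ϱ c r (a k)).im := by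
  obtain ⟨j, hj, hcase⟩ := hϱ
  have hr0 : r ≠ 0 := by linarith
  have hϱ0 : ϱ j ≠ 0 := by
    intro h
    rw [h, Complex.zero_cpow (by exact_mod_cast hr0)] at hj
    simp at hj
  have hz : ∀ α : MIdx d, Tendsto (fun k : ℕ => ϱ j + eigen ϱ c α * ((2 * k : ℝ)⁻¹ : ℝ)) atTop
      (𝓝 (ϱ j)) := by
    intro α
    have h1 : Tendsto (fun k : ℕ => (2 * k : ℝ)⁻¹) atTop (𝓝 0) :=
      (tendsto_natCast_atTop_atTop.const_mul_atTop (by norm_num)).inv_tendsto_atTop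
    have h2 := ((Complex.continuous_ofReal.tendsto 0).comp h1).const_mul (eigen ϱ c α)
    simpa using h2.const_add (ϱ j)
  have hlim : ∃ α : MIdx d, Tendsto (fun k : ℕ =>
      (ϱ j + eigen ϱ c α * ((2 * k : ℝ)⁻¹ : ℝ)) ^ (r : ℂ)) atTop (𝓝 (ϱ j ^ (r : ℂ))) := by
    by_cases hs : ϱ j ∈ Complex.slitPlane
    · exact ⟨0, (continuousAt_cpow_const hs).tendsto.comp (hz 0)⟩
    rcases hcase.resolve_left hs with ⟨n, rfl⟩ | ⟨α, hα⟩
    · simp only [Complex.ofReal_natCast, Complex.cpow_natCast]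
      exact ⟨0, (hz 0).pow n⟩
    · refine ⟨α, tendsto_cpow_of_im_nonneg hs hϱ0 (hz α) (fun k => ?_) _⟩
      have him : (ϱ j).im = 0 := by
        rw [Complex.mem_slitPlane_iff, not_or, not_not] at hs
        exact hs.2
      rw [Complex.add_im, him, zero_add, Complex.im_mul_ofReal]
      positivity
  obtain ⟨α, hα⟩ := hlim
  refine ⟨fun k => α + Pi.single j k, len α, (ϱ j ^ (r : ℂ)).im, len_add_single α j, hj, ?_⟩
  have him := (Complex.continuous_im.tendsto _).comp hα
  -- Half of the limit is given away here, and the factor `2` in `(2k) ^ r ≥ 2k` restores it, so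
  -- that `L` is the full imaginary part of `ϱ_j ^ r`.
  filter_upwards [him.eventually (lt_mem_nhds (half_lt_self hj)), eventually_ge_atTop 1]
    with k hk hk1
  have hk1' : (1 : ℝ) ≤ k := by exact_mod_cast hk1
  have h2k : (0 : ℝ) < 2 * k := by linarith
  have h1 : eigen ϱ c (α + Pi.single j k) =
      ((2 * k : ℝ) : ℂ) * (ϱ j + eigen ϱ c α * ((2 * k : ℝ)⁻¹ : ℝ)) := by
    have h3 : ((2 * k : ℝ) : ℂ) * ((2 * k : ℝ)⁻¹ : ℝ) = 1 := by
      rw [← Complex.ofReal_mul, mul_inv_cancel₀ h2k.ne', Complex.ofReal_one]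
    rw [eigen_add_single]
    push_cast at h3 ⊢
    linear_combination (-eigen ϱ c α) * h3
  rw [eigenPow, h1, ofReal_mul_cpow h2k _ hr0, Complex.im_ofReal_mul]
  have h4 : (2 * k : ℝ) ≤ (2 * k) ^ r := by
    calc (2 * k : ℝ) = (2 * k) ^ (1 : ℝ) := (Real.rpow_one _).symm
      _ ≤ _ := Real.rpow_le_rpow_of_exponent_le (by linarith) hr
  simp only [Function.comp_apply] at hk
  calc (ϱ j ^ (r : ℂ)).im * k = (2 * k) * ((ϱ j ^ (r : ℂ)).im / 2) := by ring
    _ ≤ (2 * k : ℝ) ^ r * ((ϱ j ^ (r : ℂ)).im / 2) := by gcongr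
    _ ≤ _ := by gcongr

/-! ### Ill-posedness from a sequence of eigenvectors -/

theorem norm_propagator {d : ℕ} (ϱ : Fin d → ℂ) (c : ℂ) (r t : ℝ) (α : MIdx d) :
    ‖propagator ϱ c r t α‖ = Real.exp (t * (eigenPow ϱ c r α).im) := by
  rw [propagator, Complex.norm_exp]
  congr 1
  simp [mul_assoc]

theorem IsSolution.add_eigenvector {d : ℕ} {ϱ : Fin d → ℂ} {c : ℂ} {r T : ℝ} {X : Type*}
    [AddCommGroup X] [TopologicalSpace X] [Module ℂ X] {coef : X →ₗ[ℂ] Seq d} {F : ℝ → Seq d}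
    {u₀ : X} {u : ℝ → X} (hu : IsSolution ϱ c r T coef F u₀ u) {a : MIdx d} {e : X}
    (he : ∀ β, coef e β = if a = β then 1 else 0) (z : ℂ) :
    IsSolution ϱ c r T coef F (u₀ + z • e) fun t => u t + (z * propagator ϱ c r t a) • e := by
  intro β
  obtain ⟨hF, hui, hue⟩ := hu β
  have h1 : ∀ t, coef (u t + (z * propagator ϱ c r t a) • e) β =
      coef (u t) β + propagator ϱ c r t β * coef (z • e) β := by
    intro t
    simp only [map_add, map_smul, Pi.add_apply, Pi.smul_apply, he, smul_eq_mul]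
    split_ifs with h
    · rw [h]; ring
    · ring
  have hpc : Continuous fun t => propagator ϱ c r t β * coef (z • e) β :=
    (continuous_cexp_mul _).mul continuous_const
  refine ⟨hF, ?_, fun t ht => ?_⟩
  · simp only [h1]
    exact hui.add hpc.continuousOn.integrableOn_Icc
  · simp only [h1]
    have i1 : IntervalIntegrable
        (fun s => eigenPow ϱ c r β * (propagator ϱ c r s β * coef (z • e) β)) volume 0 t :=
      (continuous_const.mul hpc).intervalIntegrable _ _
    have i2 : IntervalIntegrable
        (fun s => eigenPow ϱ c r β * coef (u s) β + F s β) volume 0 t :=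
      intervalIntegrable_of_mem_Icc ht ((hui.const_mul _).add hF)
    have h2 := integral_mul_exp (eigenPow ϱ c r β) (coef (z • e) β) t
    have h3 := hue t ht
    calc _ = Complex.I * (propagator ϱ c r t β * coef (z • e) β - coef (z • e) β) +
          Complex.I * (coef (u t) β - coef u₀ β) := by
          rw [map_add, Pi.add_apply]; ring
      _ = _ := by
        rw [h3]
        erw [h2]
        erw [← intervalIntegral.integral_add i1 i2]
        refine intervalIntegral.integral_congr fun s _ => ?_
        ring

/-- A perturbation of the data by `exp (-δ k) e_k` is eventually small, yet at time `t` it has been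
multiplied by at least `exp (t L k)`. With `δ = tL/2` the result has size at least `exp (δ k)`. -/
theorem illPosed_of_eigenvectors {d : ℕ} {ϱ : Fin d → ℂ} {c : ℂ} {r T : ℝ} (hT : 0 < T)
    {X : Type*} [AddCommGroup X] [TopologicalSpace X] [Module ℂ X] (coef : X →ₗ[ℂ] Seq d)
    {a : ℕ → MIdx d} {L : ℝ} (hL : 0 < L)
    (hgrowth : ∀ᶠ k : ℕ in atTop, L * k ≤ (eigenPow ϱ c r (a k)).im) (e : ℕ → X)
    (he : ∀ k β, coef (e k) β = if a k = β then 1 else 0)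
    (hsmall : ∀ δ : ℝ, 0 < δ →
      Tendsto (fun k : ℕ => ((Real.exp (-(δ * k)) : ℝ) : ℂ) • e k) atTop (𝓝 0))
    (hlarge : ∀ δ : ℝ, 0 < δ → ∃ V ∈ 𝓝 (0 : X), ∀ᶠ k : ℕ in atTop, ∀ z : ℂ,
      Real.exp (δ * k) ≤ ‖z‖ → z • e k ∉ V) :
    IllPosed ϱ c r T coef := by
  intro F
  have key : ∀ (u₀ : X) (u : ℝ → X), IsSolution ϱ c r T coef F u₀ u →
      ∀ t ∈ Ioc 0 T, ¬ DependsContinuously ϱ c r T coef F {t} := by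
    intro u₀ u hu t ht hdc
    have hδ : 0 < t * L / 2 := by have := ht.1; positivity
    obtain ⟨V, hV, hVl⟩ := hlarge _ hδ
    obtain ⟨U, hU, hUV⟩ := hdc u₀ u hu V hV
    obtain ⟨k, hk1, hk2, hk3⟩ :=
      (hgrowth.and (hVl.and ((hsmall _ hδ).eventually_mem hU))).exists
    set z : ℂ := ((Real.exp (-(t * L / 2 * k)) : ℝ) : ℂ)
    have h := hUV _ _ (hu.add_eigenvector (he k) z) (by rwa [add_sub_cancel_left]) t rfl
    rw [add_sub_cancel_left] at h
    refine hk2 _ ?_ h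
    rw [norm_mul, norm_propagator, Complex.norm_real, Real.norm_of_nonneg (Real.exp_nonneg _),
      ← Real.exp_add]
    refine Real.exp_le_exp.2 ?_
    have := mul_le_mul_of_nonneg_left hk1 ht.1.le
    linarith
  refine ⟨fun h => ?_, fun ⟨u₀, u, hu⟩ => key u₀ u hu⟩
  -- Well-posedness itself supplies a solution to perturb, and uniform continuity on `[0,T]`
  -- specializes to `t = T`.
  obtain ⟨u, hu, -⟩ := h.1 0
  refine key 0 u hu T (right_mem_Ioc.2 hT) fun u₀ u hu V hV => ?_
  obtain ⟨U, hU, hUV⟩ := h.2 u₀ u hu V hV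
  refine ⟨U, hU, fun v₀ v hv hvU t ht => hUV v₀ v hv hvU t ?_⟩
  rw [mem_singleton_iff.1 ht]
  exact right_mem_Icc.2 hT.le

/-! ### Ill-posedness in test function spaces and their duals -/

section
variable {d : ℕ} {Φ ι : Type*} [AddCommGroup Φ] [Module ℂ Φ] [TopologicalSpace Φ]

/-- A space of Schwartz functions, continuously included in `L^1`, that contains the Hermite
functions and whose seminorms grow subexponentially on them. -/
structure HermiteTestSpace (p : SeminormFamily ℂ Φ ι) (incl : Φ →ₗ[ℂ] 𝓢(Eucl d, ℂ))
    (H : MIdx d → Φ) : Prop where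
  withSeminorms : WithSeminorms p
  injective : Function.Injective incl
  incl_hermite : ∀ α, incl (H α) = hermiteS α
  seminorm_le : ∀ i, ∀ δ : ℝ, 0 < δ → ∃ C : ℝ, 0 ≤ C ∧ ∀ α, p i (H α) ≤ C * Real.exp (δ * len α)
  continuous_l1 : Continuous ((l1Seminorm d).comp incl)

theorem exists_le_exp_of_len {C δ : ℝ} {m : ℕ} {a : ℕ → MIdx d} (ha : ∀ k, len (a k) = m + k)
    (k : ℕ) : C * Real.exp (δ * len (a k)) = C * Real.exp (δ * m) * Real.exp (δ * k) := by
  rw [ha, mul_assoc, ← Real.exp_add]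
  push_cast
  ring_nf

theorem exp_neg_mul_exp_half (δ x : ℝ) :
    Real.exp (-(δ * x)) * Real.exp (δ / 2 * x) = Real.exp (-(δ / 2 * x)) := by
  rw [← Real.exp_add]
  ring_nf

theorem tendsto_mul_exp_neg (C : ℝ) {δ : ℝ} (hδ : 0 < δ) :
    Tendsto (fun k : ℕ => C * Real.exp (-(δ * k))) atTop (𝓝 0) := by
  have h1 : Tendsto (fun k : ℕ => δ * (k : ℝ)) atTop atTop :=
    tendsto_natCast_atTop_atTop.const_mul_atTop hδ
  simpa using (Real.tendsto_exp_neg_atTop_nhds_zero.comp h1).const_mul C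

theorem eventually_lt_exp (C : ℝ) {δ : ℝ} (hδ : 0 < δ) :
    ∀ᶠ k : ℕ in atTop, C < Real.exp (δ * k) := by
  have h1 : Tendsto (fun k : ℕ => δ * (k : ℝ)) atTop atTop :=
    tendsto_natCast_atTop_atTop.const_mul_atTop hδ
  exact (Real.tendsto_exp_atTop.comp h1).eventually_gt_atTop C

theorem exists_wordBound_zero_le (d : ℕ) {δ : ℝ} (hδ : 0 < δ) :
    ∃ C : ℝ, 0 < C ∧ ∀ m : ℕ, wordBound d 0 m ≤ C * Real.exp (δ * m) := by
  obtain ⟨C, K, hC, -, h⟩ := exists_wordBound_le d hδ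
  exact ⟨C, hC, fun m => by simpa using h 0 m⟩

variable {p : SeminormFamily ℂ Φ ι} {incl : Φ →ₗ[ℂ] 𝓢(Eucl d, ℂ)} {H : MIdx d → Φ}

/-- The Hermite coefficients as a linear map. -/
def coefLin (d : ℕ) : 𝓢(Eucl d, ℂ) →ₗ[ℂ] Seq d := LinearMap.pi coefS

theorem HermiteTestSpace.illPosed (hΦ : HermiteTestSpace p incl H) {ϱ : Fin d → ℂ} {c : ℂ}
    {r T : ℝ} (hT : 0 < T) {a : ℕ → MIdx d} {m : ℕ} {L : ℝ} (ha : ∀ k, len (a k) = m + k)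
    (hL : 0 < L) (hgrowth : ∀ᶠ k : ℕ in atTop, L * k ≤ (eigenPow ϱ c r (a k)).im) :
    IllPosed ϱ c r T (X := Φ) fun f => schwartzCoef (incl f) := by
  refine illPosed_of_eigenvectors hT (coefLin d ∘ₗ incl) hL hgrowth (fun k => H (a k))
    (fun k β => ?_) (fun δ hδ => ?_) (fun δ hδ => ?_)
  · change schwartzCoef (incl (H (a k))) β = _
    rw [hΦ.incl_hermite, schwartzCoef_hermiteS]
  · rw [hΦ.withSeminorms.tendsto_nhds]
    intro i ε hε
    obtain ⟨C, -, hC⟩ := hΦ.seminorm_le i (δ / 2) (half_pos hδ)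
    filter_upwards [(tendsto_mul_exp_neg (C * Real.exp (δ / 2 * m))
      (half_pos hδ)).eventually (gt_mem_nhds hε)] with k hk
    refine lt_of_le_of_lt ?_ hk
    rw [sub_zero, map_smul_eq_mul, Complex.norm_real, Real.norm_of_nonneg (Real.exp_nonneg _),
      ← exp_neg_mul_exp_half]
    calc _ ≤ Real.exp (-(δ * k)) * (C * Real.exp (δ / 2 * len (a k))) := by gcongr; exact hC _
      _ = _ := by rw [exists_le_exp_of_len ha]; ring
  -- The unit ball of the `L^1` norm is the neighbourhood to be avoided: a subexponentially small
  -- lower bound for `‖h_α‖₁` loses against `exp (δ k)`.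
  · obtain ⟨C, hC0, hC⟩ := exists_wordBound_zero_le d (half_pos hδ)
    refine ⟨_, Seminorm.ball_mem_nhds hΦ.continuous_l1 one_pos, ?_⟩
    filter_upwards [eventually_lt_exp (C * Real.exp (δ / 2 * m)) (half_pos hδ)] with k hk z hz hmem
    rw [Seminorm.mem_ball_zero, map_smul_eq_mul, Seminorm.comp_apply, hΦ.incl_hermite] at hmem
    have h1 := norm_schwartzCoef_le (hermiteS (a k)) (a k)
    rw [schwartzCoef_hermiteS, if_pos rfl, norm_one] at h1
    have h2 : wordBound d 0 (len (a k)) ≤ C * Real.exp (δ / 2 * m) * Real.exp (δ / 2 * k) := by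
      rw [← exists_le_exp_of_len ha]
      exact hC _
    set q := l1Seminorm d (hermiteS (a k))
    have hq : 0 ≤ q := apply_nonneg _ _
    have h3 : Real.exp (δ * k) = Real.exp (δ / 2 * k) * Real.exp (δ / 2 * k) := by
      rw [← Real.exp_add]; ring_nf
    have h4 : wordBound d 0 (len (a k)) ≤ Real.exp (δ * k) := by
      rw [h3]
      exact h2.trans (by gcongr)
    have h5 : 1 ≤ ‖z‖ * q := h1.trans (by gcongr; exact h4.trans hz)
    linarith

theorem HermiteTestSpace.continuous_coef (hΦ : HermiteTestSpace p incl H) (α : MIdx d) :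
    Continuous (coefS α ∘ₗ incl) := by
  have := hΦ.withSeminorms.topologicalAddGroup
  refine continuous_of_continuousAt_zero _ ?_
  rw [ContinuousAt, map_zero]
  have h := ((hΦ.continuous_l1.tendsto 0).const_mul (wordBound d 0 (len α)))
  rw [map_zero, mul_zero] at h
  exact squeeze_zero_norm (fun f => norm_schwartzCoef_le (incl f) α) h

/-- The Hermite functions as functionals on a space of test functions. -/
def HermiteTestSpace.functional (hΦ : HermiteTestSpace p incl H) (α : MIdx d) : StrongDual ℂ Φ :=
  ⟨coefS α ∘ₗ incl, hΦ.continuous_coef α⟩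

theorem HermiteTestSpace.functional_apply (hΦ : HermiteTestSpace p incl H) (α : MIdx d) (f : Φ) :
    hΦ.functional α f = schwartzCoef (incl f) α := rfl

/-- Injectivity of the inclusion identifies the chosen preimage of `h_α` with `H α`. -/
theorem HermiteTestSpace.dualCoef_eq (hΦ : HermiteTestSpace p incl H) (u : StrongDual ℂ Φ)
    (α : MIdx d) : dualCoef (fun f => ⇑(incl f)) u α = u (H α) := by
  have h : ∃ f, (fun f => ⇑(incl f)) f = hermiteFn α :=
    ⟨H α, by simp only [hΦ.incl_hermite]; rfl⟩
  rw [dualCoef, dif_pos h]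
  congr 1
  refine hΦ.injective (DFunLike.coe_injective ?_)
  rw [hΦ.incl_hermite]
  exact h.choose_spec

/-- The Hermite coefficients of functionals as a linear map. -/
def HermiteTestSpace.dualCoefLin (hΦ : HermiteTestSpace p incl H) :
    StrongDual ℂ Φ →ₗ[ℂ] Seq d where
  toFun := dualCoef fun f => ⇑(incl f)
  map_add' u v := funext fun α => by
    simp only [Pi.add_apply, hΦ.dualCoef_eq]
    rfl
  map_smul' z u := funext fun α => by
    simp only [Pi.smul_apply, hΦ.dualCoef_eq]
    rfl

/-- The two properties of the test space exchange roles. Bounded sets are bounded in `L^1`, so the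
functionals `h_α` grow at most polynomially on them; subexponential seminorms make a scaled sequence
of Hermite functions bounded, and this detects large multiples. -/
theorem HermiteTestSpace.illPosed_dual (hΦ : HermiteTestSpace p incl H) {ϱ : Fin d → ℂ} {c : ℂ}
    {r T : ℝ} (hT : 0 < T) {a : ℕ → MIdx d} {m : ℕ} {L : ℝ} (ha : ∀ k, len (a k) = m + k)
    (hL : 0 < L) (hgrowth : ∀ᶠ k : ℕ in atTop, L * k ≤ (eigenPow ϱ c r (a k)).im) :
    IllPosed ϱ c r T (X := StrongDual ℂ Φ) (dualCoef fun f => ⇑(incl f)) := by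
  refine illPosed_of_eigenvectors hT hΦ.dualCoefLin hL hgrowth (fun k => hΦ.functional (a k))
    (fun k β => ?_) (fun δ hδ => ?_) (fun δ hδ => ?_)
  · change dualCoef (fun f => ⇑(incl f)) (hΦ.functional (a k)) β = _
    rw [hΦ.dualCoef_eq, hΦ.functional_apply, hΦ.incl_hermite, schwartzCoef_hermiteS]
    simp only [eq_comm]
  · rw [ContinuousLinearMap.hasBasis_nhds_zero.tendsto_right_iff]
    rintro ⟨S, V⟩ ⟨hS, hV⟩
    obtain ⟨ε, hε, hεV⟩ := Metric.mem_nhds_iff.1 hV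
    obtain ⟨R, hR0, hR⟩ := (hS (Seminorm.ball_mem_nhds hΦ.continuous_l1 one_pos)).exists_pos
    have hSR : ∀ f ∈ S, (l1Seminorm d).comp incl f ≤ R := by
      intro f hf
      obtain ⟨g, hg, rfl⟩ := hR (R : ℂ) (by simp [abs_of_pos hR0]) hf
      rw [Seminorm.mem_ball_zero] at hg
      simp only [map_smul_eq_mul, Complex.norm_real, Real.norm_of_nonneg hR0.le]
      nlinarith
    obtain ⟨C, hC0, hC⟩ := exists_wordBound_zero_le d (half_pos hδ)
    filter_upwards [(tendsto_mul_exp_neg (C * Real.exp (δ / 2 * m) * R)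
      (half_pos hδ)).eventually (gt_mem_nhds hε)] with k hk f hf
    refine hεV ?_
    rw [mem_ball_zero_iff]
    refine lt_of_le_of_lt ?_ hk
    change ‖((Real.exp (-(δ * k)) : ℝ) : ℂ) * schwartzCoef (incl f) (a k)‖ ≤ _
    rw [norm_mul, Complex.norm_real, Real.norm_of_nonneg (Real.exp_nonneg _),
      ← exp_neg_mul_exp_half]
    calc _ ≤ Real.exp (-(δ * k)) * ((C * Real.exp (δ / 2 * len (a k))) * R) := by
          gcongr
          refine (norm_schwartzCoef_le _ _).trans ?_
          exact mul_le_mul (hC _) (hSR f hf) (apply_nonneg _ _) (by positivity)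
      _ = _ := by rw [exists_le_exp_of_len ha]; ring
  -- The rate `δ/2` is large enough to keep this set bounded and small enough to leave `exp (δ k /
  -- 2) ≥ 1` when tested against `z • h_{a k}`.
  · let S : Set Φ := range fun k : ℕ => ((Real.exp (-(δ / 2 * k)) : ℝ) : ℂ) • H (a k)
    have hS : Bornology.IsVonNBounded ℂ S := by
      rw [hΦ.withSeminorms.isVonNBounded_iff_seminorm_bounded]
      intro i
      obtain ⟨C, hC0, hC⟩ := hΦ.seminorm_le i (δ / 2) (half_pos hδ)
      refine ⟨C * Real.exp (δ / 2 * m) + 1, by positivity, ?_⟩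
      rintro _ ⟨k, rfl⟩
      simp only [map_smul_eq_mul, Complex.norm_real, Real.norm_of_nonneg (Real.exp_nonneg _)]
      have h1 := hC (a k)
      rw [exists_le_exp_of_len ha] at h1
      have h2 : Real.exp (-(δ / 2 * k)) * Real.exp (δ / 2 * k) = 1 := by
        rw [← Real.exp_add, neg_add_cancel, Real.exp_zero]
      calc _ ≤ Real.exp (-(δ / 2 * k)) * (C * Real.exp (δ / 2 * m) * Real.exp (δ / 2 * k)) := by
            gcongr
        _ = C * Real.exp (δ / 2 * m) := by linear_combination (C * Real.exp (δ / 2 * m)) * h2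
        _ < _ := lt_add_one _
    refine ⟨{u | ∀ f ∈ S, u f ∈ Metric.ball (0 : ℂ) 1}, ContinuousLinearMap.hasBasis_nhds_zero.mem_of_mem
      (i := (S, Metric.ball (0 : ℂ) 1)) ⟨hS, Metric.ball_mem_nhds _ one_pos⟩,
      Eventually.of_forall fun k z hz hmem => ?_⟩
    have h := hmem _ ⟨k, rfl⟩
    rw [mem_ball_zero_iff] at h
    have h1 : (z • hΦ.functional (a k)) (((Real.exp (-(δ / 2 * k)) : ℝ) : ℂ) • H (a k)) =
        z * ((Real.exp (-(δ / 2 * k)) : ℝ) : ℂ) := by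
      change z * hΦ.functional (a k) _ = _
      rw [map_smul, hΦ.functional_apply, hΦ.incl_hermite, schwartzCoef_hermiteS, if_pos rfl,
        smul_eq_mul, mul_one]
    rw [h1, norm_mul, Complex.norm_real, Real.norm_of_nonneg (Real.exp_nonneg _)] at h
    have h2 : 1 ≤ Real.exp (δ * k) * Real.exp (-(δ / 2 * k)) := by
      rw [← Real.exp_add]
      refine Real.one_le_exp ?_
      have : 0 ≤ δ * k := by positivity
      linarith
    have h3 : Real.exp (δ * k) * Real.exp (-(δ / 2 * k)) ≤ ‖z‖ * Real.exp (-(δ / 2 * k)) := by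
      gcongr
    linarith

end

/-! ### The Schwartz and Gelfand–Shilov spaces as Hermite test spaces. -/

theorem hermiteTestSpace_schwartz (d : ℕ) :
    HermiteTestSpace (schwartzSeminormFamily ℂ (Eucl d) ℂ) LinearMap.id hermiteS where
  withSeminorms := schwartz_withSeminorms ℂ (Eucl d) ℂ
  injective := fun _ _ h => h
  incl_hermite _ := rfl
  seminorm_le i δ hδ := by
    obtain ⟨M, hM, h⟩ := exists_seminorm_hermiteS_le (d := d) i.1 i.2
    obtain ⟨C, K, hC, hK, h'⟩ := exists_wordBound_le d hδ
    refine ⟨M * C * (K ^ (i.1 + i.2) * √((i.1 + i.2)!)), by positivity, fun α => ?_⟩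
    calc _ ≤ _ := h α
      _ ≤ M * (C * Real.exp (δ * len α) * (K ^ (i.1 + i.2) * √((i.1 + i.2)!))) := by
          gcongr
          exact h' _ _
      _ = _ := by ring
  continuous_l1 := continuous_l1Seminorm

theorem hermiteTestSpace_roumieu (d : ℕ) {s : ℝ} (hs : 1 / 2 ≤ s) :
    ∃ H : MIdx d → GSRoumieu d s,
      HermiteTestSpace (gsScale d s).indSeminorm (NormScale.IndLim.val _) H := by
  obtain ⟨h, C, -, hC⟩ := exists_step_gsNorm_hermiteS_le d hs one_pos
  obtain ⟨H, hH⟩ : ∃ H : MIdx d → GSRoumieu d s,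
      ∀ α, NormScale.IndLim.val _ (H α) = hermiteS α :=
    ⟨fun α => ⟨hermiteS α, le_iSup (gsScale d s).step h
      ((hC α).trans_lt ENNReal.ofReal_lt_top)⟩, fun _ => rfl⟩
  refine ⟨H, ⟨NormScale.withSeminorms_indLim _,
      NormScale.IndLim.val_injective _, hH, fun q δ hδ => ?_, ?_⟩⟩
  -- A new step for each `δ`: the one used above for membership only gives the growth rate `1`.
  · obtain ⟨h, C, hC0, hC⟩ := exists_step_gsNorm_hermiteS_le d hs hδ
    obtain ⟨K, hK⟩ := q.2 h
    refine ⟨K * C, by positivity, fun α => ?_⟩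
    have hN : (gsScale d s).N h (NormScale.IndLim.val _ (H α)) ≤
        ENNReal.ofReal (C * Real.exp (δ * len α)) := (hH α).symm ▸ hC α
    have h1 : ENNReal.ofReal (q.1 (H α)) ≤ K * ENNReal.ofReal (C * Real.exp (δ * len α)) :=
      (hK (H α) (hN.trans_lt ENNReal.ofReal_lt_top)).trans (by gcongr)
    rw [← ENNReal.ofReal_coe_nnreal, ← ENNReal.ofReal_mul K.coe_nonneg] at h1
    rw [mul_assoc]
    exact (ENNReal.ofReal_le_ofReal_iff (by positivity)).1 h1
  · exact (NormScale.withSeminorms_indLim (gsScale d s)).continuous_seminorm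
      ⟨(l1Seminorm d).comp (NormScale.IndLim.val _), fun ρ =>
        (exists_l1Seminorm_le_gs s ρ).imp fun C hC x _ => hC _⟩

theorem hermiteTestSpace_beurling (d : ℕ) {s : ℝ} (hs : 1 / 2 < s) :
    ∃ H : MIdx d → GSBeurling d s,
      HermiteTestSpace (gsScale d s).projSeminorm (NormScale.ProjLim.val _) H := by
  have hmem : ∀ α : MIdx d, hermiteS α ∈ ⨅ ρ, (gsScale d s).step ρ := fun α =>
    (Submodule.mem_iInf _).2 fun ρ => by
      obtain ⟨C, -, hC⟩ := exists_gsNorm_hermiteS_le d hs ρ one_pos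
      exact (hC α).trans_lt ENNReal.ofReal_lt_top
  refine ⟨fun α => ⟨hermiteS α, hmem α⟩, ⟨NormScale.withSeminorms_projLim _,
      NormScale.ProjLim.val_injective _, fun _ => rfl, fun ρ δ hδ => ?_, ?_⟩⟩
  · obtain ⟨C, hC0, hC⟩ := exists_gsNorm_hermiteS_le d hs ρ hδ
    exact ⟨C, hC0, fun α => ENNReal.toReal_le_of_le_ofReal (by positivity) (hC α)⟩
  · let ρ : {ρ : ℝ // 0 < ρ} := ⟨1, one_pos⟩
    obtain ⟨C, hC⟩ := exists_l1Seminorm_le_gs (d := d) s ρ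
    refine Seminorm.continuous_of_le (q := C • (gsScale d s).projSeminorm ρ) ?_ fun f => ?_
    · exact ((NormScale.withSeminorms_projLim (gsScale d s)).continuous_seminorm ρ).const_smul C
    · have hf := NormScale.ProjLim.lt_top (gsScale d s) f ρ
      have h1 := (ENNReal.ofReal_le_iff_le_toReal (ENNReal.mul_lt_top (by simp) hf).ne).1
        (hC (NormScale.ProjLim.val _ f))
      rw [ENNReal.toReal_mul] at h1
      exact h1

end Pilipovic

end

open Pilipovic SchwartzMap in
theorem corollary4p10 (d : ℕ) (r T : ℝ) (hr : 1 ≤ r) (hT : 0 < T) (c : ℂ) (ϱ : Fin d → ℂ)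
    (hϱ : ∃ j, 0 < (ϱ j ^ (r : ℂ)).im ∧
      (ϱ j ∈ Complex.slitPlane ∨ (∃ k : ℕ, r = k) ∨ ∃ α : MIdx d, 0 ≤ (eigen ϱ c α).im)) :
    -- ill-posedness in the Schwartz space, the Gelfand–Shilov spaces and their duals
    (IllPosed ϱ c r T (X := 𝓢(Eucl d, ℂ)) schwartzCoef ∧
      IllPosed ϱ c r T (X := StrongDual ℂ 𝓢(Eucl d, ℂ)) (dualCoef fun f => ⇑f) ∧
      (∀ s : ℝ, 1 / 2 ≤ s →
        IllPosed ϱ c r T (X := GSRoumieu d s)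
          (fun f => schwartzCoef (NormScale.IndLim.val _ f)) ∧
        IllPosed ϱ c r T (X := StrongDual ℂ (GSRoumieu d s))
          (dualCoef fun f => ⇑(NormScale.IndLim.val _ f))) ∧
      (∀ s : ℝ, 1 / 2 < s →
        IllPosed ϱ c r T (X := GSBeurling d s)
          (fun f => schwartzCoef (NormScale.ProjLim.val _ f)) ∧
        IllPosed ϱ c r T (X := StrongDual ℂ (GSBeurling d s))
          (dualCoef fun f => ⇑(NormScale.ProjLim.val _ f)))) ∧
    -- well-posedness in Pilipović spaces and their duals
    (∀ s₁ s₂ : PilOrder, 0 < s₁ → s₁ ≤ .real (1 / (2 * r)).toNNReal →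
      s₂ < .real (1 / (2 * r)).toNNReal →
      WellPosedWithPropagators ϱ c r T
        (X := HBeurling d s₁) (NormScale.ProjLim.val _)
        (Y := L1HBeurling d T s₁) (fun F => ⇑(NormScale.ProjLim.val _ F)) ∧
      WellPosedWithPropagators ϱ c r T
        (X := HRoumieu d s₂) (NormScale.IndLim.val _)
        (Y := L1HRoumieu d T s₂) (fun F => ⇑(NormScale.IndLim.val _ F)) ∧
      WellPosedWithPropagators ϱ c r T
        (X := HRoumieuDual d s₂) (NormScale.ProjLim.val _)
        (Y := L1HRoumieuDual d T s₂) (fun F => ⇑(NormScale.ProjLim.val _ F)) ∧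
      WellPosedWithPropagators ϱ c r T
        (X := HBeurlingDual d s₁) (NormScale.IndLim.val _)
        (Y := L1HBeurlingDual d T s₁) (fun F => ⇑(NormScale.IndLim.val _ F))) := by
  obtain ⟨a, m, L, ha, hL, hg⟩ := exists_ray_growth hr c ϱ hϱ
  refine ⟨⟨(hermiteTestSpace_schwartz d).illPosed hT ha hL hg,
    (hermiteTestSpace_schwartz d).illPosed_dual hT ha hL hg, fun s hs => ?_, fun s hs => ?_⟩,
    fun s₁ s₂ h0 h1 h2 => wellPosed_pilipovic hr hT s₁ s₂ h0 h1 h2⟩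
  · obtain ⟨H, hH⟩ := hermiteTestSpace_roumieu d hs
    exact ⟨hH.illPosed hT ha hL hg, hH.illPosed_dual hT ha hL hg⟩
  · obtain ⟨H, hH⟩ := hermiteTestSpace_beurling d hs
    exact ⟨hH.illPosed hT ha hL hg, hH.illPosed_dual hT ha hL hg⟩
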